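/- Let $\mathbb{K}$ be a field of characteristic zero and $n$ a positive integer. Let $R_n=\mathbb{K}[x_{\{i,j\}} : 1\le i<j\le n]$ be the polynomial ring in $\binom n2$ variables indexed by the pairs of vertices in $\{1,\dots,n\}$. The symmetric group $\mathfrak S_n$ acts on $R_n$ by $\sigma\cdot x_{\{i,j\}}=x_{\{\sigma(i),\sigma(j)\}}$; let $\mathcal I_n=R_n^{\mathfrak S_n}$ be the ring of invariant polynomials. A (labelled, loopless) multigraph on $\{1,\dots,n\}$ is a family $g=(g_{\{i,j\}})$ of weights in $\mathbb N=\{0,1,2,\dots\}$ indexed by the pairs. It is a simple graph if all its weights are in $\{0,1\}$, and a vertex $v$ is isolated in $g$ if $g_{\{v,j\}}=0$ for all $j\ne v$. For a multigraph $g$, let $$\exp(g)=\sum_{h}\ \prod_{\{i,j\}}x_{\{i,j\}}^{h_{\{i,j\}}}\in\mathcal I_n,$$ where $h$ runs over the distinct multigraphs in the orbit of $g$ under permutations of the vertices. A subset of $\mathcal I_n$ is generating if every element of $\mathcal I_n$ is a polynomial with coefficients in $\mathbb{K}$ in elements of the subset. Then: (i) For every $n\ge5$, the set of all $\exp(g)$,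 where $g$ is a simple graph on $\{1,\dots,n\}$, does not generate $\mathcal I_n$. (ii) For every $n$ with $11\le n\le18$, the set of all $\exp(g)$, where $g$ is a multigraph on $\{1,\dots,n\}$ with at least one isolated vertex, does not generate $\mathcal I_n$. -/

import Mathlib

namespace GraphInvariants

/-- The pairs `{i, j}` of distinct vertices among `n` vertices. -/
abbrev Edge (n : ℕ) : Type := {e : Sym2 (Fin n) // ¬ e.IsDiag}

/-- The action of a permutation of the vertices on pairs: `{i, j} ↦ {σ i, σ j}`. -/
def edgePerm {n : ℕ} (σ : Equiv.Perm (Fin n)) : Equiv.Perm (Edge n) where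
  toFun e := ⟨Sym2.map σ e.1, by rw [Sym2.isDiag_map σ.injective]; exact e.2⟩
  invFun e := ⟨Sym2.map σ.symm e.1, by rw [Sym2.isDiag_map σ.symm.injective]; exact e.2⟩
  left_inv e := Subtype.ext (by simp [Sym2.map_map])
  right_inv e := Subtype.ext (by simp [Sym2.map_map])

theorem edgePerm_mk {n : ℕ} (σ : Equiv.Perm (Fin n)) (i j : Fin n)
    (h : ¬ (s(i, j) : Sym2 (Fin n)).IsDiag) :
    (edgePerm σ ⟨s(i, j), h⟩ : Sym2 (Fin n)) = s(σ i, σ j) := rfl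

theorem edgePerm_mul {n : ℕ} (σ τ : Equiv.Perm (Fin n)) :
    edgePerm (σ * τ) = edgePerm σ * edgePerm τ := by
  refine Equiv.ext fun ⟨e, he⟩ => Subtype.ext ?_
  induction e using Sym2.ind with
  | _ i j => rfl

/-- The invariant ring over graphs: the polynomials in the variables `x_{i, j}` that are fixed by
all permutations of the `n` vertices, acting by `x_{i, j} ↦ x_{σ i, σ j}`. -/
def Inv (K : Type*) [Field K] (n : ℕ) : Subalgebra K (MvPolynomial (Edge n) K) where
  carrier := {p | ∀ σ : Equiv.Perm (Fin n), MvPolynomial.rename (edgePerm σ) p = p}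
  mul_mem' := fun ha hb σ => by rw [map_mul, ha σ, hb σ]
  add_mem' := fun ha hb σ => by rw [map_add, ha σ, hb σ]
  algebraMap_mem' := fun r σ => AlgHom.commutes _ r

/-- Labelled loopless multigraphs on `n` vertices: a weight in `ℕ` on every pair. -/
abbrev Multigraph (n : ℕ) : Type := Edge n →₀ ℕ

namespace Multigraph

variable {n : ℕ}

/-- The multigraph `σ · g`, in which the pair `{σ i, σ j}` has the weight of `{i, j}` in `g`. -/
noncomputable def relabel (σ : Equiv.Perm (Fin n)) (g : Multigraph n) : Multigraph n :=
  Finsupp.mapDomain (edgePerm σ) g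

/-- A simple graph: all weights are in `{0, 1}`. -/
def IsSimple (g : Multigraph n) : Prop := ∀ e, g e = 0 ∨ g e = 1

/-- The vertex `v` is isolated: every pair that contains it has weight zero. -/
def IsIsolated (g : Multigraph n) (v : Fin n) : Prop := ∀ e : Edge n, v ∈ e.1 → g e = 0

/-- The orbit of `g`: all labelled multigraphs isomorphic to `g`. -/
noncomputable def orbit (g : Multigraph n) : Finset (Multigraph n) :=
  Finset.univ.image fun σ : Equiv.Perm (Fin n) => g.relabel σ

theorem relabel_relabel (σ τ : Equiv.Perm (Fin n)) (g : Multigraph n) :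
    relabel σ (relabel τ g) = relabel (σ * τ) g := by
  unfold relabel
  rw [← Finsupp.mapDomain_comp, edgePerm_mul]
  rfl

theorem relabel_injective (σ : Equiv.Perm (Fin n)) :
    Function.Injective (relabel σ) :=
  Finsupp.mapDomain_injective (edgePerm σ).injective

theorem image_relabel_orbit (σ : Equiv.Perm (Fin n)) (g : Multigraph n) :
    (orbit g).image (relabel σ) = orbit g := by
  apply Finset.eq_of_subset_of_card_le
  · intro h hh
    simp only [orbit, Finset.mem_image, Finset.mem_univ, true_and,
      exists_exists_eq_and] at hh ⊢
    obtain ⟨τ, rfl⟩ := hh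
    exact ⟨σ * τ, (relabel_relabel σ τ g).symm⟩
  · rw [Finset.card_image_of_injective _ (relabel_injective σ)]

/-- The orbit sum of `g` as a polynomial: the sum over the distinct multigraphs `h` in the orbit
of `g` of the monomial `∏ e, x_e ^ h e`. -/
noncomputable def orbitSum (K : Type*) [Field K] (g : Multigraph n) :
    MvPolynomial (Edge n) K :=
  ∑ h ∈ g.orbit, MvPolynomial.monomial h 1

theorem orbitSum_mem (K : Type*) [Field K] (g : Multigraph n) :
    orbitSum K g ∈ Inv K n := by
  intro σ
  unfold orbitSum
  rw [map_sum]
  conv_rhs => rw [← image_relabel_orbit σ g]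
  rw [Finset.sum_image (fun a _ b _ h => relabel_injective σ h)]
  exact Finset.sum_congr rfl fun h _ => MvPolynomial.rename_monomial _ _ _

/-- The exponential of `g`: its orbit sum, as an element of the invariant ring. -/
noncomputable def exps (K : Type*) [Field K] (g : Multigraph n) : Inv K n :=
  ⟨orbitSum K g, orbitSum_mem K g⟩

end Multigraph

/-- A set of invariants generates the invariant ring as a `K`-algebra. -/
def Generates {K : Type*} [Field K] {n : ℕ} (S : Set (Inv K n)) : Prop :=
  Algebra.adjoin K S = ⊤

end GraphInvariants

/-! Part (i). Restrict invariants to points supported on a path with edge coordinates `t 0, …, t 3`,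
chosen so that `t 0 + t 1 + t 2 + t 3 = 0` and the sum of products over adjacent edges is zero.
There the degree-one part of an invariant with squarefree monomials vanishes, its degree-two part is
a multiple of the sum `Q` over pairs of disjoint edges, and its degree-four part is a multiple of `t
0 * t 1 * t 2 * t 3`. Hence any polynomial in such invariants has degree-four part `β * Q ^ 2 + γ *
t 0 * t 1 * t 2 * t 3`. The orbit sum of the cherry with both edges doubled restricts to `∑ t i ^ 2
* t (i + 1) ^ 2`, and three numerical points show that this is not of that form
(`expand_notMem_specialSubalgebra`).

Part (ii). This is a dimension count in degree 24. If `g` is a disjoint union of `a` and `b`, then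
`exp(a) * exp(b)` is a nonzero multiple of `exp(g)` plus terms with fewer non-isolated vertices. So,
if the graphs with an isolated vertex generate, the connected graphs on fewer than `n` vertices
generate too (`exps_mem_adjoin_connectedExps`), and the number of orbits of multigraphs with 24
edges is at most the number of degree-24 monomials in these connected generators
(`orbitCount_le_card_generatorMonomials`). For `11 ≤ n ≤ 18` this inequality fails
(`card_generatorMonomials_lt`).

The numbers come from one Newton identity, `mul_card_invMult`, used three times: for multigraphs
fixed by a permutation, which Burnside's lemma turns into numbers of orbits (`burnsideList_eq`); for
all graph classes in terms of connected ones, which determines the connected counts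
(`eq_of_newton`); and for the monomials in the connected generators. The second use rests on unique
decomposition into connected classes, proved from a refinement property (`total_injective`). The
numerical tables are not trusted: the kernel checks that they satisfy the identities that determine
them. -/

namespace GraphInvariants
open Finset

/-! ### Newton's identity for multiplicity functions fixed by a permutation -/

section Newton

set_option linter.unusedSectionVars false

variable {X : Type*} [Fintype X] [DecidableEq X]

/-- The multiplicity functions on `X` that are invariant under `τ`, with prescribed weights. -/
def invMult (τ : Equiv.Perm X) (v e : X → ℕ) (m j : ℕ) : Finset (X → ℕ) :=
  (Finset.Iic (fun _ => j)).filter fun f =>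
    (∀ x, f (τ x) = f x) ∧ ∑ x, f x * v x = m ∧ ∑ x, f x * e x = j

/-- The bounding box in `invMult` only serves finiteness: as the weights `e` are positive, the
equation in `j` already forces `f x ≤ j`. -/
theorem mem_invMult {τ : Equiv.Perm X} {v e : X → ℕ} (he : ∀ x, 1 ≤ e x) {m j : ℕ} {f : X → ℕ} :
    f ∈ invMult τ v e m j ↔
      (∀ x, f (τ x) = f x) ∧ ∑ x, f x * v x = m ∧ ∑ x, f x * e x = j := by
  simp only [invMult, mem_filter, mem_Iic, and_iff_right_iff_imp]
  rintro ⟨-, -, h⟩ x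
  calc f x ≤ f x * e x := Nat.le_mul_of_pos_right _ (he x)
    _ ≤ ∑ x, f x * e x := single_le_sum (f := fun x => f x * e x) (fun _ _ => Nat.zero_le _)
        (mem_univ x)
    _ = j := h

/-- The orbit of a point under iteration of a permutation. -/
noncomputable def iterOrbit (τ : Equiv.Perm X) (x : X) : Finset X :=
  (range (Function.minimalPeriod τ x)).image fun i => τ^[i] x

theorem minimalPeriod_pos_perm (τ : Equiv.Perm X) (x : X) : 0 < Function.minimalPeriod τ x :=
  Function.minimalPeriod_pos_of_mem_periodicPts (τ.injective.mem_periodicPts x)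

theorem self_mem_iterOrbit (τ : Equiv.Perm X) (x : X) : x ∈ iterOrbit τ x :=
  mem_image.2 ⟨0, mem_range.2 (minimalPeriod_pos_perm τ x), rfl⟩

theorem apply_mem_iterOrbit (τ : Equiv.Perm X) (x y : X) :
    τ y ∈ iterOrbit τ x ↔ y ∈ iterOrbit τ x := by
  have hp := minimalPeriod_pos_perm τ x
  have hs : τ^[Function.minimalPeriod τ x] x = x := Function.iterate_minimalPeriod
  simp only [iterOrbit, mem_image, mem_range]
  constructor
  · rintro ⟨i, hi, h⟩
    rcases i with _ | i
    · refine ⟨Function.minimalPeriod τ x - 1, by omega, τ.injective ?_⟩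
      rw [← Function.iterate_succ_apply' τ, ← h, Nat.succ_eq_add_one, Nat.sub_add_cancel hp, hs]
      rfl
    · refine ⟨i, by omega, τ.injective ?_⟩
      rw [← Function.iterate_succ_apply' τ, h]
  · rintro ⟨i, hi, rfl⟩
    rcases Nat.lt_or_ge (i + 1) (Function.minimalPeriod τ x) with h | h
    · exact ⟨i + 1, h, Function.iterate_succ_apply' _ _ _⟩
    · refine ⟨0, hp, ?_⟩
      rw [← Function.iterate_succ_apply' τ, show i.succ = Function.minimalPeriod τ x by omega, hs]
      rfl

theorem sum_iterOrbit (τ : Equiv.Perm X) (x : X) (v : X → ℕ) (hv : ∀ x, v (τ x) = v x) :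
    ∑ y ∈ iterOrbit τ x, v y = Function.minimalPeriod τ x * v x := by
  rw [iterOrbit, sum_image]
  · have : ∀ i, v (τ^[i] x) = v x := by
      intro i
      induction i with
      | zero => rfl
      | succ i ih => rw [Function.iterate_succ_apply', hv, ih]
    simp [this]
  · intro i hi j hj h
    exact Function.iterate_injOn_Iio_minimalPeriod (by simpa using hi) (by simpa using hj) h

theorem eq_of_mem_iterOrbit {τ : Equiv.Perm X} {x y : X} (h : y ∈ iterOrbit τ x) (f : X → ℕ)
    (hf : ∀ x, f (τ x) = f x) : f y = f x := by
  obtain ⟨i, -, rfl⟩ := mem_image.1 h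
  clear h
  induction i with
  | zero => rfl
  | succ i ih => rw [Function.iterate_succ_apply', hf, ih]

/-- An invariant function is constant on the orbit of `x`, so `i ≤ f x` allows `i` to be subtracted
on the whole orbit. This is a bijection onto invariant functions whose weights drop by `i` times the
orbit length times the weight of `x`. -/
theorem card_invMult_ge (τ : Equiv.Perm X) (v e : X → ℕ) (he : ∀ x, 1 ≤ e x)
    (hv : ∀ x, v (τ x) = v x) (he' : ∀ x, e (τ x) = e x) (m j : ℕ) (x : X) (i : ℕ) :
    #{f ∈ invMult τ v e m j | i ≤ f x} =
      if i * Function.minimalPeriod τ x * v x ≤ m ∧ i * Function.minimalPeriod τ x * e x ≤ j then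
        #(invMult τ v e (m - i * Function.minimalPeriod τ x * v x)
          (j - i * Function.minimalPeriod τ x * e x)) else 0 := by
  set s := Function.minimalPeriod τ x with hs
  let u : X → ℕ := fun y => if y ∈ iterOrbit τ x then i else 0
  have hu : ∀ y, u (τ y) = u y := fun y => by simp only [u, apply_mem_iterOrbit]
  have hsum : ∀ w : X → ℕ, (∀ x, w (τ x) = w x) → ∑ y, u y * w y = i * s * w x := by
    intro w hw
    simp only [u, ite_mul, zero_mul]
    rw [← sum_filter, filter_mem_eq_inter, univ_inter, ← mul_sum, sum_iterOrbit τ x w hw, mul_assoc]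
  have hle : ∀ f ∈ invMult τ v e m j, i ≤ f x → ∀ y, u y ≤ f y := by
    intro f hf hi y
    by_cases hy : y ∈ iterOrbit τ x
    · simp only [u, hy, if_true, eq_of_mem_iterOrbit hy f ((mem_invMult he).1 hf).1]; exact hi
    · simp [u, hy]
  have hsub : ∀ f ∈ invMult τ v e m j, i ≤ f x → ∀ w : X → ℕ, (∀ x, w (τ x) = w x) →
      ∑ y, (f y - u y) * w y + i * s * w x = ∑ y, f y * w y := by
    intro f hf hi w hw
    rw [← hsum w hw, ← sum_add_distrib]
    refine sum_congr rfl fun y _ => ?_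
    rw [← add_mul, Nat.sub_add_cancel (hle f hf hi y)]
  split_ifs with h
  · refine card_bij' (fun f _ y => f y - u y) (fun f _ y => f y + u y) ?_ ?_ ?_ ?_
    · intro f hf
      obtain ⟨hf, hi⟩ := mem_filter.1 hf
      have h1 := hsub f hf hi v hv
      have h2 := hsub f hf hi e he'
      obtain ⟨a, b, c⟩ := (mem_invMult he).1 hf
      refine (mem_invMult he).2 ⟨fun y => by rw [a, hu], by omega, by omega⟩
    · intro f hf
      obtain ⟨a, b, c⟩ := (mem_invMult he).1 hf
      refine mem_filter.2 ⟨(mem_invMult he).2 ⟨fun y => by rw [a, hu], ?_, ?_⟩, ?_⟩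
      · simp only [add_mul, sum_add_distrib, hsum v hv, b]; omega
      · simp only [add_mul, sum_add_distrib, hsum e he', c]; omega
      · simp [u, self_mem_iterOrbit]
    · intro f hf
      obtain ⟨hf, hi⟩ := mem_filter.1 hf
      funext y
      exact Nat.sub_add_cancel (hle f hf hi y)
    · intro f hf
      funext y
      exact Nat.add_sub_cancel ..
  · rw [card_eq_zero, filter_eq_empty_iff]
    intro f hf hi
    have h1 := hsub f hf hi v hv
    have h2 := hsub f hf hi e he'
    obtain ⟨a, b, c⟩ := (mem_invMult he).1 hf
    exact h ⟨by omega, by omega⟩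

theorem sum_Icc_dvd (s j : ℕ) (hs : 0 < s) (φ : ℕ → ℕ) (hφ : ∀ k, j < k → φ k = 0) :
    ∑ i ∈ Icc 1 j, φ (i * s) = ∑ k ∈ Icc 1 j with s ∣ k, φ k := by
  rw [← sum_filter_of_ne (s := Icc 1 j) (p := fun i => i * s ≤ j)]
  · refine sum_bij (fun i _ => i * s) ?_ ?_ ?_ ?_
    · intro i hi
      simp only [mem_filter, mem_Icc] at hi ⊢
      exact ⟨⟨Nat.mul_pos hi.1.1 hs, hi.2⟩, Dvd.intro_left i rfl⟩
    · intro i _ i' _ h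
      exact Nat.eq_of_mul_eq_mul_right hs h
    · intro k hk
      simp only [mem_filter, mem_Icc] at hk
      obtain ⟨⟨h1, h2⟩, i, rfl⟩ := hk
      refine ⟨i, ?_, mul_comm _ _⟩
      simp only [mem_filter, mem_Icc]
      refine ⟨⟨Nat.pos_of_mul_pos_left h1, ?_⟩, by rwa [mul_comm]⟩
      exact (Nat.le_mul_of_pos_left i hs).trans h2
    · intros; rfl
  · intro i _ h
    by_contra h'
    exact h (hφ _ (by omega))

/-- Newton's identity for the numbers of invariant multiplicity functions. -/
theorem mul_card_invMult (τ : Equiv.Perm X) (v e : X → ℕ) (he : ∀ x, 1 ≤ e x)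
    (hv : ∀ x, v (τ x) = v x) (he' : ∀ x, e (τ x) = e x) (m j : ℕ) :
    j * #(invMult τ v e m j) =
      ∑ x, ∑ k ∈ Icc 1 j, if (τ ^ k) x = x ∧ k * v x ≤ m ∧ k * e x ≤ j then
        e x * #(invMult τ v e (m - k * v x) (j - k * e x)) else 0 := by
  -- Double counting: each `f` has total weight `j = ∑ x, f x * e x`.
  have h1 : j * #(invMult τ v e m j) = ∑ x, e x * ∑ f ∈ invMult τ v e m j, f x := by
    simp only [mul_sum]
    rw [sum_comm, mul_comm, ← smul_eq_mul, ← sum_const]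
    refine sum_congr rfl fun f hf => ?_
    rw [← ((mem_invMult he).1 hf).2.2]
    exact sum_congr rfl fun x _ => mul_comm _ _
  rw [h1]
  refine sum_congr rfl fun x _ => ?_
  have h2 : ∑ f ∈ invMult τ v e m j, f x = ∑ i ∈ Icc 1 j, #{f ∈ invMult τ v e m j | i ≤ f x} := by
    simp only [card_filter]
    rw [sum_comm]
    refine sum_congr rfl fun f hf => ?_
    have : f x ≤ j := by
      have := (mem_filter.1 hf).1
      exact (mem_Iic.1 this) x
    rw [← card_filter, show (Icc 1 j).filter (fun i => i ≤ f x) = Icc 1 (f x) by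
      ext i; simp only [mem_filter, mem_Icc]; omega]
    simp
  rw [h2]
  simp only [card_invMult_ge τ v e he hv he']
  -- With `k` equal to `i` times the period of `x`, the sum over layers `i` becomes a sum over those
  -- `k` for which `τ ^ k` fixes `x`.
  rw [sum_Icc_dvd (Function.minimalPeriod τ x) j (minimalPeriod_pos_perm τ x) (fun k =>
    if k * v x ≤ m ∧ k * e x ≤ j then #(invMult τ v e (m - k * v x) (j - k * e x)) else 0)]
  · rw [sum_filter, mul_sum]
    refine sum_congr rfl fun k _ => ?_
    have : (τ ^ k) x = x ↔ Function.minimalPeriod τ x ∣ k := by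
      rw [← Function.isPeriodicPt_iff_minimalPeriod_dvd, Function.IsPeriodicPt,
        Function.IsFixedPt, Equiv.Perm.iterate_eq_pow]
    simp only [this]
    split_ifs <;> simp_all
  · intro k hk
    rw [if_neg]
    rintro ⟨-, h⟩
    have := Nat.le_mul_of_pos_right k (he x)
    omega

end Newton
end GraphInvariants
namespace GraphInvariants
open Finset

/-! ### Class functions on the symmetric group as sums over partitions -/

section CycleType

/-- The partitions of `r` into parts at most `k`, as lists of pairs (part, multiplicity). -/
def partitionLists : ℕ → ℕ → List (List (ℕ × ℕ))
  | 0, r => if r = 0 then [[]] else []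
  | k + 1, r => (List.range (r / (k + 1) + 1)).flatMap fun c =>
      (partitionLists k (r - (k + 1) * c)).map fun l => if c = 0 then l else (k + 1, c) :: l

/-- The multiset of parts given by a list of pairs (part, multiplicity). -/
def toParts (l : List (ℕ × ℕ)) : Multiset ℕ :=
  (l.map fun x => Multiset.replicate x.2 x.1).sum

theorem toParts_cons (x : ℕ × ℕ) (l : List (ℕ × ℕ)) :
    toParts (x :: l) = Multiset.replicate x.2 x.1 + toParts l := by
  simp [toParts]

theorem toParts_ite (k c : ℕ) (l : List (ℕ × ℕ)) :
    toParts (if c = 0 then l else (k + 1, c) :: l) =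
      Multiset.replicate c (k + 1) + toParts l := by
  split_ifs with h
  · simp [h]
  · exact toParts_cons _ _

theorem mem_map_toParts (k r : ℕ) (μ : Multiset ℕ) :
    μ ∈ (partitionLists k r).map toParts ↔ (∀ a ∈ μ, 1 ≤ a ∧ a ≤ k) ∧ μ.sum = r := by
  induction k generalizing r μ with
  | zero =>
    constructor
    · intro h
      simp only [partitionLists] at h
      split_ifs at h with hr
      · simp only [List.map_cons, List.map_nil, List.mem_singleton] at h
        subst h
        simp [toParts, hr]
      · simp at h
    · rintro ⟨h1, h2⟩
      have : μ = 0 := Multiset.eq_zero_of_forall_notMem fun a ha => by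
        have := h1 a ha
        omega
      subst this
      simp only [Multiset.sum_zero] at h2
      simp [partitionLists, ← h2, toParts]
  | succ k ih =>
    simp only [partitionLists, List.map_flatMap, List.mem_flatMap, List.map_map, List.mem_range]
    constructor
    · rintro ⟨c, hc, h⟩
      obtain ⟨l, hl, rfl⟩ := List.mem_map.1 h
      obtain ⟨h1, h2⟩ := (ih _ _).1 (List.mem_map_of_mem hl)
      simp only [Function.comp, toParts_ite]
      constructor
      · intro a ha
        rcases Multiset.mem_add.1 ha with ha | ha
        · rw [Multiset.eq_of_mem_replicate ha]
          omega
        · have := h1 a ha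
          omega
      · have hc' : (k + 1) * c ≤ r := by
          rw [mul_comm]
          exact (Nat.le_div_iff_mul_le (show 0 < k + 1 from Nat.succ_pos k)).1 (Nat.lt_succ_iff.1 hc)
        rw [Multiset.sum_add, Multiset.sum_replicate, h2, smul_eq_mul, mul_comm]
        omega
    · rintro ⟨h1, h2⟩
      have hdec : μ = Multiset.replicate (μ.count (k + 1)) (k + 1) + μ.filter (· ≠ k + 1) := by
        rw [← Multiset.filter_eq', Multiset.filter_add_not]
      have hsum : (k + 1) * μ.count (k + 1) + (μ.filter (· ≠ k + 1)).sum = r := by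
        rw [← h2]
        conv_rhs => rw [hdec]
        rw [Multiset.sum_add, Multiset.sum_replicate, smul_eq_mul, mul_comm]
      have hmem := (ih (r - (k + 1) * μ.count (k + 1)) (μ.filter (· ≠ k + 1))).2 ⟨fun a ha => by
        have := h1 a (Multiset.mem_of_mem_filter ha)
        have := Multiset.of_mem_filter ha
        omega, by omega⟩
      obtain ⟨l, hl, h⟩ := List.mem_map.1 hmem
      refine ⟨μ.count (k + 1), ?_, List.mem_map.2 ⟨l, hl, ?_⟩⟩
      · rw [Nat.lt_succ_iff, Nat.le_div_iff_mul_le (show 0 < k + 1 from Nat.succ_pos k), mul_comm]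
        omega
      · simp only [Function.comp, toParts_ite, h]
        exact hdec.symm

theorem count_toParts {k r : ℕ} {l : List (ℕ × ℕ)} (hl : l ∈ partitionLists k r) {a : ℕ}
    (ha : k < a) : (toParts l).count a = 0 := by
  rw [Multiset.count_eq_zero]
  intro h
  have := ((mem_map_toParts k r _).1 (List.mem_map_of_mem hl)).1 a h
  omega

theorem nodup_map_toParts (k r : ℕ) : ((partitionLists k r).map toParts).Nodup := by
  induction k generalizing r with
  | zero =>
    simp only [partitionLists]
    split_ifs <;> simp
  | succ k ih =>
    simp only [partitionLists, List.map_flatMap, List.map_map]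
    rw [List.nodup_flatMap]
    constructor
    · intro c _
      have := (ih (r - (k + 1) * c)).map
        (f := fun μ => Multiset.replicate c (k + 1) + μ) (add_right_injective _)
      rw [List.map_map] at this
      convert this using 2
      funext l
      exact toParts_ite k c l
    · refine List.Pairwise.imp ?_ List.nodup_range
      intro c c' hne
      simp only [Function.onFun, List.disjoint_left, List.mem_map, Function.comp]
      rintro μ ⟨l, hl, rfl⟩ ⟨l', hl', h⟩
      apply hne
      rw [toParts_ite, toParts_ite] at h
      have := congrArg (Multiset.count (k + 1)) h
      simpa [count_toParts hl (Nat.lt_succ_self k), count_toParts hl' (Nat.lt_succ_self k)]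
        using this.symm

/-- The order of the centralizer of a permutation with the given cycle lengths. -/
def centralizerOrder (l : List (ℕ × ℕ)) : ℕ :=
  (l.map fun x => x.1 ^ x.2 * x.2.factorial).prod

theorem centralizerOrder_eq {k r : ℕ} {l : List (ℕ × ℕ)} (hl : l ∈ partitionLists k r) :
    centralizerOrder l =
      ∏ a ∈ Icc 1 k, a ^ (toParts l).count a * ((toParts l).count a).factorial := by
  induction k generalizing r l with
  | zero =>
    simp only [partitionLists] at hl
    split_ifs at hl
    · simp only [List.mem_singleton] at hl
      simp [hl, centralizerOrder]
    · simp at hl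
  | succ k ih =>
    simp only [partitionLists, List.mem_flatMap, List.mem_map] at hl
    obtain ⟨c, -, l', hl', rfl⟩ := hl
    rw [prod_Icc_succ_top (Nat.le_add_left 1 k), toParts_ite]
    simp only [Multiset.count_add, Multiset.count_replicate_self,
      count_toParts hl' (Nat.lt_succ_self k), add_zero]
    have : centralizerOrder (if c = 0 then l' else (k + 1, c) :: l') =
        centralizerOrder l' * ((k + 1) ^ c * c.factorial) := by
      split_ifs with h
      · simp [h]
      · simp [centralizerOrder, mul_comm]
    rw [this, ih hl']
    congr 1
    refine prod_congr rfl fun a ha => ?_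
    have hne : k + 1 ≠ a := by
      have := (mem_Icc.1 ha).2
      omega
    simp [Multiset.count_replicate, hne]

/-- The conjugacy class has `n!` divided by the centralizer order many elements. The work lies in
passing between `partition`, which records fixed points as parts 1, and `cycleType`, which omits
them. -/
theorem card_partition_eq {n : ℕ} {l : List (ℕ × ℕ)} (hl : l ∈ partitionLists n n) :
    #{σ : Equiv.Perm (Fin n) | σ.partition.parts = toParts l} =
      n.factorial / centralizerOrder l := by
  obtain ⟨h1, h2⟩ := (mem_map_toParts n n _).1 (List.mem_map_of_mem hl)
  set μ := toParts l with hμ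
  set ν := μ.filter (2 ≤ ·) with hν
  have hdec : μ = ν + Multiset.replicate (μ.count 1) 1 := by
    rw [← Multiset.filter_eq', hν, ← Multiset.filter_add_not (2 ≤ ·) μ]
    congr 1
    · rw [Multiset.filter_add_not]
    · rw [Multiset.filter_add_not]
      refine Multiset.filter_congr fun a ha => ?_
      have := h1 a ha
      omega
  have hsum : ν.sum + μ.count 1 = n := by
    rw [← h2]
    conv_rhs => rw [hdec]
    simp
  have hset : ({σ : Equiv.Perm (Fin n) | σ.partition.parts = μ} : Finset _) =
      ({σ | σ.cycleType = ν} : Finset (Equiv.Perm (Fin n))) := by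
    ext σ
    simp only [mem_filter, mem_univ, true_and]
    constructor
    · intro h
      rw [← Equiv.Perm.filter_parts_partition_eq_cycleType, h]
    · intro h
      rw [Equiv.Perm.parts_partition, ← Equiv.Perm.sum_cycleType, h, Fintype.card_fin]
      conv_rhs => rw [hdec]
      congr 2
      omega
  have hz : (n - ν.sum).factorial * ν.prod * ∏ a ∈ ν.toFinset, (ν.count a).factorial =
      centralizerOrder l := by
    rw [centralizerOrder_eq hl, mul_assoc, prod_multiset_count, ← prod_mul_distrib,
      show n - ν.sum = μ.count 1 by omega]
    rcases Nat.eq_zero_or_pos n with hn | hn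
    · have : μ = 0 := Multiset.eq_zero_of_forall_notMem fun a ha => by
        have := h1 a ha
        omega
      simp [hν, this, hn]
    rw [← mul_prod_Ioc_eq_prod_Icc hn, one_pow, one_mul, ← hμ]
    congr 1
    have hsub : ν.toFinset ⊆ Ioc 1 n := by
      intro a ha
      rw [Multiset.mem_toFinset, hν, Multiset.mem_filter] at ha
      have := h1 a ha.1
      rw [mem_Ioc]
      omega
    have hcount : ∀ a ∈ Ioc 1 n, ν.count a = μ.count a := by
      intro a ha
      rw [hν, Multiset.count_filter_of_pos]
      exact (mem_Ioc.1 ha).1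
    rw [prod_subset hsub]
    · exact prod_congr rfl fun a ha => by rw [hcount a ha]
    · intro a _ ha'
      rw [Multiset.mem_toFinset, ← Multiset.count_eq_zero] at ha'
      simp [ha']
  rw [hset, Equiv.Perm.card_of_cycleType, if_pos, Fintype.card_fin, hz]
  refine ⟨by rw [Fintype.card_fin]; omega, fun a ha => ?_⟩
  exact (Multiset.mem_filter.1 ha).2

/-- A sum of a class function over the symmetric group is a sum over partitions. -/
theorem sum_perm_eq (n : ℕ) (Ψ : Multiset ℕ → ℕ) :
    ∑ σ : Equiv.Perm (Fin n), Ψ σ.partition.parts =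
      ((partitionLists n n).map fun l =>
        n.factorial / centralizerOrder l * Ψ (toParts l)).sum := by
  have hnd := nodup_map_toParts n n
  have hmem : ∀ σ ∈ (univ : Finset (Equiv.Perm (Fin n))),
      σ.partition.parts ∈ ((partitionLists n n).map toParts).toFinset := by
    intro σ _
    rw [List.mem_toFinset, mem_map_toParts]
    have hs : σ.partition.parts.sum = n := σ.partition.parts_sum.trans (Fintype.card_fin n)
    refine ⟨fun a ha => ⟨σ.partition.parts_pos ha, ?_⟩, hs⟩
    rw [← hs]
    exact Multiset.le_sum_of_mem ha
  rw [← sum_fiberwise_of_maps_to hmem, List.sum_toFinset _ hnd, List.map_map]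
  congr 1
  refine List.map_congr_left fun l hl => ?_
  rw [← card_partition_eq hl, Function.comp, sum_congr rfl (g := fun _ => Ψ (toParts l)),
    sum_const, smul_eq_mul]
  intro σ hσ
  rw [(mem_filter.1 hσ).2]

/-- A cycle whose length divides `k` becomes trivial in the `k`-th power; any other cycle keeps its
full support. -/
theorem card_support_pow {n : ℕ} (σ : Equiv.Perm (Fin n)) (k : ℕ) :
    #(σ ^ k).support = (σ.cycleType.filter (¬ · ∣ k)).sum := by
  induction σ using Equiv.Perm.cycle_induction_on with
  | base_one => simp
  | base_cycles σ h =>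
    rw [h.cycleType]
    by_cases hd : #σ.support ∣ k
    · rw [Multiset.filter_singleton, if_neg (by simpa using hd)]
      rw [← h.orderOf] at hd
      simp [orderOf_dvd_iff_pow_eq_one.1 hd]
    · rw [Multiset.filter_singleton, if_pos hd]
      rw [← h.orderOf] at hd
      simp [h.support_pow_eq_iff.2 hd]
  | induction_disjoint σ τ hd _ h1 h2 =>
    rw [hd.cycleType_mul, Multiset.filter_add, Multiset.sum_add, ← h1, ← h2, hd.commute.mul_pow,
      (hd.pow_disjoint_pow k k).card_support_mul]

theorem card_fixed_pow {n : ℕ} (σ : Equiv.Perm (Fin n)) (k : ℕ) :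
    #{i | (σ ^ k) i = i} = (σ.partition.parts.filter (· ∣ k)).sum := by
  have h1 : #{i | (σ ^ k) i = i} + #(σ ^ k).support = n := by
    have := card_filter_add_card_filter_not (s := (univ : Finset (Fin n)))
      (fun i => (σ ^ k) i = i)
    rw [card_univ, Fintype.card_fin] at this
    exact this
  have h2 : σ.partition.parts.sum = n := σ.partition.parts_sum.trans (Fintype.card_fin n)
  rw [← Multiset.filter_add_not (· ∣ k) σ.partition.parts,
    Multiset.sum_add] at h2
  have h3 : (σ.partition.parts.filter (¬ · ∣ k)).sum = #(σ ^ k).support := by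
    rw [card_support_pow, Equiv.Perm.parts_partition, Multiset.filter_add, Multiset.sum_add]
    rw [Multiset.filter_eq_nil (s := Multiset.replicate _ 1) |>.2]
    · simp
    · intro a ha
      rw [Multiset.eq_of_mem_replicate ha]
      simp
  omega

end CycleType
end GraphInvariants
namespace GraphInvariants
open Finset

/-! ### Burnside's lemma for multigraphs, and fixed pairs of a vertex permutation -/

section Burnside
variable {n : ℕ}

/-- The multigraphs with `j` edges, counted with multiplicity. -/
def multigraphsOfDegree (n j : ℕ) : Finset (Multigraph n) := univ.finsuppAntidiag j

theorem mem_multigraphsOfDegree {j : ℕ} {g : Multigraph n} :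
    g ∈ multigraphsOfDegree n j ↔ ∑ e, g e = j := by
  simp [multigraphsOfDegree, mem_finsuppAntidiag]

/-- The number of isomorphism classes of multigraphs with `n` vertices and `j` edges. -/
noncomputable def orbitCount (n j : ℕ) : ℕ := #((multigraphsOfDegree n j).image Multigraph.orbit)

theorem edgePerm_one : edgePerm (1 : Equiv.Perm (Fin n)) = 1 := by
  refine Equiv.ext fun ⟨e, he⟩ => Subtype.ext ?_
  induction e using Sym2.ind with
  | _ i j => rfl

theorem edgePerm_pow (σ : Equiv.Perm (Fin n)) (k : ℕ) : edgePerm σ ^ k = edgePerm (σ ^ k) := by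
  induction k with
  | zero => rw [pow_zero, pow_zero, edgePerm_one]
  | succ k ih => rw [pow_succ, pow_succ, edgePerm_mul, ih]

theorem relabel_apply (σ : Equiv.Perm (Fin n)) (g : Multigraph n) (e : Edge n) :
    g.relabel σ (edgePerm σ e) = g e :=
  Finsupp.mapDomain_apply (edgePerm σ).injective g e

theorem relabel_one (g : Multigraph n) : g.relabel 1 = g := by
  rw [Multigraph.relabel, edgePerm_one]
  exact Finsupp.mapDomain_id

theorem sum_relabel (σ : Equiv.Perm (Fin n)) (g : Multigraph n) :
    ∑ e, g.relabel σ e = ∑ e, g e := by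
  rw [← Equiv.sum_comp (edgePerm σ)]
  simp only [relabel_apply]

theorem relabel_eq_self_iff (σ : Equiv.Perm (Fin n)) (g : Multigraph n) :
    g.relabel σ = g ↔ ∀ e, g (edgePerm σ e) = g e := by
  constructor
  · intro h e
    conv_lhs => rw [← h]
    exact relabel_apply σ g e
  · intro h
    ext e
    obtain ⟨e, rfl⟩ := (edgePerm σ).surjective e
    rw [relabel_apply, h]

theorem mem_orbit {g h : Multigraph n} : h ∈ g.orbit ↔ ∃ σ, g.relabel σ = h := by
  simp [Multigraph.orbit]

theorem self_mem_orbit (g : Multigraph n) : g ∈ g.orbit := mem_orbit.2 ⟨1, relabel_one g⟩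

theorem orbit_relabel (σ : Equiv.Perm (Fin n)) (g : Multigraph n) :
    (g.relabel σ).orbit = g.orbit := by
  ext h
  simp only [mem_orbit, Multigraph.relabel_relabel]
  exact ⟨fun ⟨τ, h⟩ => ⟨_, h⟩, fun ⟨τ, h⟩ => ⟨τ * σ⁻¹, by simpa using h⟩⟩

theorem orbit_eq_iff {g h : Multigraph n} : g.orbit = h.orbit ↔ ∃ σ, g.relabel σ = h := by
  constructor
  · intro hh
    rw [← mem_orbit, hh]
    exact self_mem_orbit h
  · rintro ⟨σ, rfl⟩
    exact (orbit_relabel σ g).symm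

noncomputable instance (j : ℕ) :
    MulAction (Equiv.Perm (Fin n)) {g : Multigraph n // g ∈ multigraphsOfDegree n j} where
  smul σ g := ⟨g.1.relabel σ, mem_multigraphsOfDegree.2
    ((sum_relabel σ g.1).trans (mem_multigraphsOfDegree.1 g.2))⟩
  one_smul g := Subtype.ext (relabel_one g.1)
  mul_smul σ τ g := Subtype.ext (Multigraph.relabel_relabel σ τ g.1).symm

/-- Burnside's lemma: a multigraph is fixed by `σ` exactly when its weight function is constant
along the cycles of `edgePerm σ`. -/
theorem orbitCount_mul (n j : ℕ) :
    orbitCount n j * n.factorial =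
      ∑ σ : Equiv.Perm (Fin n), #(invMult (edgePerm σ) (fun _ => 0) (fun _ => 1) 0 j) := by
  classical
  have h := MulAction.sum_card_fixedBy_eq_card_orbits_mul_card_group (Equiv.Perm (Fin n))
    {g : Multigraph n // g ∈ multigraphsOfDegree n j}
  rw [Fintype.card_perm, Fintype.card_fin] at h
  have h1 : Fintype.card (MulAction.orbitRel.Quotient (Equiv.Perm (Fin n))
      {g : Multigraph n // g ∈ multigraphsOfDegree n j}) = orbitCount n j := by
    rw [orbitCount, ← Fintype.card_coe]
    refine Fintype.card_congr (Equiv.ofBijective (Quotient.lift (fun g =>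
      ⟨g.1.orbit, mem_image_of_mem _ g.2⟩) ?_) ⟨?_, ?_⟩)
    · rintro a b ⟨σ, h⟩
      refine Subtype.ext (orbit_eq_iff.2 ⟨σ, ?_⟩).symm
      exact congrArg Subtype.val h
    · rintro ⟨a⟩ ⟨b⟩ h
      obtain ⟨σ, h⟩ := orbit_eq_iff.1 (congrArg Subtype.val h)
      refine (Quotient.sound (s := MulAction.orbitRel _ _) (a := b) (b := a) ?_).symm
      exact MulAction.mem_orbit_iff.2 ⟨σ, Subtype.ext h⟩
    · rintro ⟨O, hO⟩
      obtain ⟨g, hg, rfl⟩ := mem_image.1 hO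
      exact ⟨Quotient.mk _ ⟨g, hg⟩, rfl⟩
  rw [← h1]
  refine h.symm.trans (sum_congr rfl fun σ _ => ?_)
  rw [← Fintype.card_coe]
  refine Fintype.card_congr
    { toFun := fun g => ⟨fun e => g.1.1 e, ?_⟩
      invFun := fun f => ⟨⟨Finsupp.equivFunOnFinite.symm f.1, ?_⟩, ?_⟩
      left_inv := ?_
      right_inv := ?_ }
  · obtain ⟨⟨g, hg⟩, hfix⟩ := g
    refine (mem_invMult fun _ => le_rfl).2 ⟨?_, by simp, ?_⟩
    · exact (relabel_eq_self_iff σ g).1 (congrArg Subtype.val hfix)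
    · simpa using mem_multigraphsOfDegree.1 hg
  · have := ((mem_invMult fun _ => le_rfl).1 f.2).2.2
    exact mem_multigraphsOfDegree.2 (by simpa using this)
  · have := ((mem_invMult fun _ => le_rfl).1 f.2).1
    exact Subtype.ext ((relabel_eq_self_iff σ _).2 this)
  · intro g
    exact Subtype.ext (Subtype.ext (Finsupp.ext fun e => rfl))
  · intro f
    rfl

/-- Count ordered pairs of distinct vertices whose unordered pair is fixed by `ρ`: either both
vertices are fixed, or `ρ` exchanges them, and the latter pairs are `(i, ρ i)` with `i` fixed by `ρ
^ 2` but not by `ρ`. The terms are arranged so that no subtraction occurs. -/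
theorem two_mul_card_fixed_edge (ρ : Equiv.Perm (Fin n)) :
    2 * #{e : Edge n | edgePerm ρ e = e} + 2 * #{i | ρ i = i} =
      #{i | ρ i = i} * #{i | ρ i = i} + #{i | (ρ ^ 2) i = i} := by
  let D : Finset (Fin n × Fin n) := {p | p.1 ≠ p.2 ∧ s(ρ p.1, ρ p.2) = s(p.1, p.2)}
  have hD : #D = #{e : Edge n | edgePerm ρ e = e} * 2 := by
    rw [← card_image_of_injective {e : Edge n | edgePerm ρ e = e} Subtype.val_injective,
      card_eq_sum_card_fiberwise (f := fun p => s(p.1, p.2))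
        (t := ({e : Edge n | edgePerm ρ e = e} : Finset (Edge n)).image Subtype.val),
      ← smul_eq_mul, ← sum_const]
    · refine sum_congr rfl fun e he => ?_
      obtain ⟨⟨e, hd⟩, hfix, rfl⟩ := mem_image.1 he
      simp only [mem_filter, mem_univ, true_and] at hfix
      induction e using Sym2.ind with
      | _ a b =>
        have hne : a ≠ b := fun h => hd (by simp [h])
        have hfix' : s(ρ a, ρ b) = s(a, b) := congrArg Subtype.val hfix
        rw [← card_pair (a := (a, b)) (b := (b, a)) (by simp [hne])]
        congr 1
        ext ⟨x, y⟩
        simp only [D, mem_filter, mem_univ, true_and, mem_insert, mem_singleton, Prod.mk.injEq]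
        constructor
        · rintro ⟨-, h⟩
          simpa using h
        · rintro (⟨rfl, rfl⟩ | ⟨rfl, rfl⟩)
          · exact ⟨⟨hne, hfix'⟩, rfl⟩
          · exact ⟨⟨hne.symm, by rw [Sym2.eq_swap, hfix', Sym2.eq_swap]⟩, Sym2.eq_swap⟩
    · rintro ⟨a, b⟩ hp
      simp only [D, coe_filter, mem_univ, true_and, Set.mem_ofPred_eq] at hp
      simp only [coe_image, Set.mem_image]
      refine ⟨⟨s(a, b), by simpa using hp.1⟩, ?_, rfl⟩
      simp only [coe_filter, mem_univ, true_and, Set.mem_ofPred_eq]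
      exact Subtype.ext hp.2
  have hD' : #D = #({i | ρ i = i} : Finset (Fin n)).offDiag +
      #{i | (ρ ^ 2) i = i ∧ ρ i ≠ i} := by
    rw [← card_image_of_injective {i | (ρ ^ 2) i = i ∧ ρ i ≠ i} (f := fun i => (i, ρ i))
      (fun i j h => congrArg Prod.fst h), ← card_union_of_disjoint]
    · congr 1
      ext ⟨a, b⟩
      simp only [D, mem_filter, mem_univ, true_and, mem_union, mem_offDiag, mem_image,
        Prod.mk.injEq, sq, Equiv.Perm.mul_apply]
      constructor
      · rintro ⟨hne, h⟩
        rcases Sym2.eq_iff.1 h with ⟨h1, h2⟩ | ⟨h1, h2⟩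
        · exact Or.inl ⟨h1, h2, hne⟩
        · exact Or.inr ⟨a, ⟨by rw [h1, h2], by rw [h1]; exact hne.symm⟩, rfl, h1⟩
      · rintro (⟨h1, h2, hne⟩ | ⟨i, ⟨h1, h2⟩, rfl, rfl⟩)
        · exact ⟨hne, by rw [h1, h2]⟩
        · exact ⟨h2.symm, by rw [h1, Sym2.eq_swap]⟩
    · rw [disjoint_left]
      rintro ⟨a, b⟩ h1 h2
      simp only [mem_offDiag, mem_filter, mem_univ, true_and] at h1
      simp only [mem_image, mem_filter, mem_univ, true_and, Prod.mk.injEq] at h2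
      obtain ⟨i, ⟨-, hi⟩, rfl, -⟩ := h2
      exact hi h1.1
  have h2 : #{i | (ρ ^ 2) i = i} = #{i | ρ i = i} + #{i | (ρ ^ 2) i = i ∧ ρ i ≠ i} := by
    rw [← card_filter_add_card_filter_not (s := ({i | (ρ ^ 2) i = i} : Finset (Fin n)))
      (fun i => ρ i = i), filter_filter, filter_filter]
    congr 2
    ext i
    simp only [mem_filter, mem_univ, true_and, and_iff_right_iff_imp]
    intro h
    rw [sq, Equiv.Perm.mul_apply, h, h]
  have h3 := Nat.le_mul_self #{i | ρ i = i}
  rw [offDiag_card] at hD'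
  omega

end Burnside
end GraphInvariants
namespace GraphInvariants
open Finset

/-! The functions of this section are written with recursors so that the kernel evaluates them
quickly. -/

/-! ### Kernel evaluation of the Burnside sum -/

section Compute

/-- The number of fixed points of the `k`-th power of a permutation with the given cycles. -/
noncomputable def fixPow (l : List (ℕ × ℕ)) (k : ℕ) : ℕ :=
  List.rec (motive := fun _ => ℕ) 0 (fun x _ ih =>
    Nat.add (bif Nat.beq (Nat.mod k x.1) 0 then Nat.mul x.1 x.2 else 0) ih) l

/-- The number of pairs of vertices fixed by the `k`-th power of a permutation. -/
noncomputable def fixEdge (l : List (ℕ × ℕ)) (k : ℕ) : ℕ :=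
  Nat.div (Nat.sub (Nat.add (Nat.mul (fixPow l k) (fixPow l k)) (fixPow l (Nat.mul 2 k)))
    (Nat.mul 2 (fixPow l k))) 2

/-- The scalar product of two lists. -/
noncomputable def dot (as : List ℕ) : List ℕ → ℕ :=
  List.rec (motive := fun _ => List ℕ → ℕ) (fun _ => 0) (fun a _ ih hs =>
    List.rec (motive := fun _ => ℕ) 0 (fun h t _ => Nat.add (Nat.mul a h) (ih t)) hs) as

/-- The complete symmetric values of degrees `d, …, 0` from the list of power sum values. -/
noncomputable def newtonList (as : List ℕ) (d : ℕ) : List ℕ :=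
  Nat.rec (motive := fun _ => List ℕ) [1] (fun j ih => Nat.div (dot as ih) (Nat.succ j) :: ih) d

/-- The list `w • as + bs`. -/
noncomputable def axpy (w : ℕ) (as : List ℕ) : List ℕ → List ℕ :=
  List.rec (motive := fun _ => List ℕ → List ℕ) (fun _ => []) (fun a _ ih hs =>
    List.rec (motive := fun _ => List ℕ) [] (fun h t _ => Nat.add (Nat.mul w a) h :: ih t) hs) as

/-- The numbers of pairs (permutation, invariant multigraph) of degrees `d, …, 0`. -/
noncomputable def burnsideList (n : ℕ) (ds : List ℕ) (d : ℕ) : List ℕ :=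
  List.rec (motive := fun _ => List ℕ) (List.replicate (d + 1) 0) (fun l _ ih =>
    axpy (n.factorial / centralizerOrder l) (newtonList (ds.map (fixEdge l)) d) ih)
    (partitionLists n n)

theorem fixPow_eq (l : List (ℕ × ℕ)) (k : ℕ) :
    fixPow l k = ((toParts l).filter (· ∣ k)).sum := by
  induction l with
  | nil => simp [toParts, fixPow]
  | cons x l ih =>
    have h : fixPow (x :: l) k =
      (bif Nat.beq (k % x.1) 0 then x.1 * x.2 else 0) + fixPow l k := rfl
    rw [h, ih, toParts_cons, Multiset.filter_add, Multiset.sum_add]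
    congr 1
    by_cases hd : x.1 ∣ k
    · rw [Multiset.filter_eq_self.2, Nat.mod_eq_zero_of_dvd hd]
      · simp [mul_comm]
      · intro a ha
        rwa [Multiset.eq_of_mem_replicate ha]
    · rw [Multiset.filter_eq_nil.2]
      · have : Nat.beq (k % x.1) 0 = false := by
          rw [← Bool.not_eq_true, Nat.beq_eq, ← Nat.dvd_iff_mod_eq_zero]
          exact hd
        simp [this]
      · intro a ha
        rwa [Multiset.eq_of_mem_replicate ha]

/-- The scalar product stops at the shorter list, so one list of power sums serves at every stage of
`newtonList`. -/
theorem dot_map_range (p q : ℕ) (f g : ℕ → ℕ) :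
    dot ((List.range p).map f) ((List.range q).map g) = ∑ i ∈ range (min p q), f i * g i := by
  induction p generalizing q f g with
  | zero => simp [dot]
  | succ p ih =>
    cases q with
    | zero => simp [dot, List.range_succ_eq_map]
    | succ q =>
      rw [List.range_succ_eq_map, List.range_succ_eq_map, List.map_cons, List.map_cons,
        List.map_map, List.map_map, Nat.succ_min_succ, sum_range_succ']
      have := ih q (f ∘ Nat.succ) (g ∘ Nat.succ)
      simp only [Function.comp_apply] at this
      rw [add_comm]
      exact congrArg (f 0 * g 0 + ·) this

/-- Keeping the values in descending order of degree makes the Newton convolution a plain scalar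
product with the ascending list of power sums. The recursion makes the natural number division
exact. -/
theorem newtonList_eq (a h : ℕ → ℕ) (D : ℕ) (h0 : h 0 = 1)
    (hs : ∀ d, (d + 1) * h (d + 1) = ∑ k ∈ range (d + 1), a (k + 1) * h (d - k)) (d : ℕ)
    (hd : d ≤ D) :
    newtonList ((List.range D).map fun k => a (k + 1)) d =
      (List.range (d + 1)).map fun i => h (d - i) := by
  induction d with
  | zero => simp [newtonList, h0]
  | succ d ih =>
    have h1 : newtonList ((List.range D).map fun k => a (k + 1)) (d + 1) =
      (dot ((List.range D).map fun k => a (k + 1))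
        (newtonList ((List.range D).map fun k => a (k + 1)) d) / (d + 1)) ::
        newtonList ((List.range D).map fun k => a (k + 1)) d := rfl
    rw [h1, ih (by omega), dot_map_range, min_eq_right (by omega), ← hs,
      Nat.mul_div_cancel_left _ (Nat.succ_pos d), List.range_succ_eq_map (n := d + 1),
      List.map_cons, List.map_map]
    congr 1
    refine List.map_congr_left fun i _ => ?_
    rw [Function.comp, Nat.succ_sub_succ]

theorem axpy_map_range (w p : ℕ) (f g : ℕ → ℕ) :
    axpy w ((List.range p).map f) ((List.range p).map g) =
      (List.range p).map fun i => w * f i + g i := by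
  induction p generalizing f g with
  | zero => rfl
  | succ p ih =>
    rw [List.range_succ_eq_map, List.map_cons, List.map_cons, List.map_cons, List.map_map,
      List.map_map, List.map_map]
    have := ih (f ∘ Nat.succ) (g ∘ Nat.succ)
    refine Eq.trans ?_ (congrArg (List.cons _) this)
    rfl

theorem card_invMult_zero {X : Type*} [Fintype X] [DecidableEq X] (τ : Equiv.Perm X)
    (v e : X → ℕ) (he : ∀ x, 1 ≤ e x) : #(invMult τ v e 0 0) = 1 := by
  rw [card_eq_one]
  refine ⟨fun _ => 0, ?_⟩
  ext f
  rw [mem_invMult he, mem_singleton]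
  constructor
  · rintro ⟨-, -, h⟩
    funext x
    have := sum_eq_zero_iff.1 h x (mem_univ x)
    have := he x
    exact (Nat.mul_eq_zero.1 ‹_›).resolve_right (by omega)
  · rintro rfl
    simp

/-- With all weights one, the `k`-th power sum is the number of fixed points of `τ ^ k`. -/
theorem newton_invMult {X : Type*} [Fintype X] [DecidableEq X] (τ : Equiv.Perm X) (d : ℕ) :
    (d + 1) * #(invMult τ (fun _ => 0) (fun _ => 1) 0 (d + 1)) =
      ∑ k ∈ range (d + 1), #{x | (τ ^ (k + 1)) x = x} *
        #(invMult τ (fun _ => 0) (fun _ => 1) 0 (d - k)) := by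
  rw [mul_card_invMult τ _ _ (fun _ => le_rfl) (fun _ => rfl) (fun _ => rfl), sum_comm,
    show Icc 1 (d + 1) = (range (d + 1)).image (· + 1) by
      ext k
      simp only [mem_Icc, mem_image, mem_range]
      exact ⟨fun h => ⟨k - 1, by omega, by omega⟩, by rintro ⟨i, hi, rfl⟩; omega⟩,
    sum_image (fun _ _ _ _ h => Nat.succ_injective h)]
  refine sum_congr rfl fun k hk => ?_
  have hk := mem_range.1 hk
  rw [card_filter, sum_mul]
  refine sum_congr rfl fun x _ => ?_
  have : k + 1 ≤ d + 1 := by omega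
  simp [this, ite_mul]

theorem length_newtonList (as : List ℕ) (d : ℕ) : (newtonList as d).length = d + 1 := by
  induction d with
  | zero => rfl
  | succ d ih => exact congrArg (· + 1) ih

/-- The number of pairs of vertices fixed by the `k`-th power of a permutation, from its cycle
lengths. -/
def fixEdgeParts (μ : Multiset ℕ) (k : ℕ) : ℕ :=
  ((μ.filter (· ∣ k)).sum * (μ.filter (· ∣ k)).sum + (μ.filter (· ∣ 2 * k)).sum -
    2 * (μ.filter (· ∣ k)).sum) / 2

theorem fixEdge_eq_fixEdgeParts (l : List (ℕ × ℕ)) : fixEdge l = fixEdgeParts (toParts l) := by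
  funext k
  change (fixPow l k * fixPow l k + fixPow l (2 * k) - 2 * fixPow l k) / 2 = _
  rw [fixPow_eq, fixPow_eq]
  rfl

theorem card_fixed_edgePerm_pow {n : ℕ} (σ : Equiv.Perm (Fin n)) (k : ℕ) :
    #{e : Edge n | (edgePerm σ ^ k) e = e} = fixEdgeParts σ.partition.parts k := by
  have h1 := two_mul_card_fixed_edge (σ ^ k)
  rw [← pow_mul, card_fixed_pow, card_fixed_pow, mul_comm k] at h1
  rw [edgePerm_pow, fixEdgeParts]
  omega

theorem newtonList_edgePerm {n : ℕ} (σ : Equiv.Perm (Fin n)) (d : ℕ) :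
    newtonList (((List.range d).map (· + 1)).map (fixEdgeParts σ.partition.parts)) d =
      (List.range (d + 1)).map fun i =>
        #(invMult (edgePerm σ) (fun _ => 0) (fun _ => 1) 0 (d - i)) := by
  rw [List.map_map]
  refine newtonList_eq (fixEdgeParts σ.partition.parts)
    (fun j => #(invMult (edgePerm σ) (fun _ => 0) (fun _ => 1) 0 j)) d
    (card_invMult_zero _ _ _ fun _ => le_rfl) (fun d => ?_) d le_rfl
  rw [newton_invMult]
  simp only [card_fixed_edgePerm_pow]

theorem burnsideList_eq (n d : ℕ) :
    burnsideList n ((List.range d).map (· + 1)) d =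
      (List.range (d + 1)).map fun i => orbitCount n (d - i) * n.factorial := by
  let N : Multiset ℕ → List ℕ := fun μ =>
    newtonList (((List.range d).map (· + 1)).map (fixEdgeParts μ)) d
  have hN : ∀ μ, N μ = (List.range (d + 1)).map fun i => (N μ).getD i 0 := by
    intro μ
    refine List.ext_getElem (by simp [N, length_newtonList]) fun i h1 h2 => ?_
    simp [List.getElem_eq_getD (h := h1) 0]
  have key : ∀ L : List (List (ℕ × ℕ)),
      (List.rec (motive := fun _ => List ℕ) (List.replicate (d + 1) 0) (fun l _ ih =>
        axpy (n.factorial / centralizerOrder l)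
          (newtonList (((List.range d).map (· + 1)).map (fixEdge l)) d) ih) L : List ℕ) =
      (List.range (d + 1)).map fun i => (L.map fun l => n.factorial / centralizerOrder l *
        (N (toParts l)).getD i 0).sum := by
    intro L
    induction L with
    | nil => simp
    | cons l L ih =>
      simp only [List.map_cons, List.sum_cons]
      rw [ih, fixEdge_eq_fixEdgeParts, ← axpy_map_range, ← hN]
  refine (key _).trans (List.map_congr_left fun i hi => ?_)
  -- Entry by entry, the list attached to a permutation depends only on its cycle lengths, so each
  -- coordinate is the sum of a class function.
  rw [orbitCount_mul, ← sum_perm_eq n fun μ => (N μ).getD i 0]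
  refine sum_congr rfl fun σ _ => ?_
  simp only [N, newtonList_edgePerm]
  have := List.mem_range.1 hi
  simp [List.getD_eq_getElem?_getD, this]

end Compute
end GraphInvariants
namespace GraphInvariants

/-! ### Unique factorization in graded refinement monoids -/

section Refinement

set_option linter.unusedSectionVars false

/-- An irreducible element of an additive monoid. -/
def IsIrred {M : Type*} [AddCommMonoid M] (x : M) : Prop :=
  x ≠ 0 ∧ ∀ a b, x = a + b → a = 0 ∨ b = 0

/-- A graded commutative monoid in which any two decompositions of an element have a common
refinement. -/
class GradedRefinement (M : Type*) [AddCommMonoid M] where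
  /-- the grading -/
  deg : M →+ ℕ
  deg_eq_zero : ∀ x, deg x = 0 → x = 0
  refine_add : ∀ a b c d : M, a + b = c + d →
    ∃ x y z w, a = x + y ∧ b = z + w ∧ c = x + z ∧ d = y + w

namespace GradedRefinement
variable {M : Type*} [AddCommMonoid M] [GradedRefinement M]

theorem eq_zero_of_add_eq_self {x y : M} (h : x + y = x) : y = 0 := by
  apply deg_eq_zero
  have := congrArg deg h
  rw [map_add] at this
  omega

theorem eq_zero_of_add_eq_zero {x y : M} (h : x + y = 0) : x = 0 ∧ y = 0 := by
  have := congrArg deg h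
  rw [map_add, map_zero] at this
  exact ⟨deg_eq_zero _ (by omega), deg_eq_zero _ (by omega)⟩

theorem deg_pos {x : M} (h : x ≠ 0) : 0 < deg x :=
  Nat.pos_of_ne_zero fun h' => h (deg_eq_zero _ h')

/-- Cancellation is not an axiom. In a common refinement of the two sums, irreducibility leaves two
cases: the two copies of `p` are the same piece, and the grading kills the rest, or each lies in the
other remainder, which gives `x` and `y` the same form. -/
theorem add_left_cancel_of_isIrred {p x y : M} (hp : IsIrred p) (h : p + x = p + y) : x = y := by
  obtain ⟨a, b, c, d, h1, rfl, h2, rfl⟩ := refine_add _ _ _ _ h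
  rcases hp.2 _ _ h1 with rfl | rfl
  · rw [zero_add] at h1 h2
    rw [← h1, ← h2]
  · rw [add_zero] at h1
    rw [← h1] at h2
    rw [eq_zero_of_add_eq_self h2.symm]

/-- The irreducible elements. -/
abbrev Irred (M : Type*) [AddCommMonoid M] : Type _ := {x : M // IsIrred x}

/-- The sum of a multiset of irreducible elements. -/
def total (s : Multiset (Irred M)) : M := (s.map Subtype.val).sum

theorem total_cons (p : Irred M) (s : Multiset (Irred M)) : total (p ::ₘ s) = p.1 + total s := by
  simp [total]

/-- Irreducible elements are prime: refining `p + x = q + (rest)`, either `p` is `q` or `p` is a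
summand of the rest. -/
theorem mem_of_add_eq_total {p : Irred M} {x : M} {s : Multiset (Irred M)}
    (h : p.1 + x = total s) : p ∈ s := by
  induction s using Multiset.induction generalizing x with
  | empty => exact absurd (eq_zero_of_add_eq_zero (h.trans (by simp [total]))).1 p.2.1
  | cons q s ih =>
    rw [total_cons] at h
    obtain ⟨a, b, c, d, h1, -, h2, h3⟩ := refine_add _ _ _ _ h
    rcases p.2.2 _ _ h1 with rfl | rfl
    · rw [zero_add] at h1
      exact Multiset.mem_cons_of_mem (ih (by rw [h1, ← h3]))
    · rw [add_zero] at h1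
      rcases q.2.2 _ _ h2 with h0 | rfl
      · exact absurd (h1.trans h0) p.2.1
      · rw [add_zero] at h2
        rw [Subtype.ext (h1.trans h2.symm)]
        exact Multiset.mem_cons_self _ _

/-- Together with `total_surjective` this makes the monoid free on its irreducible elements. -/
theorem total_injective : Function.Injective (total : Multiset (Irred M) → M) := by
  intro s t h
  induction s using Multiset.induction generalizing t with
  | empty =>
    by_contra hne
    obtain ⟨p, hp⟩ := Multiset.exists_mem_of_ne_zero (Ne.symm hne)
    obtain ⟨t, rfl⟩ := Multiset.exists_cons_of_mem hp
    rw [total_cons] at h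
    exact p.2.1 (eq_zero_of_add_eq_zero (h.symm.trans (by simp [total]))).1
  | cons p s ih =>
    have hp : p ∈ t := mem_of_add_eq_total ((total_cons p s).symm.trans h)
    obtain ⟨t, rfl⟩ := Multiset.exists_cons_of_mem hp
    rw [total_cons, total_cons] at h
    rw [ih (add_left_cancel_of_isIrred p.2 h)]

theorem total_surjective : Function.Surjective (total : Multiset (Irred M) → M) := by
  suffices H : ∀ n, ∀ x : M, deg x = n → ∃ s, total s = x from fun x => H _ x rfl
  intro n
  induction n using Nat.strong_induction_on with
  | _ n ih =>
    rintro x rfl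
    by_cases h0 : x = 0
    · exact ⟨0, by simp [total, h0]⟩
    by_cases hx : IsIrred x
    · exact ⟨{⟨x, hx⟩}, by simp [total]⟩
    · simp only [IsIrred, ne_eq, h0, not_false_eq_true, true_and, not_forall, not_or] at hx
      obtain ⟨a, b, rfl, ha, hb⟩ := hx
      have ha' := deg_pos ha
      have hb' := deg_pos hb
      rw [map_add] at ih
      obtain ⟨s, rfl⟩ := ih _ (by omega) a rfl
      obtain ⟨t, rfl⟩ := ih (deg b) (by omega) b rfl
      exact ⟨s + t, by simp [total]⟩

end GradedRefinement
end Refinement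
end GraphInvariants
namespace GraphInvariants

/-! ### Labelled multigraphs on the natural numbers and their isomorphisms -/

section LabelledGraphs

/-- The vertices that are not isolated. -/
def verts (g : Sym2 ℕ →₀ ℕ) : Finset ℕ := g.support.biUnion Sym2.toFinset

theorem mem_verts {g : Sym2 ℕ →₀ ℕ} {x : ℕ} : x ∈ verts g ↔ ∃ e, g e ≠ 0 ∧ x ∈ e := by
  simp [verts]

theorem mem_verts_of_mem {g : Sym2 ℕ →₀ ℕ} {x : ℕ} {e : Sym2 ℕ} (he : g e ≠ 0) (hx : x ∈ e) :
    x ∈ verts g := mem_verts.2 ⟨e, he, hx⟩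

theorem verts_zero : verts 0 = ∅ := by simp [verts]

theorem verts_nonempty {g : Sym2 ℕ →₀ ℕ} (h : g ≠ 0) : (verts g).Nonempty := by
  obtain ⟨e, he⟩ := Finsupp.ne_iff.1 h
  exact ⟨_, mem_verts_of_mem he (Sym2.out_fst_mem e)⟩

theorem verts_add (a b : Sym2 ℕ →₀ ℕ) : verts (a + b) = verts a ∪ verts b := by
  ext x
  simp only [Finset.mem_union, mem_verts, Finsupp.add_apply]
  constructor
  · rintro ⟨e, he, hx⟩
    by_cases h : a e = 0
    · exact Or.inr ⟨e, by omega, hx⟩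
    · exact Or.inl ⟨e, h, hx⟩
  · rintro (⟨e, he, hx⟩ | ⟨e, he, hx⟩) <;> exact ⟨e, by omega, hx⟩

/-- The image of a labelled graph under a map of the vertices. -/
noncomputable def push (f : ℕ → ℕ) (g : Sym2 ℕ →₀ ℕ) : Sym2 ℕ →₀ ℕ :=
  g.mapDomain (Sym2.map f)

theorem push_add (f : ℕ → ℕ) (a b : Sym2 ℕ →₀ ℕ) : push f (a + b) = push f a + push f b :=
  Finsupp.mapDomain_add

theorem push_push (f f' : ℕ → ℕ) (g : Sym2 ℕ →₀ ℕ) : push f (push f' g) = push (f ∘ f') g := by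
  rw [push, push, push, ← Finsupp.mapDomain_comp, Sym2.map_comp]

theorem sym2_map_congr {f f' : ℕ → ℕ} {e : Sym2 ℕ} (h : ∀ x ∈ e, f x = f' x) :
    Sym2.map f e = Sym2.map f' e := Sym2.map_congr h

theorem push_congr {f f' : ℕ → ℕ} {g : Sym2 ℕ →₀ ℕ} (h : ∀ x ∈ verts g, f x = f' x) :
    push f g = push f' g :=
  Finsupp.mapDomain_congr fun _ he => sym2_map_congr fun x hx =>
    h x (mem_verts_of_mem (Finsupp.mem_support_iff.1 he) hx)

theorem push_id (g : Sym2 ℕ →₀ ℕ) : push id g = g := by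
  rw [push, Sym2.map_id, Finsupp.mapDomain_id]

theorem injOn_sym2_map {f : ℕ → ℕ} {s : Set ℕ} (hf : Set.InjOn f s) {e e' : Sym2 ℕ}
    (he : ∀ x ∈ e, x ∈ s) (he' : ∀ x ∈ e', x ∈ s) (h : Sym2.map f e = Sym2.map f e') : e = e' := by
  induction e using Sym2.ind with
  | _ a b =>
    induction e' using Sym2.ind with
    | _ c d =>
      simp only [Sym2.mem_iff, forall_eq_or_imp, forall_eq] at he he'
      rw [Sym2.map_mk, Sym2.map_mk, Sym2.eq_iff] at h
      rw [Sym2.eq_iff]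
      exact h.imp (fun h => ⟨hf he.1 he'.1 h.1, hf he.2 he'.2 h.2⟩)
        fun h => ⟨hf he.1 he'.2 h.1, hf he.2 he'.1 h.2⟩

theorem injOn_support {f : ℕ → ℕ} {g : Sym2 ℕ →₀ ℕ} (hf : Set.InjOn f (verts g)) :
    Set.InjOn (Sym2.map f) g.support := fun _ he _ he' h =>
  injOn_sym2_map hf (fun _ hx => mem_verts_of_mem (Finsupp.mem_support_iff.1 he) hx)
    (fun _ hx => mem_verts_of_mem (Finsupp.mem_support_iff.1 he') hx) h

theorem support_push {f : ℕ → ℕ} {g : Sym2 ℕ →₀ ℕ} (hf : Set.InjOn f (verts g)) :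
    (push f g).support = g.support.image (Sym2.map f) :=
  Finsupp.mapDomain_support_of_injOn _ (injOn_support hf)

theorem verts_push {f : ℕ → ℕ} {g : Sym2 ℕ →₀ ℕ} (hf : Set.InjOn f (verts g)) :
    verts (push f g) = (verts g).image f := by
  ext x
  rw [verts, support_push hf]
  simp only [Finset.mem_biUnion, Finset.mem_image, Sym2.mem_toFinset, mem_verts]
  constructor
  · rintro ⟨_, ⟨e, he, rfl⟩, hx⟩
    obtain ⟨y, hy, rfl⟩ := Sym2.mem_map.1 hx
    exact ⟨y, ⟨e, Finsupp.mem_support_iff.1 he, hy⟩, rfl⟩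
  · rintro ⟨y, ⟨e, he, hy⟩, rfl⟩
    exact ⟨_, ⟨e, Finsupp.mem_support_iff.2 he, rfl⟩, Sym2.mem_map.2 ⟨y, hy, rfl⟩⟩

/-- Isomorphism of labelled graphs. -/
def Iso (g h : Sym2 ℕ →₀ ℕ) : Prop := ∃ f : ℕ → ℕ, Set.InjOn f (verts g) ∧ push f g = h

theorem Iso.refl (g : Sym2 ℕ →₀ ℕ) : Iso g g := ⟨id, Function.injective_id.injOn, push_id g⟩

theorem Iso.symm {g h : Sym2 ℕ →₀ ℕ} : Iso g h → Iso h g := by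
  rintro ⟨f, hf, rfl⟩
  have hinv : ∀ x ∈ verts g, Function.invFunOn f (verts g) (f x) = x := fun x hx =>
    hf.leftInvOn_invFunOn hx
  refine ⟨Function.invFunOn f (verts g), ?_, ?_⟩
  · rw [verts_push hf, Finset.coe_image]
    rintro _ ⟨x, hx, rfl⟩ _ ⟨y, hy, rfl⟩ h
    rw [hinv x hx, hinv y hy] at h
    rw [h]
  · rw [push_push]
    exact (push_congr (f' := id) hinv).trans (push_id g)

theorem Iso.trans {g h k : Sym2 ℕ →₀ ℕ} : Iso g h → Iso h k → Iso g k := by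
  rintro ⟨f, hf, rfl⟩ ⟨f', hf', rfl⟩
  refine ⟨f' ∘ f, ?_, (push_push _ _ _).symm⟩
  rw [verts_push hf, Finset.coe_image] at hf'
  exact hf'.comp hf (Set.mapsTo_image f _)

theorem Iso.card_verts {g h : Sym2 ℕ →₀ ℕ} : Iso g h → (verts g).card = (verts h).card := by
  rintro ⟨f, hf, rfl⟩
  rw [verts_push hf, Finset.card_image_of_injOn hf]

theorem degree_push (f : ℕ → ℕ) (g : Sym2 ℕ →₀ ℕ) : (push f g).degree = g.degree := by
  rw [push, Finsupp.degree_mapDomain]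

theorem Iso.degree_eq {g h : Sym2 ℕ →₀ ℕ} : Iso g h → g.degree = h.degree := by
  rintro ⟨f, -, rfl⟩
  exact (degree_push f g).symm

/-- The two isomorphisms glue to one map, injective because both the sources and the targets are
vertex-disjoint. -/
theorem Iso.add {a b a' b' : Sym2 ℕ →₀ ℕ} (hab : Disjoint (verts a) (verts b))
    (hab' : Disjoint (verts a') (verts b')) : Iso a a' → Iso b b' → Iso (a + b) (a' + b') := by
  rintro ⟨f, hf, rfl⟩ ⟨f', hf', rfl⟩
  rw [verts_push hf, verts_push hf'] at hab'
  let F : ℕ → ℕ := fun x => if x ∈ verts a then f x else f' x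
  have h1 : ∀ x ∈ verts a, F x = f x := fun x hx => if_pos hx
  have h2 : ∀ x ∈ verts b, F x = f' x := fun x hx => if_neg (Finset.disjoint_right.1 hab hx)
  refine ⟨F, ?_, by rw [push_add, push_congr h1, push_congr h2]⟩
  rw [verts_add, Finset.coe_union, Set.injOn_union (by exact_mod_cast hab)]
  refine ⟨hf.congr fun x hx => (h1 x hx).symm, hf'.congr fun x hx => (h2 x hx).symm, ?_⟩
  intro x hx y hy h
  rw [h1 x hx, h2 y hy] at h
  exact Finset.disjoint_left.1 hab' (Finset.mem_image_of_mem f hx)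
    (h ▸ Finset.mem_image_of_mem f' hy)

end LabelledGraphs

/-! ### The monoid of isomorphism classes under disjoint union -/

section Classes

/-- Loopless labelled multigraphs with finitely many edges on the vertex set `ℕ`. -/
abbrev LGraph : Type := {g : Sym2 ℕ →₀ ℕ // ∀ e, g e ≠ 0 → ¬ e.IsDiag}

theorem loopless_push {f : ℕ → ℕ} {g : Sym2 ℕ →₀ ℕ} (hf : Set.InjOn f (verts g))
    (hg : ∀ e, g e ≠ 0 → ¬ e.IsDiag) : ∀ e, push f g e ≠ 0 → ¬ e.IsDiag := by
  intro e he hd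
  rw [← Finsupp.mem_support_iff, support_push hf, Finset.mem_image] at he
  obtain ⟨e, he, rfl⟩ := he
  rw [Finsupp.mem_support_iff] at he
  refine hg e he ?_
  have h : ∀ x ∈ e, x ∈ verts g := fun _ => mem_verts_of_mem he
  clear he
  induction e using Sym2.ind with
  | _ a b =>
    rw [Sym2.map_mk, Sym2.mk_isDiag_iff] at hd
    rw [Sym2.mk_isDiag_iff]
    exact hf (h a (Sym2.mem_mk_left a b)) (h b (Sym2.mem_mk_right a b)) hd

theorem loopless_add {a b : Sym2 ℕ →₀ ℕ} (ha : ∀ e, a e ≠ 0 → ¬ e.IsDiag)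
    (hb : ∀ e, b e ≠ 0 → ¬ e.IsDiag) : ∀ e, (a + b) e ≠ 0 → ¬ e.IsDiag := by
  intro e he
  rw [Finsupp.add_apply] at he
  by_cases h : a e = 0
  · exact hb e (by omega)
  · exact ha e h

instance isoSetoid : Setoid LGraph where
  r g h := Iso g.1 h.1
  iseqv := ⟨fun g => Iso.refl g.1, Iso.symm, Iso.trans⟩

/-- Isomorphism classes of loopless multigraphs without isolated vertices. -/
def GraphClass : Type := Quotient isoSetoid

namespace GraphClass

/-- The isomorphism class of a labelled graph. -/
def mk (g : LGraph) : GraphClass := Quotient.mk _ g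

theorem mk_eq_mk {g h : LGraph} : mk g = mk h ↔ Iso g.1 h.1 := Quotient.eq

theorem exists_rep (x : GraphClass) : ∃ g, mk g = x := Quotient.exists_rep x

/-- The image of a labelled graph under an injective map of the vertices. -/
noncomputable def shift (f : ℕ → ℕ) (hf : Function.Injective f) (g : LGraph) : LGraph :=
  ⟨push f g.1, loopless_push hf.injOn g.2⟩

theorem mk_shift (f : ℕ → ℕ) (hf : Function.Injective f) (g : LGraph) :
    mk (shift f hf g) = mk g := (mk_eq_mk.2 ⟨f, hf.injOn, rfl⟩).symm

theorem disjoint_shift {f f' : ℕ → ℕ} (hf : Function.Injective f) (hf' : Function.Injective f')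
    (h : ∀ x y, f x ≠ f' y) (a b : LGraph) :
    Disjoint (verts (shift f hf a).1) (verts (shift f' hf' b).1) := by
  rw [shift, shift, verts_push hf.injOn, verts_push hf'.injOn, Finset.disjoint_left]
  simp only [Finset.mem_image]
  rintro _ ⟨x, -, rfl⟩ ⟨y, -, hy⟩
  exact h x y hy.symm

theorem injective_three_mul_add (r : ℕ) : Function.Injective fun i : ℕ => 3 * i + r := fun i j h => by
  simp only at h
  omega

/-- Disjoint copies are obtained by moving the vertices into the residue classes 0 and 1 modulo 3.
The class 2 is kept for a third summand, as associativity needs in `exists_rep₃`. -/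
noncomputable instance : Add GraphClass where
  add := Quotient.map₂ (fun a b => ⟨push (fun i => 3 * i + 0) a.1 + push (fun i => 3 * i + 1) b.1,
      loopless_add (shift _ (injective_three_mul_add 0) a).2 (shift _ (injective_three_mul_add 1) b).2⟩)
    (fun a a' ha b b' hb => Iso.add
      (disjoint_shift (injective_three_mul_add 0) (injective_three_mul_add 1) (fun x y => by omega) a b)
      (disjoint_shift (injective_three_mul_add 0) (injective_three_mul_add 1) (fun x y => by omega) a' b')
      (mk_eq_mk.1 ((mk_shift _ (injective_three_mul_add 0) a).trans ((mk_eq_mk.2 ha).trans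
        (mk_shift _ (injective_three_mul_add 0) a').symm)))
      (mk_eq_mk.1 ((mk_shift _ (injective_three_mul_add 1) b).trans ((mk_eq_mk.2 hb).trans
        (mk_shift _ (injective_three_mul_add 1) b').symm))))

theorem mk_add_mk {a b : LGraph} (h : Disjoint (verts a.1) (verts b.1)) :
    mk a + mk b = mk ⟨a.1 + b.1, loopless_add a.2 b.2⟩ :=
  mk_eq_mk.2 (Iso.add (disjoint_shift (injective_three_mul_add 0) (injective_three_mul_add 1) (fun x y => by omega) a b) h
    (mk_eq_mk.1 (mk_shift _ (injective_three_mul_add 0) a)) (mk_eq_mk.1 (mk_shift _ (injective_three_mul_add 1) b)))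

instance : Zero GraphClass where
  zero := mk ⟨0, fun _ h => absurd rfl h⟩

theorem mk_eq_zero {g : LGraph} : mk g = 0 ↔ g.1 = 0 := by
  constructor
  · intro h
    obtain ⟨f, -, h⟩ := (mk_eq_mk.1 h).symm
    rw [← h]
    exact Finsupp.mapDomain_zero
  · intro h
    exact congrArg mk (Subtype.ext h)

theorem exists_rep₃ (x y z : GraphClass) : ∃ a b c : LGraph, mk a = x ∧ mk b = y ∧ mk c = z ∧
    Disjoint (verts a.1) (verts b.1) ∧ Disjoint (verts a.1) (verts c.1) ∧
    Disjoint (verts b.1) (verts c.1) := by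
  obtain ⟨a, rfl⟩ := exists_rep x
  obtain ⟨b, rfl⟩ := exists_rep y
  obtain ⟨c, rfl⟩ := exists_rep z
  exact ⟨shift _ (injective_three_mul_add 0) a, shift _ (injective_three_mul_add 1) b, shift _ (injective_three_mul_add 2) c, mk_shift .., mk_shift ..,
    mk_shift .., disjoint_shift _ _ (fun x y => by omega) _ _,
    disjoint_shift _ _ (fun x y => by omega) _ _, disjoint_shift _ _ (fun x y => by omega) _ _⟩

protected theorem add_comm' (x y : GraphClass) : x + y = y + x := by
  obtain ⟨a, b, -, rfl, rfl, -, h, -⟩ := exists_rep₃ x y 0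
  rw [mk_add_mk h, mk_add_mk h.symm]
  exact congrArg mk (Subtype.ext (add_comm _ _))

protected theorem add_assoc' (x y z : GraphClass) : x + y + z = x + (y + z) := by
  obtain ⟨a, b, c, rfl, rfl, rfl, hab, hac, hbc⟩ := exists_rep₃ x y z
  rw [mk_add_mk hab, mk_add_mk hbc, mk_add_mk, mk_add_mk]
  · exact congrArg mk (Subtype.ext (add_assoc _ _ _))
  · rw [verts_add, Finset.disjoint_union_right]
    exact ⟨hab, hac⟩
  · rw [verts_add, Finset.disjoint_union_left]
    exact ⟨hac, hbc⟩

protected theorem zero_add' (x : GraphClass) : 0 + x = x := by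
  obtain ⟨a, rfl⟩ := exists_rep x
  refine (mk_add_mk (a := ⟨0, fun _ h => absurd rfl h⟩) (by simp [verts_zero])).trans ?_
  exact congrArg mk (Subtype.ext (zero_add _))

noncomputable instance : AddCommMonoid GraphClass where
  add_assoc := GraphClass.add_assoc'
  zero_add := GraphClass.zero_add'
  add_zero x := (GraphClass.add_comm' x 0).trans (GraphClass.zero_add' x)
  add_comm := GraphClass.add_comm'
  nsmul := nsmulRec

/-- The number of vertices of a class. -/
noncomputable def order : GraphClass →+ ℕ where
  toFun := Quotient.lift (fun g => (verts g.1).card) fun _ _ h => Iso.card_verts h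
  map_zero' := by
    change (verts 0).card = 0
    rw [verts_zero, Finset.card_empty]
  map_add' x y := by
    obtain ⟨a, b, -, rfl, rfl, -, h, -⟩ := exists_rep₃ x y 0
    rw [mk_add_mk h]
    change (verts (a.1 + b.1)).card = (verts a.1).card + (verts b.1).card
    rw [verts_add, Finset.card_union_of_disjoint h]

theorem order_mk (g : LGraph) : order (mk g) = (verts g.1).card := rfl

/-- The number of edges of a class. -/
noncomputable def size : GraphClass →+ ℕ where
  toFun := Quotient.lift (fun g => g.1.degree) fun _ _ h => Iso.degree_eq h
  map_zero' := map_zero Finsupp.degree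
  map_add' x y := by
    obtain ⟨a, b, -, rfl, rfl, -, h, -⟩ := exists_rep₃ x y 0
    rw [mk_add_mk h]
    exact map_add Finsupp.degree a.1 b.1

theorem size_mk (g : LGraph) : size (mk g) = g.1.degree := rfl

theorem order_pos {x : GraphClass} (h : x ≠ 0) : 0 < order x := by
  obtain ⟨g, rfl⟩ := exists_rep x
  rw [order_mk, Finset.card_pos]
  exact verts_nonempty fun h' => h (mk_eq_zero.2 h')

/-- A decomposition of the class is carried back along an isomorphism to a decomposition of the
given labelled graph itself. -/
theorem exists_add_of_mk_eq {g : LGraph} {x y : GraphClass} (h : mk g = x + y) :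
    ∃ a b : LGraph, mk a = x ∧ mk b = y ∧ Disjoint (verts a.1) (verts b.1) ∧
      g.1 = a.1 + b.1 := by
  obtain ⟨a, b, -, rfl, rfl, -, hd, -⟩ := exists_rep₃ x y 0
  rw [mk_add_mk hd] at h
  obtain ⟨f, hf, h⟩ := (mk_eq_mk.1 h).symm
  simp only [verts_add, Finset.coe_union] at hf
  have hfa : Set.InjOn f (verts a.1) := hf.mono Set.subset_union_left
  have hfb : Set.InjOn f (verts b.1) := hf.mono Set.subset_union_right
  refine ⟨⟨push f a.1, loopless_push hfa a.2⟩, ⟨push f b.1, loopless_push hfb b.2⟩,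
    (mk_eq_mk.2 ⟨f, hfa, rfl⟩).symm, (mk_eq_mk.2 ⟨f, hfb, rfl⟩).symm, ?_, ?_⟩
  · rw [verts_push hfa, verts_push hfb, Finset.disjoint_left]
    simp only [Finset.mem_image]
    rintro _ ⟨u, hu, rfl⟩ ⟨w, hw, h'⟩
    have := hf (Or.inr hw) (Or.inl hu) h'
    subst this
    exact Finset.disjoint_left.1 hd hu hw
  · rw [← h, push_add]

/-- The subgraph of the edges in a given set. -/
noncomputable def restrict (g : LGraph) (p : Sym2 ℕ → Prop) [DecidablePred p] : LGraph :=
  ⟨g.1.filter p, fun e h => g.2 e fun h' => h (by rw [Finsupp.filter_apply]; simp [h'])⟩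

theorem verts_restrict_subset (g : LGraph) (p : Sym2 ℕ → Prop) [DecidablePred p]
    (s : Finset ℕ) (h : ∀ e, g.1 e ≠ 0 → p e → ∀ x ∈ e, x ∈ s) : verts (restrict g p).1 ⊆ s := by
  intro x hx
  obtain ⟨e, he, hx⟩ := mem_verts.1 hx
  rw [restrict, Finsupp.filter_apply] at he
  split_ifs at he with hp
  · exact h e he hp x hx
  · exact absurd rfl he

/-- Realize both decompositions on one labelled graph, `a + b = c + d`, and cut `a` and `b` along
the support of `c`. The four pieces have the required disjointness because `c` and `d` share no
vertex. Irreducible classes are thus the connected graphs with at least one edge. -/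
noncomputable instance : GradedRefinement GraphClass where
  deg := size
  deg_eq_zero x h := by
    obtain ⟨g, rfl⟩ := exists_rep x
    exact mk_eq_zero.2 ((Finsupp.degree_eq_zero_iff _).1 h)
  refine_add x y z w h := by
    classical
    obtain ⟨c, d, -, rfl, rfl, -, hcd, -⟩ := exists_rep₃ z w 0
    rw [mk_add_mk hcd] at h
    obtain ⟨a, b, rfl, rfl, hab, h⟩ := exists_add_of_mk_eq h.symm
    simp only at h
    have hne : ∀ e, c.1 e ≠ 0 → d.1 e ≠ 0 → False := fun e h1 h2 =>
      Finset.disjoint_left.1 hcd (mem_verts_of_mem h1 (Sym2.out_fst_mem e))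
        (mem_verts_of_mem h2 (Sym2.out_fst_mem e))
    have happ : ∀ e, c.1 e + d.1 e = a.1 e + b.1 e := fun e => by
      rw [← Finsupp.add_apply, h, Finsupp.add_apply]
    have hp1 : ∀ (u : LGraph), ∀ e, u.1 e ≠ 0 → c.1 e ≠ 0 → ∀ x ∈ e, x ∈ verts c.1 :=
      fun u e _ he x hx => mem_verts_of_mem he hx
    have hp2 : ∀ (u : LGraph), (∀ e, u.1 e ≤ a.1 e + b.1 e) →
        ∀ e, u.1 e ≠ 0 → ¬ c.1 e ≠ 0 → ∀ x ∈ e, x ∈ verts d.1 := by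
      intro u hu e he hc x hx
      refine mem_verts_of_mem (e := e) ?_ hx
      have := happ e
      have := hu e
      omega
    have hsplit : ∀ u : LGraph, (∀ e, u.1 e ≤ a.1 e + b.1 e) →
        mk u = mk (restrict u fun e => c.1 e ≠ 0) + mk (restrict u fun e => ¬ c.1 e ≠ 0) := by
      intro u hu
      rw [mk_add_mk]
      · exact congrArg mk (Subtype.ext (Finsupp.filter_add_filter_not _ _).symm)
      · exact hcd.mono (verts_restrict_subset u _ _ (hp1 u))
          (verts_restrict_subset u _ _ (hp2 u hu))
    have hsub : ∀ (u : LGraph) (p : Sym2 ℕ → Prop) [DecidablePred p],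
        verts (restrict u p).1 ⊆ verts u.1 := fun u p _ =>
      verts_restrict_subset u p _ fun e he _ x hx => mem_verts_of_mem he hx
    refine ⟨_, _, _, _, hsplit a fun e => Nat.le_add_right _ _,
      hsplit b fun e => Nat.le_add_left _ _, ?_, ?_⟩
    · rw [mk_add_mk (hab.mono (hsub _ _) (hsub _ _))]
      refine congrArg mk (Subtype.ext (Finsupp.ext fun e => ?_))
      simp only [restrict, Finsupp.add_apply, Finsupp.filter_apply]
      have := happ e
      have := hne e
      by_cases hc : c.1 e = 0
      · simp [hc]
      · have : d.1 e = 0 := by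
          by_contra hd
          exact hne e hc hd
        simp only [hc, ne_eq, not_false_eq_true, if_true]
        omega
    · rw [mk_add_mk (hab.mono (hsub _ _) (hsub _ _))]
      refine congrArg mk (Subtype.ext (Finsupp.ext fun e => ?_))
      simp only [restrict, Finsupp.add_apply, Finsupp.filter_apply]
      have := happ e
      by_cases hc : c.1 e = 0
      · simp only [hc, ne_eq, not_true_eq_false, not_false_eq_true, if_true]
        omega
      · have : d.1 e = 0 := by
          by_contra hd
          exact hne e hc hd
        simp [hc, this]

end GraphClass
end Classes
end GraphInvariants
namespace GraphInvariants

/-! ### Orbits of multigraphs on `Fin n` as classes with at most `n` vertices -/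

section Transport
variable {n : ℕ}

/-- The inclusion of the pairs of vertices of `Fin n`. -/
def edgeVal (e : Edge n) : Sym2 ℕ := Sym2.map Fin.val e.1

theorem edgeVal_injective : Function.Injective (edgeVal : Edge n → Sym2 ℕ) := fun _ _ h =>
  Subtype.ext (Sym2.map.injective Fin.val_injective h)

theorem mem_edgeVal {e : Edge n} {x : ℕ} : x ∈ edgeVal e ↔ ∃ i ∈ e.1, (i : ℕ) = x :=
  Sym2.mem_map

theorem edgeVal_not_isDiag (e : Edge n) : ¬ (edgeVal e).IsDiag := by
  rw [edgeVal, Sym2.isDiag_map Fin.val_injective]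
  exact e.2

/-- A multigraph on `Fin n` as a labelled graph on `ℕ`. -/
noncomputable def embed (g : Multigraph n) : LGraph :=
  ⟨g.mapDomain edgeVal, fun e he => by
    have := Finsupp.mapDomain_support (Finsupp.mem_support_iff.2 he)
    obtain ⟨e, -, rfl⟩ := Finset.mem_image.1 this
    exact edgeVal_not_isDiag e⟩

theorem embed_apply (g : Multigraph n) (e : Edge n) : (embed g).1 (edgeVal e) = g e :=
  Finsupp.mapDomain_apply edgeVal_injective g e

theorem embed_injective : Function.Injective (embed : Multigraph n → LGraph) := fun _ _ h =>
  Finsupp.mapDomain_injective edgeVal_injective (congrArg Subtype.val h)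

theorem embed_ne_zero {g : Multigraph n} {e : Sym2 ℕ} (h : (embed g).1 e ≠ 0) :
    ∃ e', edgeVal e' = e ∧ g e' ≠ 0 := by
  have := Finsupp.mapDomain_support (Finsupp.mem_support_iff.2 h)
  obtain ⟨e, -, rfl⟩ := Finset.mem_image.1 this
  exact ⟨e, rfl, by rwa [embed_apply] at h⟩

theorem val_mem_verts {g : Multigraph n} {i : Fin n} :
    (i : ℕ) ∈ verts (embed g).1 ↔ ∃ e : Edge n, g e ≠ 0 ∧ i ∈ e.1 := by
  rw [mem_verts]
  constructor
  · rintro ⟨e, he, hi⟩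
    obtain ⟨e, rfl, he'⟩ := embed_ne_zero he
    obtain ⟨j, hj, h⟩ := mem_edgeVal.1 hi
    exact ⟨e, he', Fin.val_injective h ▸ hj⟩
  · rintro ⟨e, he, hi⟩
    exact ⟨edgeVal e, by rwa [embed_apply], mem_edgeVal.2 ⟨i, hi, rfl⟩⟩

theorem verts_embed_subset (g : Multigraph n) : verts (embed g).1 ⊆ Finset.range n := by
  intro x hx
  obtain ⟨e, he, hx⟩ := mem_verts.1 hx
  obtain ⟨e, rfl, -⟩ := embed_ne_zero he
  obtain ⟨i, -, rfl⟩ := mem_edgeVal.1 hx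
  exact Finset.mem_range.2 i.2

theorem embed_relabel (σ : Equiv.Perm (Fin n)) (g : Multigraph n) (f : ℕ → ℕ)
    (h : ∀ i : Fin n, (i : ℕ) ∈ verts (embed g).1 → f i = σ i) :
    (embed (g.relabel σ)).1 = push f (embed g).1 := by
  change (g.mapDomain (edgePerm σ)).mapDomain edgeVal = (g.mapDomain edgeVal).mapDomain (Sym2.map f)
  rw [← Finsupp.mapDomain_comp, ← Finsupp.mapDomain_comp]
  refine Finsupp.mapDomain_congr fun e he => ?_
  have he : g e ≠ 0 := Finsupp.mem_support_iff.1 he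
  have h' : ∀ i ∈ e.1, f i = σ i := fun i hi => h i (val_mem_verts.2 ⟨e, he, hi⟩)
  obtain ⟨e, hd⟩ := e
  clear he
  induction e using Sym2.ind with
  | _ a b =>
    change Sym2.map Fin.val (Sym2.map σ s(a, b)) = Sym2.map f (Sym2.map Fin.val s(a, b))
    simp only [Sym2.map_mk]
    rw [h' a (Sym2.mem_mk_left a b), h' b (Sym2.mem_mk_right a b)]

/-- The isomorphism class of a multigraph, disregarding isolated vertices. -/
noncomputable def cls (g : Multigraph n) : GraphClass := GraphClass.mk (embed g)

theorem cls_eq_iff {g h : Multigraph n} : cls g = cls h ↔ g.orbit = h.orbit := by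
  rw [orbit_eq_iff, cls, cls, GraphClass.mk_eq_mk]
  constructor
  · rintro ⟨f, hf, h⟩
    have hmaps : Set.MapsTo (fun i : Fin n => f i) {i : Fin n | (i : ℕ) ∈ verts (embed g).1}
        (Finset.range n) := by
      intro i hi
      apply verts_embed_subset
      rw [← h, verts_push hf]
      exact Finset.mem_image_of_mem f hi
    -- The isomorphism is only controlled on the non-isolated vertices of `g`; being injective
    -- there, it extends to a bijection of all `n` vertices.
    obtain ⟨e, he⟩ := hmaps.exists_equiv_extend_of_card_eq (by simp) (fun i hi j hj hij =>
      Fin.val_injective (hf hi hj hij))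
    let e' : {x // x ∈ Finset.range n} ≃ Fin n :=
      { toFun := fun x => ⟨x.1, Finset.mem_range.1 x.2⟩
        invFun := fun i => ⟨i.1, Finset.mem_range.2 i.2⟩
        left_inv := fun _ => rfl
        right_inv := fun _ => rfl }
    refine ⟨e.trans e', embed_injective (Subtype.ext ?_)⟩
    rw [embed_relabel _ _ f fun i hi => (he i hi).symm, h]
  · rintro ⟨σ, rfl⟩
    refine ⟨fun x => if h : x < n then σ ⟨x, h⟩ else x, ?_, (embed_relabel _ _ _ ?_).symm⟩
    · intro x hx y hy h
      have hx := Finset.mem_range.1 (verts_embed_subset g hx)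
      have hy := Finset.mem_range.1 (verts_embed_subset g hy)
      simp only [hx, hy, dif_pos] at h
      exact congrArg Fin.val (σ.injective (Fin.val_injective h))
    · intro i _
      simp

theorem exists_embed_eq {u : LGraph} (h : verts u.1 ⊆ Finset.range n) :
    ∃ g : Multigraph n, embed g = u := by
  refine ⟨Finsupp.comapDomain edgeVal u.1 edgeVal_injective.injOn, Subtype.ext ?_⟩
  refine Finsupp.mapDomain_comapDomain _ edgeVal_injective _ ?_
  intro e he
  have he : u.1 e ≠ 0 := Finsupp.mem_support_iff.1 he
  have hv : ∀ x ∈ e, x < n := fun x hx => Finset.mem_range.1 (h (mem_verts_of_mem he hx))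
  have hd := u.2 e he
  clear he
  induction e using Sym2.ind with
  | _ a b =>
    refine ⟨⟨s(⟨a, hv a (Sym2.mem_mk_left a b)⟩, ⟨b, hv b (Sym2.mem_mk_right a b)⟩), ?_⟩, rfl⟩
    rw [Sym2.mk_isDiag_iff] at hd ⊢
    exact fun h => hd (congrArg Fin.val h)

theorem exists_cls_eq {x : GraphClass} (h : GraphClass.order x ≤ n) :
    ∃ g : Multigraph n, cls g = x := by
  obtain ⟨u, rfl⟩ := GraphClass.exists_rep x
  rw [GraphClass.order_mk] at h
  obtain ⟨φ⟩ : Nonempty ({x // x ∈ verts u.1} ↪ Fin n) :=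
    Function.Embedding.nonempty_of_card_le (by simpa using h)
  let f : ℕ → ℕ := fun x => if hx : x ∈ verts u.1 then φ ⟨x, hx⟩ else 0
  have hf : ∀ x (hx : x ∈ verts u.1), f x = φ ⟨x, hx⟩ := fun x hx => dif_pos hx
  have hinj : Set.InjOn f (verts u.1) := by
    intro x hx y hy h
    rw [hf x hx, hf y hy] at h
    exact congrArg Subtype.val (φ.injective (Fin.val_injective h))
  obtain ⟨g, hg⟩ := exists_embed_eq (n := n) (u := ⟨push f u.1, loopless_push hinj u.2⟩) (by
    rw [verts_push hinj]
    intro y hy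
    obtain ⟨x, hx, rfl⟩ := Finset.mem_image.1 hy
    rw [hf x hx]
    exact Finset.mem_range.2 (φ _).2)
  refine ⟨g, ?_⟩
  rw [cls, hg]
  exact (GraphClass.mk_eq_mk.2 ⟨f, hinj, rfl⟩).symm

theorem order_cls_le (g : Multigraph n) : GraphClass.order (cls g) ≤ n := by
  have := Finset.card_le_card (verts_embed_subset g)
  rwa [Finset.card_range] at this

theorem order_cls_lt_iff (g : Multigraph n) :
    GraphClass.order (cls g) < n ↔ ∃ v, g.IsIsolated v := by
  have hiso : ∀ v, g.IsIsolated v ↔ (v : ℕ) ∉ verts (embed g).1 := by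
    intro v
    rw [val_mem_verts, Multigraph.IsIsolated]
    push Not
    exact forall_congr' fun e => ⟨fun h h1 h2 => h1 (h h2), fun h h1 => by
      by_contra h2
      exact h h2 h1⟩
  simp only [hiso]
  constructor
  · intro h
    have hss : verts (embed g).1 ⊂ Finset.range n := by
      refine (verts_embed_subset g).ssubset_of_ne fun h' => ?_
      rw [cls, GraphClass.order_mk, h', Finset.card_range] at h
      exact lt_irrefl _ h
    obtain ⟨x, hx, hx'⟩ := Finset.exists_of_ssubset hss
    exact ⟨⟨x, Finset.mem_range.1 hx⟩, hx'⟩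
  · rintro ⟨v, hv⟩
    have hss : verts (embed g).1 ⊂ Finset.range n :=
      (Finset.ssubset_iff_of_subset (verts_embed_subset g)).2 ⟨v, Finset.mem_range.2 v.2, hv⟩
    rw [cls, GraphClass.order_mk]
    exact (Finset.card_lt_card hss).trans_eq (Finset.card_range n)

theorem size_cls (g : Multigraph n) : GraphClass.size (cls g) = ∑ e, g e := by
  rw [cls, GraphClass.size_mk, embed, Finsupp.degree_mapDomain, Finsupp.degree_eq_sum]

/-- The isomorphism classes with at most `n` vertices and `j` edges are the orbits of the
multigraphs on `Fin n` with `j` edges. -/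
noncomputable def orbitEquiv (n j : ℕ) :
    {O // O ∈ (multigraphsOfDegree n j).image Multigraph.orbit} ≃
      {x : GraphClass // GraphClass.order x ≤ n ∧ GraphClass.size x = j} := by
  have hrep : ∀ O : {O // O ∈ (multigraphsOfDegree n j).image Multigraph.orbit},
      ∃ g ∈ multigraphsOfDegree n j, g.orbit = O.1 := fun O => Finset.mem_image.1 O.2
  choose r hr1 hr2 using hrep
  refine Equiv.ofBijective (fun O => ⟨cls (r O), order_cls_le _,
    (size_cls _).trans (mem_multigraphsOfDegree.1 (hr1 O))⟩) ⟨?_, ?_⟩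
  · intro O O' h
    have := cls_eq_iff.1 (congrArg Subtype.val h)
    rw [hr2, hr2] at this
    exact Subtype.ext this
  · rintro ⟨x, hx, hj⟩
    obtain ⟨g, rfl⟩ := exists_cls_eq hx
    have hg : g ∈ multigraphsOfDegree n j :=
      mem_multigraphsOfDegree.2 ((size_cls g).symm.trans hj)
    exact ⟨⟨g.orbit, Finset.mem_image_of_mem _ hg⟩, Subtype.ext (cls_eq_iff.2 (hr2 _))⟩

theorem orbitCount_eq_card (n j : ℕ) :
    orbitCount n j = Nat.card {x : GraphClass // GraphClass.order x ≤ n ∧ GraphClass.size x = j} := by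
  rw [← Nat.card_congr (orbitEquiv n j), Nat.card_eq_fintype_card, Fintype.card_coe, orbitCount]

theorem finite_classes (n j : ℕ) :
    Finite {x : GraphClass // GraphClass.order x ≤ n ∧ GraphClass.size x = j} :=
  Finite.of_equiv _ (orbitEquiv n j)

end Transport
end GraphInvariants
namespace GraphInvariants
open Finset

/-! ### Bigraded Newton identity and its inversion -/

section WeightedCount

set_option linter.unusedSectionVars false

variable {X : Type*} [Fintype X] [DecidableEq X]

/-- Newton's identity for the trivial permutation, with the terms grouped by the bidegree `(a, b)`
that `k` copies of a generator contribute. -/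
theorem mul_card_invMult_one (v e : X → ℕ) (he : ∀ x, 1 ≤ e x) (m j : ℕ) :
    j * #(invMult 1 v e m j) = ∑ a ∈ range (m + 1), ∑ b ∈ range (j + 1),
      (∑ k ∈ Icc 1 b, ∑ x, if k * v x = a ∧ k * e x = b then e x else 0) *
        #(invMult 1 v e (m - a) (j - b)) := by
  rw [mul_card_invMult 1 v e he (fun _ => rfl) (fun _ => rfl)]
  have h1 : ∀ a ∈ range (m + 1), ∀ b ∈ range (j + 1),
      (∑ k ∈ Icc 1 b, ∑ x, if k * v x = a ∧ k * e x = b then e x else 0) *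
        #(invMult 1 v e (m - a) (j - b)) = ∑ x, ∑ k ∈ Icc 1 j,
        if k * v x = a ∧ k * e x = b then
          e x * #(invMult 1 v e (m - k * v x) (j - k * e x)) else 0 := by
    intro a _ b hb
    rw [sum_comm (s := univ)]
    have hsub : Icc 1 b ⊆ Icc 1 j := Icc_subset_Icc_right (by
      have := mem_range.1 hb
      omega)
    rw [← sum_subset hsub, sum_mul]
    · refine sum_congr rfl fun k _ => ?_
      rw [sum_mul]
      refine sum_congr rfl fun x _ => ?_
      split_ifs with h
      · rw [h.1, h.2]
      · rw [zero_mul]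
    · intro k hk hk'
      refine sum_eq_zero fun x _ => if_neg fun h => hk' ?_
      have := Nat.le_mul_of_pos_right k (he x)
      rw [mem_Icc] at hk ⊢
      omega
  rw [sum_congr rfl fun a ha => sum_congr rfl fun b hb => h1 a ha b hb]
  simp only [sum_comm (s := range (j + 1)) (t := univ), sum_comm (s := range (m + 1)) (t := univ),
    sum_comm (s := range (j + 1)) (t := Icc 1 j), sum_comm (s := range (m + 1)) (t := Icc 1 j)]
  refine sum_congr rfl fun x _ => sum_congr rfl fun k _ => ?_
  simp only [Equiv.Perm.one_apply, one_pow, true_and]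
  split_ifs with h
  · rw [sum_eq_single_of_mem (k * v x) (mem_range.2 (by omega)),
      sum_eq_single_of_mem (k * e x) (mem_range.2 (by omega))]
    · simp
    · intro b _ hb
      exact if_neg fun h => hb h.2.symm
    · intro a _ ha
      exact sum_eq_zero fun b _ => if_neg fun h => ha h.1.symm
  · refine (sum_eq_zero fun a ha => sum_eq_zero fun b hb => if_neg fun h' => h ?_).symm
    have := mem_range.1 ha
    have := mem_range.1 hb
    omega

/-- The power sum coefficients of a family of generators counted by bidegree. -/
def powerSum (p : ℕ → ℕ → ℕ) (a b : ℕ) : ℕ :=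
  ∑ k ∈ Icc 1 b, if k ∣ a ∧ k ∣ b then b / k * p (a / k) (b / k) else 0

theorem sum_weights_eq_powerSum (v e : X → ℕ) (a b : ℕ) :
    (∑ k ∈ Icc 1 b, ∑ x, if k * v x = a ∧ k * e x = b then e x else 0) =
      powerSum (fun a b => #{x | v x = a ∧ e x = b}) a b := by
  refine sum_congr rfl fun k hk => ?_
  have hk0 : 0 < k := (mem_Icc.1 hk).1
  split_ifs with h
  · obtain ⟨⟨a, rfl⟩, b, rfl⟩ := h
    rw [Nat.mul_div_cancel_left _ hk0, Nat.mul_div_cancel_left _ hk0]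
    simp only [card_filter, mul_sum]
    refine sum_congr rfl fun x _ => ?_
    simp only [Nat.mul_right_inj hk0.ne']
    split_ifs with h
    · rw [h.2, mul_one]
    · rw [mul_zero]
  · refine sum_eq_zero fun x _ => if_neg fun h' => h ?_
    exact ⟨⟨_, h'.1.symm⟩, ⟨_, h'.2.symm⟩⟩

theorem powerSum_congr {p q : ℕ → ℕ → ℕ} {a b : ℕ}
    (h : ∀ k, 1 ≤ k → k ≤ b → k ∣ a → k ∣ b → p (a / k) (b / k) = q (a / k) (b / k)) :
    powerSum p a b = powerSum q a b := by
  refine sum_congr rfl fun k hk => ?_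
  rw [mem_Icc] at hk
  split_ifs with hd
  · rw [h k hk.1 hk.2 hd.1 hd.2]
  · rfl

/-- The recursion can be solved for the numbers of generators: modulo values at pairs that precede
`(j, m)` lexicographically, its right side is `j * p m j`. -/
theorem eq_of_newton {g p q : ℕ → ℕ → ℕ} {M D : ℕ} (h0 : g 0 0 = 1)
    (hp0 : ∀ m, p m 0 = q m 0)
    (hp : ∀ m ≤ M, ∀ j ≤ D, j * g m j =
      ∑ a ∈ range (m + 1), ∑ b ∈ range (j + 1), powerSum p a b * g (m - a) (j - b))
    (hq : ∀ m ≤ M, ∀ j ≤ D, j * g m j =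
      ∑ a ∈ range (m + 1), ∑ b ∈ range (j + 1), powerSum q a b * g (m - a) (j - b)) :
    ∀ j ≤ D, ∀ m ≤ M, p m j = q m j := by
  intro j
  induction j using Nat.strong_induction_on with
  | _ j ihj =>
    intro hj m
    induction m using Nat.strong_induction_on with
    | _ m ihm =>
      intro hm
      rcases Nat.eq_zero_or_pos j with rfl | hj0
      · exact hp0 m
      -- Such a coefficient only involves entries with fewer edges, or, for `b = j` and `k = 1`,
      -- entries with the same `j` and smaller `a`.
      have hlow : ∀ a ≤ m, ∀ b ≤ j, (a, b) ≠ (m, j) → powerSum p a b = powerSum q a b := by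
        intro a ha b hb hne
        refine powerSum_congr fun k hk hkb hka hkd => ?_
        have ha' : a / k ≤ a := Nat.div_le_self a k
        have hb' : b / k ≤ b := Nat.div_le_self b k
        by_cases hbj : b / k < j
        · exact ihj _ hbj (by omega) _ (by omega)
        · have hbj : b / k = j := by omega
          have hk1 : k = 1 := by
            by_contra hk1
            have := Nat.div_lt_self (n := b) (k := k) (by omega) (by omega)
            omega
          subst hk1
          simp only [Nat.div_one] at hbj ⊢
          subst hbj
          exact ihm a (lt_of_le_of_ne ha fun h => hne (by rw [h])) (by omega)
      have heq := (hp m hm j hj).symm.trans (hq m hm j hj)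
      simp only [← sum_product'] at heq
      have hmem : (m, j) ∈ range (m + 1) ×ˢ range (j + 1) := by simp
      rw [← add_sum_erase _ _ hmem, ← add_sum_erase _ _ hmem] at heq
      have hrest : ∀ x ∈ (range (m + 1) ×ˢ range (j + 1)).erase (m, j),
          powerSum p x.1 x.2 * g (m - x.1) (j - x.2) =
          powerSum q x.1 x.2 * g (m - x.1) (j - x.2) := by
        rintro ⟨a, b⟩ hx
        obtain ⟨hne, hx⟩ := mem_erase.1 hx
        rw [mem_product, mem_range, mem_range] at hx
        rw [hlow a (by omega) b (by omega) hne]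
      rw [sum_congr rfl hrest, Nat.add_right_cancel_iff] at heq
      simp only [Nat.sub_self, h0, mul_one] at heq
      have h1 : (1 : ℕ) ∈ Icc 1 j := mem_Icc.2 ⟨le_rfl, hj0⟩
      -- In the one remaining coefficient, the summand `k = 1` contains the unknown; the others have
      -- `j / k < j`.
      rw [powerSum, powerSum, ← add_sum_erase _ _ h1, ← add_sum_erase _ _ h1] at heq
      have hrest' : ∀ k ∈ (Icc 1 j).erase 1,
          (if k ∣ m ∧ k ∣ j then j / k * p (m / k) (j / k) else 0) =
          if k ∣ m ∧ k ∣ j then j / k * q (m / k) (j / k) else 0 := by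
        intro k hk
        obtain ⟨hk1, hk⟩ := mem_erase.1 hk
        rw [mem_Icc] at hk
        have hlt := Nat.div_lt_self (n := j) (k := k) hj0 (by omega)
        have := Nat.div_le_self m k
        rw [ihj _ hlt (by omega) _ (by omega)]
      rw [sum_congr rfl hrest', Nat.add_right_cancel_iff] at heq
      simpa [hj0.ne'] using heq

end WeightedCount

/-! ### Counting all classes through connected classes -/

section ClassCount
open GradedRefinement

/-- The classes of connected graphs. -/
abbrev IrrClass : Type := Irred GraphClass

/-- The number of classes with `m` vertices and `j` edges. -/
noncomputable def classCount (m j : ℕ) : ℕ :=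
  Nat.card {x : GraphClass // GraphClass.order x = m ∧ GraphClass.size x = j}

/-- The number of irreducible classes with `m` vertices and `j` edges. -/
noncomputable def irrCount (m j : ℕ) : ℕ :=
  Nat.card {p : IrrClass // GraphClass.order p.1 = m ∧ GraphClass.size p.1 = j}

theorem finite_smallIrr (N D : ℕ) :
    {p : IrrClass | GraphClass.order p.1 ≤ N ∧ GraphClass.size p.1 ≤ D}.Finite := by
  have h : (⋃ j ∈ Set.Iic D, {x : GraphClass | GraphClass.order x ≤ N ∧
      GraphClass.size x = j}).Finite :=
    (Set.finite_Iic D).biUnion fun j _ =>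
      @Set.toFinite _ _ (finite_classes N j)
  refine (h.preimage Subtype.val_injective.injOn).subset fun p hp => ?_
  simp only [Set.mem_preimage, Set.mem_iUnion]
  exact ⟨_, hp.2, hp.1, rfl⟩

/-- The irreducible classes with at most `N` vertices and at most `D` edges. -/
noncomputable def smallIrr (N D : ℕ) : Finset IrrClass := (finite_smallIrr N D).toFinset

theorem mem_smallIrr {N D : ℕ} {p : IrrClass} :
    p ∈ smallIrr N D ↔ GraphClass.order p.1 ≤ N ∧ GraphClass.size p.1 ≤ D := by
  simp [smallIrr]

theorem one_le_size (p : IrrClass) : 1 ≤ GraphClass.size p.1 := deg_pos p.2.1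

theorem hom_total (φ : GraphClass →+ ℕ) (s : Multiset IrrClass) :
    φ (total s) = (s.map fun p => φ p.1).sum := by
  rw [total, map_multiset_sum, Multiset.map_map]
  rfl

theorem sum_map_sum_nsmul (X : Finset IrrClass) (f : X → ℕ) (ψ : IrrClass → ℕ) :
    ((∑ x, f x • ({x.1} : Multiset IrrClass)).map ψ).sum = ∑ x, f x * ψ x.1 := by
  have := map_sum (Multiset.sumAddMonoidHom.comp (Multiset.mapAddMonoidHom ψ))
    (fun x : X => f x • ({x.1} : Multiset IrrClass)) univ
  refine this.trans (sum_congr rfl fun x _ => ?_)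
  change (Multiset.map ψ (f x • {x.1})).sum = _
  rw [Multiset.map_nsmul, Multiset.sum_nsmul, Multiset.map_singleton, Multiset.sum_singleton,
    smul_eq_mul]

theorem count_sum_nsmul [DecidableEq IrrClass] (X : Finset IrrClass) (f : X → ℕ) (x : X) :
    (∑ x, f x • ({x.1} : Multiset IrrClass)).count x.1 = f x := by
  rw [Multiset.count_sum', sum_eq_single_of_mem x (mem_univ x)]
  · simp
  · intro y _ hy
    rw [Multiset.count_nsmul, Multiset.count_singleton, if_neg fun h => hy (Subtype.ext h.symm),
      mul_zero]

/-- Unique decomposition: a class is a multiset of irreducible classes, each of which is bounded by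
the order and size of the whole and hence lies in `smallIrr N D`. -/
theorem classCount_eq {N D m j : ℕ} [DecidableEq (smallIrr N D)] (hm : m ≤ N) (hj : j ≤ D) :
    classCount m j = #(invMult (1 : Equiv.Perm (smallIrr N D))
      (fun x => GraphClass.order x.1.1) (fun x => GraphClass.size x.1.1) m j) := by
  classical
  rw [classCount, ← Fintype.card_coe, ← Nat.card_eq_fintype_card]
  symm
  have he : ∀ x : smallIrr N D, 1 ≤ GraphClass.size x.1.1 := fun x => one_le_size x.1
  refine Nat.card_congr (Equiv.ofBijective
    (fun f => ⟨total (∑ x, f.1 x • ({x.1} : Multiset IrrClass)), ?_, ?_⟩) ⟨?_, ?_⟩)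
  · rw [hom_total, sum_map_sum_nsmul]
    exact ((mem_invMult he).1 f.2).2.1
  · rw [hom_total, sum_map_sum_nsmul]
    exact ((mem_invMult he).1 f.2).2.2
  · intro f f' h
    have h := total_injective (congrArg Subtype.val h)
    refine Subtype.ext (funext fun x => ?_)
    have := congrArg (Multiset.count x.1) h
    rwa [count_sum_nsmul, count_sum_nsmul] at this
  · rintro ⟨x, hx1, hx2⟩
    obtain ⟨s, rfl⟩ := total_surjective x
    have hmem : ∀ p ∈ s, p ∈ smallIrr N D := by
      intro p hp
      rw [hom_total] at hx1 hx2
      refine mem_smallIrr.2 ⟨le_trans ?_ hm, le_trans ?_ hj⟩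
      · rw [← hx1]
        exact Multiset.le_sum_of_mem (Multiset.mem_map_of_mem (fun p => GraphClass.order p.1) hp)
      · rw [← hx2]
        exact Multiset.le_sum_of_mem (Multiset.mem_map_of_mem (fun p => GraphClass.size p.1) hp)
    have hs : ∑ x : smallIrr N D, s.count x.1 • ({x.1} : Multiset IrrClass) = s := by
      ext p
      by_cases hp : p ∈ smallIrr N D
      · exact count_sum_nsmul _ (fun x => s.count x.1) ⟨p, hp⟩
      · rw [Multiset.count_sum', Multiset.count_eq_zero.2 fun h => hp (hmem p h)]
        refine sum_eq_zero fun x _ => ?_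
        rw [Multiset.count_nsmul, Multiset.count_singleton, if_neg, mul_zero]
        rintro rfl
        exact hp x.2
    refine ⟨⟨fun x => s.count x.1, (mem_invMult he).2 ⟨fun _ => rfl, ?_, ?_⟩⟩,
      Subtype.ext (congrArg total hs)⟩
    · rw [← hx1, hom_total]
      conv_rhs => rw [← hs]
      rw [sum_map_sum_nsmul]
    · rw [← hx2, hom_total]
      conv_rhs => rw [← hs]
      rw [sum_map_sum_nsmul]

theorem card_filter_smallIrr {N D : ℕ} {m j : ℕ} (hm : m ≤ N) (hj : j ≤ D) :
    #{x : smallIrr N D | GraphClass.order x.1.1 = m ∧ GraphClass.size x.1.1 = j} =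
      irrCount m j := by
  classical
  rw [irrCount, ← Fintype.card_coe, ← Nat.card_eq_fintype_card]
  refine Nat.card_congr
    { toFun := fun x => ⟨x.1.1, (mem_filter.1 x.2).2⟩
      invFun := fun p => ⟨⟨p.1, mem_smallIrr.2 ⟨p.2.1.trans_le hm, p.2.2.trans_le hj⟩⟩,
        mem_filter.2 ⟨mem_univ _, p.2⟩⟩
      left_inv := fun _ => rfl
      right_inv := fun _ => rfl }

/-- The relation between all graphs and connected graphs in recursive form; by `eq_of_newton` it
determines `irrCount`. -/
theorem mul_classCount (m j : ℕ) :
    j * classCount m j = ∑ a ∈ range (m + 1), ∑ b ∈ range (j + 1),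
      powerSum irrCount a b * classCount (m - a) (j - b) := by
  classical
  rw [classCount_eq (N := m) (D := j) le_rfl le_rfl,
    mul_card_invMult_one (X := smallIrr m j) (fun x => GraphClass.order x.1.1)
      (fun x => GraphClass.size x.1.1) fun x => one_le_size x.1]
  refine sum_congr rfl fun a ha => sum_congr rfl fun b hb => ?_
  rw [mem_range] at ha hb
  rw [classCount_eq (N := m) (D := j) (Nat.sub_le _ _) (Nat.sub_le _ _),
    sum_weights_eq_powerSum]
  congr 1
  refine powerSum_congr fun k _ _ _ _ => ?_
  have := Nat.div_le_self a k
  have := Nat.div_le_self b k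
  exact card_filter_smallIrr (by omega) (by omega)

theorem irrCount_zero (m : ℕ) : irrCount m 0 = 0 := by
  rw [irrCount, Nat.card_eq_zero]
  left
  refine ⟨fun p => ?_⟩
  have := one_le_size p.1
  have := p.2.2
  omega

theorem orbitCount_eq_sum (n j : ℕ) :
    orbitCount n j = ∑ m ∈ range (n + 1), classCount m j := by
  classical
  have := finite_classes n j
  have hf : ∀ m ≤ n, Finite {x : GraphClass // GraphClass.order x = m ∧ GraphClass.size x = j} :=
    fun m hm => Finite.of_injective
      (fun x => (⟨x.1, x.2.1.trans_le hm, x.2.2⟩ :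
        {x : GraphClass // GraphClass.order x ≤ n ∧ GraphClass.size x = j}))
      fun x y h => Subtype.ext (congrArg (fun z => z.1) h)
  have : ∀ m : Fin (n + 1), Finite {x : GraphClass // GraphClass.order x = m ∧
    GraphClass.size x = j} := fun m => hf m (Nat.le_of_lt_succ m.2)
  rw [orbitCount_eq_card, ← Fin.sum_univ_eq_sum_range (fun m => classCount m j)]
  simp only [classCount]
  rw [← Nat.card_sigma]
  exact Nat.card_congr
    { toFun := fun x => ⟨⟨GraphClass.order x.1, Nat.lt_succ_of_le x.2.1⟩, x.1, rfl, x.2.2⟩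
      invFun := fun y => ⟨y.2.1, y.2.2.1.trans_le (Nat.le_of_lt_succ y.1.2), y.2.2.2⟩
      left_inv := fun _ => rfl
      right_inv := by
        rintro ⟨⟨m, hm⟩, x, hx, hx'⟩
        dsimp only at hx
        subst hx
        rfl }

/-- The multisets of irreducible classes with less than `n` vertices each and `j` edges
in total, for `j ≤ D`. -/
noncomputable def generatorMonomials (n D j : ℕ) : Finset (smallIrr (n - 1) D → ℕ) :=
  by classical exact invMult 1 (fun _ => 0) (fun x => GraphClass.size x.1.1) 0 j

/-- The number of vertices plays no role in the degree of a monomial, so the first weight is set to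
zero and only the edge grading remains. -/
theorem mul_card_generatorMonomials (n D j : ℕ) :
    j * #(generatorMonomials n D j) = ∑ b ∈ range (j + 1),
      powerSum (fun _ b => #{x : smallIrr (n - 1) D | GraphClass.size x.1.1 = b}) 0 b *
        #(generatorMonomials n D (j - b)) := by
  classical
  have h := mul_card_invMult_one (X := smallIrr (n - 1) D) (fun _ => 0)
    (fun x => GraphClass.size x.1.1) (fun x => one_le_size x.1) 0 j
  simp only [zero_add, range_one, sum_singleton, Nat.sub_self] at h
  refine h.trans (sum_congr rfl fun b _ => congrArg₂ _ ?_ rfl)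
  rw [sum_weights_eq_powerSum (X := smallIrr (n - 1) D) (fun _ => 0)
    (fun x => GraphClass.size x.1.1) 0 b]
  exact powerSum_congr fun k _ _ _ _ => by simp only [Nat.zero_div, true_and]

theorem card_filter_size_smallIrr {n D b : ℕ} (hn : 1 ≤ n) (hb : b ≤ D) :
    #{x : smallIrr (n - 1) D | GraphClass.size x.1.1 = b} = ∑ a ∈ range n, irrCount a b := by
  classical
  rw [card_eq_sum_card_fiberwise (f := fun x : smallIrr (n - 1) D => GraphClass.order x.1.1)
    (t := range n)]
  · refine sum_congr rfl fun a ha => ?_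
    rw [mem_range] at ha
    rw [← card_filter_smallIrr (N := n - 1) (D := D) (by omega) (by omega), filter_filter]
    simp only [and_comm]
  · rintro (x : smallIrr (n - 1) D) _
    have := (mem_smallIrr.1 x.2).1
    simp only [coe_range, Set.mem_Iio]
    omega

end ClassCount
end GraphInvariants
namespace GraphInvariants
open Finset

/-! ### Numerical tables and their kernel checks -/

section Tables

/-- The row of index `m` of a table. -/
def row (T : List (List ℕ)) (m : ℕ) : List ℕ := T.getD m []

/-- The numbers of classes with `m ≤ 18` vertices and `24, …, 0` edges. -/
def classTable : List (List ℕ) :=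
  [[0, 0, 0, 0, 0, 0, 0, 0, 0, 0, 0, 0, 0, 0, 0, 0, 0, 0, 0, 0, 0, 0, 0, 0, 1],
  [0, 0, 0, 0, 0, 0, 0, 0, 0, 0, 0, 0, 0, 0, 0, 0, 0, 0, 0, 0, 0, 0, 0, 0, 0],
  [1, 1, 1, 1, 1, 1, 1, 1, 1, 1, 1, 1, 1, 1, 1, 1, 1, 1, 1, 1, 1, 1, 1, 1, 0],
  [60, 55, 51, 47, 43, 39, 36, 32, 29, 26, 23, 20, 18, 15, 13, 11, 9, 7, 6, 4, 3, 2, 1, 0, 0],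
  [5199, 4312, 3557, 2910, 2361, 1896, 1513, 1188, 926, 711, 538, 399, 294, 208, 146, 99, 65,
   40, 25, 13, 7, 3, 1, 0, 0],
  [325893, 237282, 170794, 121380, 85122, 58808, 40000, 26723, 17529, 11248, 7058, 4310, 2561,
   1467, 814, 428, 216, 101, 44, 17, 6, 1, 0, 0, 0],
  [13445213, 8491282, 5278093, 3225236, 1934976, 1138068, 655200, 368484, 202061, 107759, 55743,
   27874, 13436, 6204, 2737, 1145, 450, 164, 56, 17, 4, 1, 0, 0, 0],
  [345347996, 188046347, 100382161, 52459266, 26797423, 13357044, 6484106, 3058701, 1398775,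
   618345, 263429, 107736, 42154, 15679, 5523, 1826, 562, 158, 41, 8, 1, 0, 0, 0, 0],
  [5535903507, 2594936897, 1188308408, 530774891, 230842407, 97567262, 39989818, 15856580,
   6066651, 2232874, 788098, 265751, 85297, 25931, 7443, 1999, 503, 117, 24, 4, 1, 0, 0, 0, 0],
  [56634893392, 22881268849, 9003404962, 3444453243, 1278805208, 459790120, 159735330, 53485983,
   17214653, 5309708, 1564532, 438820, 116765, 29340, 6938, 1533, 315, 57, 9, 1, 0, 0, 0, 0, 0],
  [381560717557, 133271916198, 45216250532, 14874781614, 4735407103, 1455764349, 431175574,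
   122735456, 33488864, 8734613, 2171638, 513217, 115017, 24375, 4879, 922, 162, 26, 4, 1, 0, 0,
   0, 0, 0],
  [1750950742583, 530932712302, 156032382705, 44361380453, 12177463561, 3220754231, 818921342,
   199710370, 46602199, 10380838, 2202619, 444293, 85078, 15442, 2659, 428, 64, 9, 1, 0, 0, 0, 0,
   0, 0],
  [5657271883654, 1496528358191, 382984822218, 94648843278, 22545643123, 5166136531, 1136450400,
   239524330, 48278664, 9291259, 1705552, 298535, 49896, 7981, 1227, 182, 27, 4, 1, 0, 0, 0, 0,
   0, 0],
  [13277266887963, 3080479546045, 690464732128, 149258936706, 31064220235, 6213690932,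
   1192587975, 219304180, 38596449, 6498066, 1047105, 161782, 24068, 3458, 482, 66, 9, 1, 0, 0,
   0, 0, 0, 0, 0],
  [23295880847706, 4767367695210, 941643080334, 179244718178, 32834063607, 5780216402,
   976881921, 158400018, 24646678, 3685015, 531138, 74234, 10148, 1374, 189, 27, 4, 1, 0, 0, 0,
   0, 0, 0, 0],
  [31373406586830, 5696727536406, 997968720359, 168466284283, 27375932391, 4279361397,
   643384282, 93097908, 12991489, 1755168, 231089, 29924, 3859, 502, 67, 9, 1, 0, 0, 0, 0, 0, 0,
   0, 0],
  [33222968412221, 5386063959655, 842601286731, 127107817188, 18482832504, 2591320675,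
   350714061, 45941770, 5852502, 730546, 90358, 11232, 1433, 191, 27, 4, 1, 0, 0, 0, 0, 0, 0, 0,
   0],
  [28286989145236, 4121697757682, 580118814603, 78867902884, 10363545719, 1318450013, 162906318,
   19652271, 2333351, 275704, 32876, 4018, 509, 67, 9, 1, 0, 0, 0, 0, 0, 0, 0, 0, 0],
  [19773528865165, 2608526546818, 333080567176, 41209113953, 4950406507, 579528737, 66496862,
   7542271, 855479, 98439, 11680, 1453, 192, 27, 4, 1, 0, 0, 0, 0, 0, 0, 0, 0, 0]]

/-- The numbers of irreducible classes with `m ≤ 17` vertices and `0, …, 24` edges. -/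
def irrTable : List (List ℕ) :=
  [[0, 0, 0, 0, 0, 0, 0, 0, 0, 0, 0, 0, 0, 0, 0, 0, 0, 0, 0, 0, 0, 0, 0, 0, 0],
  [0, 0, 0, 0, 0, 0, 0, 0, 0, 0, 0, 0, 0, 0, 0, 0, 0, 0, 0, 0, 0, 0, 0, 0, 0],
  [0, 1, 1, 1, 1, 1, 1, 1, 1, 1, 1, 1, 1, 1, 1, 1, 1, 1, 1, 1, 1, 1, 1, 1, 1],
  [0, 0, 1, 2, 3, 4, 6, 7, 9, 11, 13, 15, 18, 20, 23, 26, 29, 32, 36, 39, 43, 47, 51, 55, 60],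
  [0, 0, 0, 2, 5, 11, 22, 37, 61, 95, 141, 203, 288, 393, 531, 704, 918, 1180, 1504, 1887, 2351,
   2900, 3546, 4301, 5187],
  [0, 0, 0, 0, 3, 11, 34, 85, 193, 396, 771, 1411, 2490, 4221, 6949, 11116, 17371, 26536, 39781,
   58553, 84828, 121043, 170410, 236847, 325403],
  [0, 0, 0, 0, 0, 6, 29, 110, 348, 969, 2445, 5746, 12736, 26843, 54256, 105669, 199170, 364565,
   649956, 1131159, 1925974, 3213653, 5263326, 8472653, 13421898],
  [0, 0, 0, 0, 0, 0, 11, 70, 339, 1318, 4457, 13572, 38201, 100622, 251078, 597554, 1364722,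
   3004250, 6398915, 13226339, 26600435, 52167176, 99955523, 187431741, 344473926],
  [0, 0, 0, 0, 0, 0, 0, 23, 185, 1067, 4940, 19753, 70930, 234096, 721332, 2097462, 5801091,
   15351493, 39054916, 95879452, 227863718, 525627224, 1179582797, 2580410577, 5512121962],
  [0, 0, 0, 0, 0, 0, 0, 0, 47, 479, 3294, 17927, 83732, 349156, 1333992, 4743843, 15881206,
   50455727, 153070783, 445562689, 1249252040, 3384596070, 8884978643, 22652027734, 56200120477],
  [0, 0, 0, 0, 0, 0, 0, 0, 0, 106, 1279, 10218, 64182, 344070, 1643022, 7169559, 29067481,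
   110754990, 399907209, 1376897712, 4542633166, 14417080816, 44158527181, 130888576125,
   376316200226],
  [0, 0, 0, 0, 0, 0, 0, 0, 0, 0, 235, 3413, 31455, 225567, 1373921, 7430359, 36645872,
   167659453, 720003511, 2926921776, 11334739937, 42021634061, 149729817677, 514429402039,
   1708871120541],
  [0, 0, 0, 0, 0, 0, 0, 0, 0, 0, 0, 551, 9261, 96807, 783229, 5361580, 32516178, 179544427,
   918629994, 4407747054, 20004863139, 86433959396, 357288943135, 1418605192960, 5427757446233],
  [0, 0, 0, 0, 0, 0, 0, 0, 0, 0, 0, 0, 1301, 25184, 296762, 2686412, 20499779, 138283088,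
   848095079, 4814970946, 25617875768, 128852138104, 616684906096, 2822493486501, 12403062313404],
  [0, 0, 0, 0, 0, 0, 0, 0, 0, 0, 0, 0, 0, 3159, 69122, 908418, 9124992, 77031590, 573794691,
   3881316558, 24284574649, 142310908166, 788067937167, 4151129607765, 20904506409357],
  [0, 0, 0, 0, 0, 0, 0, 0, 0, 0, 0, 0, 0, 0, 7741, 190451, 2773772, 30716622, 285048956,
   2330057270, 17277449155, 118417694383, 759813073515, 4605461016965, 26546767056472],
  [0, 0, 0, 0, 0, 0, 0, 0, 0, 0, 0, 0, 0, 0, 0, 19320, 527641, 8456064, 102605186, 1040711148,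
   9283913001, 75054416644, 560501106278, 3917022879083, 25852248812418],
  [0, 0, 0, 0, 0, 0, 0, 0, 0, 0, 0, 0, 0, 0, 0, 0, 48629, 1467058, 25732055, 340351420,
   3754365670, 36372017628, 319046297120, 2583741479514, 19573556191833]]

/-- The power sum coefficients of `irrTable`. -/
def powerSumTable : List (List ℕ) :=
  [[0, 0, 0, 0, 0, 0, 0, 0, 0, 0, 0, 0, 0, 0, 0, 0, 0, 0, 0, 0, 0, 0, 0, 0, 0],
  [0, 0, 0, 0, 0, 0, 0, 0, 0, 0, 0, 0, 0, 0, 0, 0, 0, 0, 0, 0, 0, 0, 0, 0, 0],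
  [0, 1, 2, 3, 4, 5, 6, 7, 8, 9, 10, 11, 12, 13, 14, 15, 16, 17, 18, 19, 20, 21, 22, 23, 24],
  [0, 0, 2, 6, 12, 20, 36, 49, 72, 99, 130, 165, 216, 260, 322, 390, 464, 544, 648, 741, 860,
   987, 1122, 1265, 1440],
  [0, 0, 1, 6, 22, 55, 135, 259, 492, 855, 1415, 2233, 3462, 5109, 7441, 10560, 14696, 20060,
   27081, 35853, 47030, 60900, 78023, 98923, 124500],
  [0, 0, 0, 0, 12, 55, 204, 595, 1544, 3564, 7710, 15521, 29880, 54873, 97286, 166740, 277936,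
   451112, 716058, 1112507, 1696560, 2541903, 3749020, 5447481, 7809672],
  [0, 0, 0, 1, 2, 30, 182, 770, 2796, 8724, 24470, 63206, 152872, 348959, 759633, 1585040,
   3186792, 6197605, 11699313, 21492021, 38519610, 67486720, 115793337, 194871019, 322125776],
  [0, 0, 0, 0, 0, 0, 66, 490, 2712, 11862, 44570, 149292, 458412, 1308086, 3515092, 8963310,
   21835552, 51072250, 115180470, 251300441, 532008700, 1095510696, 2199021506, 4310930043,
   8267374224],
  [0, 0, 0, 0, 1, 0, 6, 161, 1502, 9603, 49455, 217283, 851295, 3043248, 10098907, 31461930,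
   92817948, 260975381, 702989343, 1821709588, 4557275775, 11038171704, 25950823767, 59349443271,
   132290930550],
  [0, 0, 0, 0, 0, 0, 2, 0, 376, 4317, 32940, 197197, 1004796, 4539028, 18675888, 71157665,
   254099296, 857747359, 2755274130, 8465691091, 24985040800, 71076517519, 195469530146,
   520996637882, 1348802891520],
  [0, 0, 0, 0, 0, 1, 0, 0, 12, 954, 12847, 112398, 770388, 4472910, 23002903, 107543388,
   465081240, 1882834830, 7198333326, 26161056528, 90852671034, 302758697136, 971487613503,
   3010437250875, 9031588835304],
  [0, 0, 0, 0, 0, 0, 0, 0, 0, 0, 2350, 37543, 377460, 2932371, 19234894, 111455385, 586333952,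
   2850210701, 12960063198, 55611513744, 226694798740, 882454315281, 3294055988894,
   11831876246897, 41012906892984],
  [0, 0, 0, 0, 0, 0, 1, 0, 2, 6, 30, 6061, 111334, 1258491, 10965976, 80423755, 520261644,
   3052255259, 16535348748, 83747194026, 400097287250, 1815113147575, 7860356812176,
   32627919438080, 130266178862952],
  [0, 0, 0, 0, 0, 0, 0, 0, 0, 0, 0, 0, 15612, 327392, 4154668, 40296180, 327996464, 2350812496,
   15265711422, 91484447974, 512357515360, 2705894900184, 13567067934112, 64917350189523,
   297673495521696],
  [0, 0, 0, 0, 0, 0, 0, 1, 0, 0, 0, 0, 66, 41067, 968200, 13626270, 146002584, 1309537030,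
   10328316300, 73745014602, 485691537550, 2988529071489, 17337494766966, 95475980978595,
   501708154282980],
  [0, 0, 0, 0, 0, 0, 0, 0, 0, 0, 2, 0, 12, 0, 108374, 2856826, 44380352, 522182574, 5130881412,
   44271088130, 345548983112, 2486771582638, 16715887617330, 105925603390195, 637122409356872],
  [0, 0, 0, 0, 0, 0, 0, 0, 1, 0, 0, 0, 6, 0, 161, 289800, 8443758, 143753088, 1846902951,
   19773511812, 185678309475, 1576142749524, 12331024555399, 90091526218909, 620453972349327],
  [0, 0, 0, 0, 0, 0, 0, 0, 0, 0, 0, 0, 0, 0, 0, 0, 778064, 24939986, 463176990, 6466676980,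
   75087313400, 763812370188, 7019018536640, 59426054028822, 469765348603992]]

/-- The power sum coefficients in degrees `1, …, 24` of the irreducible classes with less than
`n` vertices, for `n = 11, …, 18`. -/
def generatorTable : List (List ℕ) :=
  [[1, 5, 16, 53, 166, 638, 2332, 9517, 39994, 173580, 757307, 3271622, 13772487, 56158912,
   220889191, 837321341, 3059299159, 10784256434, 36722398790, 120967424748, 386038989877,
   1195227349827, 3595294680783, 10521283340446],
  [1, 5, 16, 53, 166, 638, 2332, 9517, 39994, 175930, 794850, 3649082, 16704858, 75393806,
   332344576, 1423655293, 5909509860, 23744319632, 92333912534, 347662225838, 1268493305158,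
   4489283376264, 15427170927680, 51534190610890],
  [1, 5, 16, 53, 166, 638, 2332, 9517, 39994, 175930, 800911, 3760214, 17963349, 86359012,
   412768276, 1943914141, 8961765119, 40279659524, 176081106560, 747759488618, 3083606452474,
   12349640131295, 48055090365760, 181800369431614],
  [1, 5, 16, 53, 166, 638, 2332, 9517, 39994, 175930, 800911, 3775826, 18290741, 90513680,
   453064456, 2271910605, 11312577615, 55545370946, 267565554534, 1260117003978, 5789501352658,
   25916708065407, 112972440555283, 479473864968922],
  [1, 5, 16, 53, 166, 638, 2332, 9517, 39994, 175930, 800911, 3775826, 18331808, 91481388,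
   466690726, 2417910477, 12622114645, 65873675384, 341310569136, 1745808496958, 8778030424144,
   43254202683081, 208448421533878, 981182018793490],
  [1, 5, 16, 53, 166, 638, 2332, 9517, 39994, 175930, 800911, 3775826, 18331808, 91589762,
   469547491, 2462290829, 13144297219, 71004556592, 385581657266, 2091357480058, 11264802006187,
   59970090300411, 314374024924073, 1618304428148818],
  [1, 5, 16, 53, 166, 638, 2332, 9517, 39994, 175930, 800911, 3775826, 18331808, 91589762,
   469837291, 2470733085, 13288050307, 72851449940, 405355169078, 2277035740078, 12840944755711,
   72301114638527, 404465551142982, 2238758399646850],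
  [1, 5, 16, 53, 166, 638, 2332, 9517, 39994, 175930, 800911, 3775826, 18331808, 91589762,
   469837291, 2471511149, 13312990293, 73314626930, 411821846058, 2352123053478, 13604757125899,
   79320133175167, 463891605171804, 2708523748250842]]

/-- The entry of `classTable` for `m` vertices and `j` edges. -/
def tableClass (m j : ℕ) : ℕ := (row classTable m).getD (24 - j) 0

/-- The entry of `irrTable` for `m` vertices and `j` edges. -/
def tableIrr (m j : ℕ) : ℕ := (row irrTable m).getD j 0

/-- The entry of `powerSumTable` for `m` vertices and `j` edges. -/
def tablePower (m j : ℕ) : ℕ := (row powerSumTable m).getD j 0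

/-- The numbers of classes with at most `n` vertices and `24, …, 0` edges. -/
noncomputable def cumulativeRow (n : ℕ) : List ℕ :=
  Nat.rec (motive := fun _ => List ℕ) (row classTable 0)
    (fun m ih => axpy 1 (row classTable (Nat.succ m)) ih) n

/-- The coefficient for `m` vertices and `j` edges of the product of `powerSumTable` and
`classTable`. -/
noncomputable def cell (m j : ℕ) : ℕ :=
  Nat.rec (motive := fun _ => ℕ) 0 (fun a ih => Nat.add ih
    (dot (row powerSumTable a) ((row classTable (m - a)).drop (24 - j)))) (Nat.succ m)

set_option maxRecDepth 100000

theorem length_row_classTable : ∀ m < 19, (row classTable m).length = 25 := by decide +kernel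

theorem length_row_powerSumTable : ∀ m < 18, (row powerSumTable m).length = 25 := by
  decide +kernel

/-- With `tablePower_eq_powerSum` this is the bigraded Newton identity for the tables. Rows of
`classTable` descend in degree and rows of `powerSumTable` ascend, so each convolution is a scalar
product. -/
theorem mul_tableClass_eq_cell : ∀ m < 18, ∀ j < 25, j * tableClass m j = cell m j := by
  decide +kernel

theorem tablePower_eq_powerSum : ∀ m < 18, ∀ j < 25,
    tablePower m j = powerSum tableIrr m j := by
  decide +kernel

theorem tableIrr_zero : ∀ m < 18, tableIrr m 0 = 0 := by decide +kernel

/-- Row `i` belongs to `n = i + 11`, whose generators have order below `i + 11`. -/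
theorem generatorTable_eq : ∀ i < 8, row generatorTable i = (List.range 24).map fun k =>
    powerSum (fun _ b => ∑ a ∈ range (i + 11), tableIrr a b) 0 (k + 1) := by
  decide +kernel

/-- The numerical heart of part (ii). Both lists descend, so their heads belong to degree 24: on the
left the monomials in the generators, on the right all orbits. -/
theorem newtonList_generatorTable_lt : ∀ i < 8,
    (newtonList (row generatorTable i) 24).getD 0 0 < (cumulativeRow (i + 11)).getD 0 0 := by
  decide +kernel

/-- The degrees `1, …, 24`. -/
def degreeList : List ℕ :=
  [1, 2, 3, 4, 5, 6, 7, 8, 9, 10, 11, 12, 13, 14, 15, 16, 17, 18, 19, 20, 21, 22, 23, 24]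

/-- This anchors `classTable` to Burnside's count. Both sides carry the factor `n!`, which is
cancelled later. -/
theorem burnsideList_eq_cumulativeRow : ∀ n < 19, burnsideList n degreeList 24 =
    (cumulativeRow n).map (· * n.factorial) := by
  decide +kernel

end Tables
end GraphInvariants
namespace GraphInvariants
open Finset

/-! ### The tables are the true counts -/

section TableCounts

theorem eq_map_range_getD (l : List ℕ) : l = (List.range l.length).map fun i => l.getD i 0 := by
  refine List.ext_getElem (by simp) fun i h _ => ?_
  simp [h]

theorem dot_eq_sum (as hs : List ℕ) :
    dot as hs = ∑ i ∈ range (min as.length hs.length), as.getD i 0 * hs.getD i 0 := by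
  conv_lhs => rw [eq_map_range_getD as, eq_map_range_getD hs]
  exact dot_map_range _ _ _ _

theorem row_classTable {m : ℕ} (hm : m < 19) :
    row classTable m = (List.range 25).map fun i => tableClass m (24 - i) := by
  rw [eq_map_range_getD (row classTable m), length_row_classTable m hm]
  refine List.map_congr_left fun i hi => ?_
  rw [List.mem_range] at hi
  rw [tableClass, Nat.sub_sub_self (by omega)]

theorem cumulativeRow_eq {n : ℕ} (hn : n < 19) :
    cumulativeRow n = (List.range 25).map fun i => ∑ m ∈ range (n + 1), tableClass m (24 - i) := by
  induction n with
  | zero =>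
    simp only [zero_add, range_one, sum_singleton]
    exact row_classTable (by omega)
  | succ n ih =>
    have h : cumulativeRow (n + 1) = axpy 1 (row classTable (n + 1)) (cumulativeRow n) := rfl
    rw [h, ih (by omega), row_classTable hn, axpy_map_range]
    refine List.map_congr_left fun i _ => ?_
    rw [sum_range_succ _ (n + 1), one_mul, add_comm]

theorem orbitCount_eq_tableClass {n j : ℕ} (hn : n < 19) (hj : j ≤ 24) :
    orbitCount n j = ∑ m ∈ range (n + 1), tableClass m j := by
  have h := burnsideList_eq_cumulativeRow n hn
  have hd : degreeList = (List.range 24).map (· + 1) := rfl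
  rw [hd, burnsideList_eq, cumulativeRow_eq hn, List.map_map] at h
  have h := List.map_inj_left.1 h (24 - j) (List.mem_range.2 (by omega))
  rw [Function.comp, Nat.sub_sub_self hj] at h
  exact Nat.eq_of_mul_eq_mul_right n.factorial_pos h

/-- Burnside gives the classes with at most `n` vertices; differences over consecutive `n` isolate
those with exactly `m`. -/
theorem classCount_eq_tableClass {m j : ℕ} (hm : m < 19) (hj : j ≤ 24) :
    classCount m j = tableClass m j := by
  have h : ∀ n < 19, ∑ m ∈ range (n + 1), classCount m j = ∑ m ∈ range (n + 1), tableClass m j :=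
    fun n hn => (orbitCount_eq_sum n j).symm.trans (orbitCount_eq_tableClass hn hj)
  cases m with
  | zero => simpa using h 0 (by omega)
  | succ m =>
    have h1 := h (m + 1) hm
    rwa [sum_range_succ, h m (by omega), sum_range_succ _ (m + 1), Nat.add_left_cancel_iff] at h1

theorem cell_eq {m j : ℕ} (hm : m < 18) (hj : j < 25) : cell m j =
    ∑ a ∈ range (m + 1), ∑ b ∈ range (j + 1), tablePower a b * tableClass (m - a) (j - b) := by
  have h : ∀ k ≤ m + 1, Nat.rec (motive := fun _ => ℕ) 0 (fun a ih => Nat.add ih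
      (dot (row powerSumTable a) ((row classTable (m - a)).drop (24 - j)))) k =
      ∑ a ∈ range k, ∑ b ∈ range (j + 1), tablePower a b * tableClass (m - a) (j - b) := by
    intro k hk
    induction k with
    | zero => rfl
    | succ k ih =>
      rw [sum_range_succ, ← ih (by omega)]
      refine congrArg (Nat.add _) ?_
      rw [dot_eq_sum, List.length_drop, length_row_classTable _ (by omega),
        length_row_powerSumTable _ (by omega), min_eq_right (by omega),
        show 25 - (24 - j) = j + 1 by omega]
      refine sum_congr rfl fun b hb => ?_
      rw [mem_range] at hb
      rw [tablePower, tableClass, List.getD_eq_getElem?_getD (l := List.drop _ _),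
        List.getElem?_drop, ← List.getD_eq_getElem?_getD, show 24 - j + b = 24 - (j - b) by omega]
  exact h (m + 1) le_rfl

/-- Both families satisfy the same Newton identity against `classCount`, so `eq_of_newton`
identifies them. -/
theorem irrCount_eq_tableIrr {m j : ℕ} (hm : m < 18) (hj : j < 25) :
    irrCount m j = tableIrr m j := by
  -- `eq_of_newton` asks for agreement in degree zero at every `m`, also beyond the table, hence the
  -- extension by zero.
  let q : ℕ → ℕ → ℕ := fun m j => if m < 18 then tableIrr m j else 0
  have hq : ∀ m j, m < 18 → q m j = tableIrr m j := fun m j h => if_pos h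
  rw [← hq m j hm]
  refine eq_of_newton (g := classCount) (M := 17) (D := 24) ?_ ?_ ?_ ?_ j (by omega) m (by omega)
  · rw [classCount_eq_tableClass (by omega) (by omega)]
    rfl
  · intro m
    rw [irrCount_zero]
    change 0 = if m < 18 then tableIrr m 0 else 0
    split_ifs with h
    · rw [tableIrr_zero m h]
    · rfl
  · exact fun m _ j _ => mul_classCount m j
  · intro m hm j hj
    rw [classCount_eq_tableClass (by omega) hj, mul_tableClass_eq_cell m (by omega) j (by omega),
      cell_eq (by omega) (by omega)]
    refine sum_congr rfl fun a ha => sum_congr rfl fun b hb => ?_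
    rw [mem_range] at ha hb
    rw [classCount_eq_tableClass (by omega) (by omega),
      tablePower_eq_powerSum a (by omega) b (by omega)]
    congr 1
    refine powerSum_congr fun k _ _ _ _ => (hq _ _ ?_).symm
    have := Nat.div_le_self a k
    omega

/-- There are fewer monomials of degree `24` in the irreducible classes with less than `n`
vertices than orbits of multigraphs with `24` edges on `n` vertices. -/
theorem card_generatorMonomials_lt {n : ℕ} (hn : 11 ≤ n) (hn' : n ≤ 18) :
    #(generatorMonomials n 24 24) < orbitCount n 24 := by
  classical
  obtain ⟨i, rfl⟩ := Nat.exists_eq_add_of_le' hn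
  have h := newtonList_generatorTable_lt i (by omega)
  rw [cumulativeRow_eq (by omega), generatorTable_eq i (by omega)] at h
  let a : ℕ → ℕ := powerSum (fun _ b => #{x : smallIrr (i + 11 - 1) 24 | GraphClass.size x.1.1 = b}) 0
  have ha : ((List.range 24).map fun k =>
      powerSum (fun _ b => ∑ a ∈ range (i + 11), tableIrr a b) 0 (k + 1)) =
      (List.range 24).map fun k => a (k + 1) := by
    refine List.map_congr_left fun k hk => powerSum_congr fun l _ _ _ _ => ?_
    rw [List.mem_range] at hk
    have := Nat.div_le_self (k + 1) l
    rw [card_filter_size_smallIrr (by omega) (by omega)]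
    refine sum_congr rfl fun m hm => ?_
    rw [mem_range] at hm
    exact (irrCount_eq_tableIrr (by omega) (by omega)).symm
  rw [ha, newtonList_eq a (fun j => #(generatorMonomials (i + 11) 24 j)) 24 ?_ ?_ 24 le_rfl] at h
  · rw [orbitCount_eq_tableClass (by omega) le_rfl]
    simpa using h
  · exact card_invMult_zero _ _ _ fun x => one_le_size x.1
  · intro d
    rw [mul_card_generatorMonomials, sum_range_succ']
    have : powerSum (fun _ b => #{x : smallIrr (i + 11 - 1) 24 | GraphClass.size x.1.1 = b}) 0 0 = 0 := by
      simp [powerSum]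
    rw [this, zero_mul, add_zero]
    exact sum_congr rfl fun k _ => by rw [Nat.add_sub_add_right]

end TableCounts
end GraphInvariants
namespace GraphInvariants
open Finset MvPolynomial

/-! ### Homogeneous elements of a subalgebra with homogeneous generators -/

section Homogeneous
variable {K : Type*} [Field K] {σ ι : Type*}

theorem isHomogeneous_finsuppProd {y : ι → MvPolynomial σ K} {w : ι → ℕ}
    (hy : ∀ i, (y i).IsHomogeneous (w i)) (f : ι →₀ ℕ) :
    (f.prod fun i k => y i ^ k).IsHomogeneous (f.sum fun i k => k * w i) := by
  refine IsHomogeneous.prod _ _ _ fun i _ => ?_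
  simp only [mul_comm (f i)]
  exact (hy i).pow _

/-- A homogeneous polynomial in homogeneous generators is a linear combination of the monomials
of its degree in the generators. -/
theorem mem_span_of_mem_adjoin {y : ι → MvPolynomial σ K} {w : ι → ℕ}
    (hy : ∀ i, (y i).IsHomogeneous (w i)) {p : MvPolynomial σ K} {d : ℕ}
    (hp : p.IsHomogeneous d) (hmem : p ∈ Algebra.adjoin K (Set.range y)) :
    p ∈ Submodule.span K ((fun f : ι →₀ ℕ => f.prod fun i k => y i ^ k) ''
      {f | (f.sum fun i k => k * w i) = d}) := by
  rw [Algebra.adjoin_range_eq_range_aeval] at hmem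
  obtain ⟨P, hP⟩ := hmem
  have hP : aeval y P = p := hP
  have h := homogeneousComponent_of_mem (m := d) ((mem_homogeneousSubmodule _ _).2 hp)
  rw [if_pos rfl] at h
  rw [← h, ← hP, aeval_def, eval₂_eq, map_sum]
  refine Submodule.sum_mem _ fun f _ => ?_
  rw [algebraMap_eq, homogeneousComponent_C_mul, ← smul_eq_C_mul]
  refine Submodule.smul_mem _ _ ?_
  change homogeneousComponent d (f.prod fun i k => y i ^ k) ∈ _
  -- Each monomial in the generators is homogeneous, so its component in degree `d` is the monomial
  -- itself or zero.
  rw [homogeneousComponent_of_mem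
    ((mem_homogeneousSubmodule _ _).2 (isHomogeneous_finsuppProd hy f))]
  split_ifs with hd
  · exact Submodule.subset_span ⟨f, hd.symm, rfl⟩
  · exact Submodule.zero_mem _

theorem card_le_of_linearIndependent {V : Type*} [AddCommGroup V] [Module K V] [Fintype ι]
    {v : ι → V} (hv : LinearIndependent K v) (W : Finset V)
    (h : ∀ i, v i ∈ Submodule.span K (W : Set V)) : Fintype.card ι ≤ W.card := by
  have := linearIndependent_le_span' v hv (W : Set V) (by
    rintro _ ⟨i, rfl⟩
    exact h i)
  simpa using this

end Homogeneous

/-! ### Orbit sums as a linear basis of the invariants -/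

section OrbitSums
open Multigraph
variable {K : Type*} [Field K] {n : ℕ}

theorem coeff_orbitSum (g h : Multigraph n) :
    coeff h (orbitSum K g) = if h ∈ g.orbit then 1 else 0 := by
  simp [orbitSum, coeff_sum, coeff_monomial]

theorem orbitSum_congr {g h : Multigraph n} (hgh : g.orbit = h.orbit) :
    orbitSum K g = orbitSum K h := by
  rw [orbitSum, orbitSum, hgh]

theorem orbitSum_isHomogeneous (g : Multigraph n) :
    (orbitSum K g).IsHomogeneous (∑ e, g e) := by
  refine IsHomogeneous.sum _ _ _ fun h hh => isHomogeneous_monomial _ ?_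
  obtain ⟨σ, rfl⟩ := mem_orbit.1 hh
  rw [Finsupp.degree_eq_sum, sum_relabel]

theorem orbitSum_zero : orbitSum K (0 : Multigraph n) = 1 := by
  have h : (0 : Multigraph n).orbit = {0} := by
    ext g
    simp [mem_orbit, relabel, eq_comm]
  rw [orbitSum, h, sum_singleton]
  rfl

theorem coeff_relabel (p : Inv K n) (σ : Equiv.Perm (Fin n)) (g : Multigraph n) :
    coeff (g.relabel σ) p.1 = coeff g p.1 := by
  conv_lhs => rw [← p.2 σ]
  exact coeff_rename_mapDomain _ (edgePerm σ).injective _ _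

/-- An invariant is a linear combination of the orbit sums of its monomials. -/
theorem mem_of_exps_mem {V : Submodule K (Inv K n)} (p : Inv K n)
    (h : ∀ g ∈ p.1.support, exps K g ∈ V) : p ∈ V := by
  induction hc : #p.1.support using Nat.strong_induction_on generalizing p with
  | _ c ih =>
    subst hc
    by_cases hp : p.1 = 0
    · rw [show p = 0 from Subtype.ext hp]
      exact V.zero_mem
    · obtain ⟨g, hg⟩ := Finset.nonempty_of_ne_empty (mt support_eq_empty.1 hp)
      -- Subtracting the right multiple of one orbit sum clears a whole orbit from the support,
      -- since coefficients are constant on orbits.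
      have hcoeff : ∀ k, coeff k (p - coeff g p.1 • exps K g : Inv K n).1 =
          if k ∈ orbit g then 0 else coeff k p.1 := by
        intro k
        change coeff k (p.1 - coeff g p.1 • orbitSum K g) = _
        rw [coeff_sub, coeff_smul, coeff_orbitSum]
        split_ifs with hk
        · obtain ⟨σ, rfl⟩ := mem_orbit.1 hk
          rw [coeff_relabel, smul_eq_mul, mul_one, sub_self]
        · simp
      have hsub : (p - coeff g p.1 • exps K g : Inv K n).1.support ⊆ p.1.support.erase g := by
        intro k hk
        rw [mem_support_iff, hcoeff] at hk
        rw [mem_erase, mem_support_iff]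
        split_ifs at hk with hk'
        · exact absurd rfl hk
        · exact ⟨fun h => hk' (h ▸ self_mem_orbit g), hk⟩
      have := ih _ ((card_le_card hsub).trans_lt (card_erase_lt_of_mem hg))
        (p - coeff g p.1 • exps K g) (fun k hk => h k (mem_of_mem_erase (hsub hk))) rfl
      rw [← sub_add_cancel p (coeff g p.1 • exps K g)]
      exact V.add_mem this (V.smul_mem _ (h g hg))

/-- Distinct orbits are disjoint, so orbit sums have disjoint supports. -/
theorem linearIndependent_orbitSum (s : Finset (Multigraph n)) :
    LinearIndependent K fun O : {O // O ∈ s.image orbit} =>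
      ∑ h ∈ O.1, (monomial h 1 : MvPolynomial (Edge n) K) := by
  rw [Fintype.linearIndependent_iff]
  rintro c hc ⟨O, hO⟩
  obtain ⟨g, hg, rfl⟩ := mem_image.1 hO
  have h := congrArg (coeff g) hc
  rw [coeff_sum, sum_eq_single_of_mem ⟨g.orbit, hO⟩ (mem_univ _), coeff_zero, coeff_smul] at h
  · rw [show coeff g (∑ h ∈ g.orbit, (monomial h 1 : MvPolynomial (Edge n) K)) = _ from
      coeff_orbitSum g g, if_pos (self_mem_orbit g)] at h
    simpa using h
  · rintro ⟨O', hO'⟩ _ hne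
    obtain ⟨g', hg', rfl⟩ := mem_image.1 hO'
    rw [coeff_smul, show coeff g (∑ h ∈ g'.orbit, (monomial h 1 : MvPolynomial (Edge n) K)) = _ from
      coeff_orbitSum g' g, if_neg, smul_zero]
    intro hgg
    obtain ⟨σ, rfl⟩ := mem_orbit.1 hgg
    exact hne (Subtype.ext (orbit_relabel σ g').symm)

end OrbitSums

/-! ### Reduction to connected generators and the dimension bound -/

section Products
open Multigraph
variable {K : Type*} [Field K] {n : ℕ}

theorem orbitSum_mul_orbitSum (a b : Multigraph n) : orbitSum K a * orbitSum K b =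
    ∑ x ∈ a.orbit ×ˢ b.orbit, monomial (x.1 + x.2) 1 := by
  rw [orbitSum, orbitSum, sum_mul_sum, ← sum_product']
  simp [monomial_mul]

theorem coeff_orbitSum_mul_orbitSum (a b g : Multigraph n) :
    coeff g (orbitSum K a * orbitSum K b) =
      (#{x ∈ a.orbit ×ˢ b.orbit | x.1 + x.2 = g} : K) := by
  rw [orbitSum_mul_orbitSum, coeff_sum]
  simp [coeff_monomial]

theorem embed_add (a b : Multigraph n) : (embed (a + b)).1 = (embed a).1 + (embed b).1 :=
  Finsupp.mapDomain_add

theorem cls_relabel (σ : Equiv.Perm (Fin n)) (g : Multigraph n) : cls (g.relabel σ) = cls g :=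
  cls_eq_iff.2 (orbit_relabel σ g)

theorem cls_of_mem_orbit {g h : Multigraph n} (hh : h ∈ g.orbit) : cls h = cls g := by
  obtain ⟨σ, rfl⟩ := mem_orbit.1 hh
  exact cls_relabel σ g

/-- A sum of two multigraphs either has a smaller order or is a disjoint union. -/
theorem order_add_lt_or (a b : Multigraph n) :
    GraphClass.order (cls (a + b)) < GraphClass.order (cls a) + GraphClass.order (cls b) ∨
      cls (a + b) = cls a + cls b := by
  by_cases h : Disjoint (verts (embed a).1) (verts (embed b).1)
  · right
    rw [cls, cls, cls, GraphClass.mk_add_mk h]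
    exact congrArg GraphClass.mk (Subtype.ext (embed_add a b))
  · left
    rw [cls, cls, cls, GraphClass.order_mk, GraphClass.order_mk, GraphClass.order_mk, embed_add,
      verts_add, ← card_union_add_card_inter, Nat.lt_add_right_iff_pos, card_pos]
    exact not_disjoint_iff_nonempty_inter.1 h

/-- The exponentials of the multigraphs with an irreducible class with less than `n` vertices. -/
def connectedExps (K : Type*) [Field K] (n : ℕ) : Set (Inv K n) :=
  {p | ∃ g : Multigraph n, IsIrred (cls g) ∧ GraphClass.order (cls g) < n ∧ p = exps K g}

/-- Induction on the number of non-isolated vertices. For a disconnected `g = a + b`, the product of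
the two exponentials involves `exp(g)` and otherwise only overlapping superpositions, which have
fewer vertices. -/
theorem exps_mem_adjoin_connectedExps [CharZero K] (g : Multigraph n)
    (hg : GraphClass.order (cls g) < n) : exps K g ∈ Algebra.adjoin K (connectedExps K n) := by
  induction hm : GraphClass.order (cls g) using Nat.strong_induction_on generalizing g with
  | _ m ih =>
    subst hm
    by_cases h0 : cls g = 0
    · have h0 : g = 0 := by
        rw [cls, GraphClass.mk_eq_zero] at h0
        exact Finsupp.mapDomain_injective edgeVal_injective (h0.trans Finsupp.mapDomain_zero.symm)
      rw [show exps K g = 1 from Subtype.ext (by rw [h0]; exact orbitSum_zero)]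
      exact one_mem _
    by_cases hirr : IsIrred (cls g)
    · exact Algebra.subset_adjoin ⟨g, hirr, hg, rfl⟩
    · rw [IsIrred] at hirr
      push Not at hirr
      obtain ⟨x, y, hxy, hx, hy⟩ := hirr h0
      obtain ⟨a, b, rfl, rfl, hd, hab⟩ := GraphClass.exists_add_of_mk_eq hxy
      have hv : verts a.1 ∪ verts b.1 ⊆ range n := by
        rw [← verts_add, ← hab]
        exact verts_embed_subset g
      obtain ⟨a, rfl⟩ := exists_embed_eq (union_subset_iff.1 hv).1
      obtain ⟨b, rfl⟩ := exists_embed_eq (union_subset_iff.1 hv).2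
      have hab : g = a + b := embed_injective (Subtype.ext (hab.trans (embed_add a b).symm))
      have hxy : cls g = cls a + cls b := hxy
      have ho : GraphClass.order (cls g) =
        GraphClass.order (cls a) + GraphClass.order (cls b) := by rw [hxy, map_add]
      have hx : 0 < GraphClass.order (cls a) := GraphClass.order_pos hx
      have hy : 0 < GraphClass.order (cls b) := GraphClass.order_pos hy
      have ha := ih _ (by omega) a (by omega) rfl
      have hb := ih _ (by omega) b (by omega) rfl
      let q : Inv K n := exps K a * exps K b
      have hq : q.1 = orbitSum K a * orbitSum K b := rfl
      -- The coefficient is a positive count of superpositions giving `g`; characteristic zero keeps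
      -- it invertible.
      have hc : coeff g q.1 ≠ 0 := by
        rw [hq, coeff_orbitSum_mul_orbitSum, Nat.cast_ne_zero, card_ne_zero]
        exact ⟨(a, b), mem_filter.2 ⟨mem_product.2 ⟨self_mem_orbit a, self_mem_orbit b⟩, hab.symm⟩⟩
      have hr : q - coeff g q.1 • exps K g ∈
          Subalgebra.toSubmodule (Algebra.adjoin K (connectedExps K n)) := by
        refine mem_of_exps_mem _ fun k hk => ?_
        have hk : coeff k (q.1 - coeff g q.1 • orbitSum K g) ≠ 0 := mem_support_iff.1 hk
        rw [coeff_sub, coeff_smul, coeff_orbitSum] at hk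
        have hkg : k ∉ g.orbit := by
          intro hkg
          rw [if_pos hkg] at hk
          obtain ⟨σ, rfl⟩ := mem_orbit.1 hkg
          rw [coeff_relabel] at hk
          simp at hk
        rw [if_neg hkg, smul_zero, sub_zero, hq, coeff_orbitSum_mul_orbitSum, Nat.cast_ne_zero,
          card_ne_zero] at hk
        obtain ⟨⟨a', b'⟩, hk⟩ := hk
        obtain ⟨hmem, rfl⟩ := mem_filter.1 hk
        obtain ⟨ha', hb'⟩ := mem_product.1 hmem
        -- A superposition without overlap has the class of `g` and so lies in its orbit, which has
        -- been subtracted.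
        have hlt := order_add_lt_or a' b'
        rw [cls_of_mem_orbit ha', cls_of_mem_orbit hb', ← hxy, ← ho] at hlt
        rcases hlt with hlt | heq
        · exact ih _ hlt _ (hlt.trans hg) rfl
        · exact absurd (cls_eq_iff.1 heq ▸ self_mem_orbit (a' + b')) hkg
      have hs : coeff g q.1 • exps K g ∈ Algebra.adjoin K (connectedExps K n) := by
        have := Subalgebra.sub_mem _ (mul_mem ha hb) hr
        rwa [show exps K a * exps K b = q from rfl, sub_sub_cancel] at this
      have := Subalgebra.smul_mem _ hs (coeff g q.1)⁻¹
      rwa [inv_smul_smul₀ hc] at this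

/-- A multigraph on `Fin n` in the given class, for classes with at most `n` vertices. -/
noncomputable def rep (n : ℕ) (x : GraphClass) : Multigraph n :=
  by classical exact if h : GraphClass.order x ≤ n then (exists_cls_eq h).choose else 0

theorem cls_rep {x : GraphClass} (h : GraphClass.order x ≤ n) : cls (rep n x) = x := by
  rw [rep, dif_pos h]
  exact (exists_cls_eq h).choose_spec

theorem mem_generatorMonomials {D j : ℕ} {f : smallIrr (n - 1) D → ℕ} :
    f ∈ generatorMonomials n D j ↔ ∑ x, f x * GraphClass.size x.1.1 = j := by
  classical
  have h := mem_invMult (X := smallIrr (n - 1) D) (τ := 1) (v := fun _ => 0)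
    (e := fun x => GraphClass.size x.1.1) (fun x => one_le_size x.1) (m := 0) (j := j) (f := f)
  rw [generatorMonomials]
  simpa using h

/-- If the multigraphs with an isolated vertex generate, then the orbits of each degree are at most
as many as the monomials of this degree in the irreducible classes with less than `n` vertices. -/
theorem orbitCount_le_card_generatorMonomials [CharZero K] (hn : 1 ≤ n) (d : ℕ)
    (h : Generates {p : Inv K n | ∃ g : Multigraph n, (∃ v, g.IsIsolated v) ∧ p = g.exps K}) :
    orbitCount n d ≤ #(generatorMonomials n d d) := by
  classical
  have htop : Algebra.adjoin K (connectedExps K n) = ⊤ := by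
    rw [eq_top_iff, ← h]
    refine Algebra.adjoin_le ?_
    rintro _ ⟨g, hg, rfl⟩
    exact exps_mem_adjoin_connectedExps g ((order_cls_lt_iff g).2 hg)
  let ι := {x : IrrClass // GraphClass.order x.1 < n}
  let y : ι → MvPolynomial (Edge n) K := fun i => orbitSum K (rep n i.1.1)
  let w : ι → ℕ := fun i => GraphClass.size i.1.1
  have hcls : ∀ i : ι, cls (rep n i.1.1) = i.1.1 := fun i => cls_rep i.2.le
  have hy : ∀ i, (y i).IsHomogeneous (w i) := by
    intro i
    have := orbitSum_isHomogeneous (K := K) (rep n i.1.1)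
    rwa [← size_cls, hcls] at this
  have hadj : ∀ p : Inv K n, p.1 ∈ Algebra.adjoin K (Set.range y) := by
    intro p
    have hp : p ∈ Algebra.adjoin K (connectedExps K n) := htop ▸ Algebra.mem_top
    have hp : p.1 ∈ (Algebra.adjoin K (connectedExps K n)).map (Inv K n).val := ⟨p, hp, rfl⟩
    rw [AlgHom.map_adjoin] at hp
    refine Algebra.adjoin_mono ?_ hp
    rintro _ ⟨_, ⟨g, hirr, hg, rfl⟩, rfl⟩
    exact ⟨⟨⟨cls g, hirr⟩, hg⟩, orbitSum_congr (cls_eq_iff.1 (hcls ⟨⟨cls g, hirr⟩, hg⟩))⟩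
  let X := smallIrr (n - 1) d
  have hX : ∀ x : X, GraphClass.order x.1.1 < n := fun x => by
    have := (mem_smallIrr.1 x.2).1
    omega
  let j : X → ι := fun x => ⟨x.1, hX x⟩
  let W : Finset (MvPolynomial (Edge n) K) :=
    (generatorMonomials n d d).image fun f => ∏ x : X, y (j x) ^ f x
  have hspan : ∀ p : Inv K n, p.1.IsHomogeneous d → p.1 ∈ Submodule.span K (W : Set _) := by
    intro p hp
    refine Submodule.span_mono ?_ (mem_span_of_mem_adjoin hy hp (hadj p))
    rintro _ ⟨f, hf, rfl⟩
    have hf : ∑ i ∈ f.support, f i * w i = d := hf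
    -- Generators with more than `d` edges cannot occur in a monomial of degree `d`, so only the
    -- finitely many in `smallIrr (n - 1) d` matter.
    have hle : ∀ i ∈ f.support, w i ≤ d := by
      intro i hi
      rw [← hf]
      refine le_trans ?_ (single_le_sum (f := fun i => f i * w i) (fun _ _ => Nat.zero_le _) hi)
      exact Nat.le_mul_of_pos_left _ (Nat.pos_of_ne_zero (Finsupp.mem_support_iff.1 hi))
    have hsurj : ∀ i ∈ f.support, ∃ x, j x = i := by
      intro i hi
      exact ⟨⟨i.1, mem_smallIrr.2 ⟨Nat.le_sub_one_of_lt i.2, hle i hi⟩⟩, rfl⟩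
    have hinj : Function.Injective j := fun x x' h =>
      Subtype.ext (congrArg (fun i : ι => i.1) h)
    have hsub : f.support ⊆ univ.image j := fun i hi => by
      obtain ⟨x, hx⟩ := hsurj i hi
      exact mem_image.2 ⟨x, mem_univ _, hx⟩
    refine mem_coe.2 (mem_image.2 ⟨fun x => f (j x), ?_, ?_⟩)
    · rw [mem_generatorMonomials]
      change ∑ x : X, f (j x) * w (j x) = d
      rw [← hf, sum_subset hsub, sum_image hinj.injOn]
      intro i _ hi
      rw [Finsupp.notMem_support_iff.1 hi, zero_mul]
    · change _ = ∏ i ∈ f.support, y i ^ f i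
      rw [prod_subset hsub, prod_image hinj.injOn]
      intro i _ hi
      rw [Finsupp.notMem_support_iff.1 hi, pow_zero]
  -- The orbit sums of degree `d` are independent and lie in the span of the monomials in `W`.
  have hcard := card_le_of_linearIndependent
    (linearIndependent_orbitSum (K := K) (multigraphsOfDegree n d)) W (by
      rintro ⟨O, hO⟩
      obtain ⟨g, hg, rfl⟩ := mem_image.1 hO
      have := orbitSum_isHomogeneous (K := K) g
      rw [mem_multigraphsOfDegree.1 hg] at this
      exact hspan (exps K g) this)
  rw [Fintype.card_coe] at hcard
  exact hcard.trans card_image_le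

theorem not_generates_isolated [CharZero K] (hn : 11 ≤ n) (hn' : n ≤ 18) :
    ¬ Generates {p : Inv K n | ∃ g : Multigraph n, (∃ v, g.IsIsolated v) ∧ p = g.exps K} :=
  fun h => (orbitCount_le_card_generatorMonomials (by omega) 24 h).not_gt
    (card_generatorMonomials_lt hn hn')

end Products
end GraphInvariants
namespace GraphInvariants
open Finset MvPolynomial

/-! ### Graphs supported on a path with five vertices -/

section Path
variable {n : ℕ}

/-- The inclusion of the pairs of the first five vertices. -/
def liftEdge (hn : 5 ≤ n) (e : Edge 5) : Edge n :=
  ⟨Sym2.map (Fin.castLE hn) e.1, by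
    rw [Sym2.isDiag_map (Fin.castLE_injective hn)]
    exact e.2⟩

theorem liftEdge_injective (hn : 5 ≤ n) : Function.Injective (liftEdge hn) := fun _ _ h =>
  Subtype.ext (Sym2.map.injective (Fin.castLE_injective hn) (congrArg Subtype.val h))

theorem exists_edgePerm_liftEdge (hn : 5 ≤ n) (τ : Equiv.Perm (Fin 5)) :
    ∃ σ : Equiv.Perm (Fin n), ∀ e, edgePerm σ (liftEdge hn e) = liftEdge hn (edgePerm τ e) := by
  refine ⟨τ.viaEmbedding (Fin.castLEEmb hn), ?_⟩
  rintro ⟨e, he⟩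
  induction e using Sym2.ind with
  | _ a b =>
    refine Subtype.ext ?_
    change s(τ.viaEmbedding (Fin.castLEEmb hn) (Fin.castLEEmb hn a),
      τ.viaEmbedding (Fin.castLEEmb hn) (Fin.castLEEmb hn b)) = _
    rw [Equiv.Perm.viaEmbedding_apply, Equiv.Perm.viaEmbedding_apply]
    rfl

/-- The `i`-th edge of the path on five vertices. -/
def pathEdge (i : Fin 4) : Edge 5 :=
  ⟨s(i.castSucc, i.succ), by
    rw [Sym2.mk_isDiag_iff]
    exact i.castSucc_lt_succ.ne⟩

theorem pathEdge_injective : Function.Injective pathEdge := by decide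

/-- The `i`-th edge of the path on the first five vertices of `Fin n`. -/
def longPathEdge (hn : 5 ≤ n) (i : Fin 4) : Edge n := liftEdge hn (pathEdge i)

theorem longPathEdge_injective (hn : 5 ≤ n) : Function.Injective (longPathEdge hn) :=
  (liftEdge_injective hn).comp pathEdge_injective

/-- The multigraph supported on the path with the given weights. -/
noncomputable def pathGraph (hn : 5 ≤ n) (f : Fin 4 → ℕ) : Multigraph n :=
  (Finsupp.equivFunOnFinite.symm f).mapDomain (longPathEdge hn)

theorem pathGraph_apply (hn : 5 ≤ n) (f : Fin 4 → ℕ) (i : Fin 4) :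
    pathGraph hn f (longPathEdge hn i) = f i :=
  Finsupp.mapDomain_apply (longPathEdge_injective hn) _ _

theorem pathGraph_apply_of_notMem (hn : 5 ≤ n) (f : Fin 4 → ℕ) {e : Edge n}
    (he : e ∉ Set.range (longPathEdge hn)) : pathGraph hn f e = 0 :=
  Finsupp.mapDomain_of_notMem_range _ _ he

theorem pathGraph_injective (hn : 5 ≤ n) : Function.Injective (pathGraph hn) := fun f g h =>
  funext fun i => by rw [← pathGraph_apply hn f, h, pathGraph_apply]

theorem prod_pathGraph (hn : 5 ≤ n) {A : Type*} [CommMonoid A] (y : Edge n → A) (f : Fin 4 → ℕ) :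
    ∏ e, y e ^ pathGraph hn f e = ∏ i, y (longPathEdge hn i) ^ f i := by
  have h : univ.image (longPathEdge hn) ⊆ univ := subset_univ _
  rw [← prod_subset h, prod_image (longPathEdge_injective hn).injOn]
  · exact prod_congr rfl fun i _ => by rw [pathGraph_apply]
  · intro e _ he
    rw [pathGraph_apply_of_notMem, pow_zero]
    rintro ⟨i, rfl⟩
    exact he (mem_image_of_mem _ (mem_univ i))

theorem pathGraph_eq_sum (hn : 5 ≤ n) (f : Fin 4 → ℕ) :
    pathGraph hn f = ∑ i, Finsupp.single (longPathEdge hn i) (f i) := by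
  rw [pathGraph, Finsupp.mapDomain, Finsupp.sum_fintype _ _ fun _ => Finsupp.single_zero _]
  rfl

/-- The permutation `τ` of the five path vertices need only send edges of nonzero weight to path
edges; it may move the other edges off the path. -/
theorem orbit_pathGraph_eq (hn : 5 ≤ n) (τ : Equiv.Perm (Fin 5)) (π : Equiv.Perm (Fin 4))
    {f g : Fin 4 → ℕ}
    (h : ∀ i, g (π i) = f i ∧ (f i = 0 ∨ edgePerm τ (pathEdge i) = pathEdge (π i))) :
    (pathGraph hn f).orbit = (pathGraph hn g).orbit := by
  obtain ⟨σ, hσ⟩ := exists_edgePerm_liftEdge hn τ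
  refine orbit_eq_iff.2 ⟨σ, ?_⟩
  rw [pathGraph_eq_sum, pathGraph_eq_sum, Multigraph.relabel, Finsupp.mapDomain_finsetSum,
    ← Equiv.sum_comp π fun i => Finsupp.single (longPathEdge hn i) (g i)]
  refine sum_congr rfl fun i _ => ?_
  rw [Finsupp.mapDomain_single, (h i).1]
  rcases (h i).2 with h0 | h0
  · rw [h0, Finsupp.single_zero, Finsupp.single_zero]
  · rw [longPathEdge, hσ, h0, longPathEdge]

/-- Two adjacent edges of weight different from zero. -/
def HasCherry (g : Multigraph n) : Prop :=
  ∃ e e' : Edge n, e ≠ e' ∧ (∃ v, v ∈ e.1 ∧ v ∈ e'.1) ∧ g e ≠ 0 ∧ g e' ≠ 0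

theorem HasCherry.relabel {g : Multigraph n} (h : HasCherry g) (σ : Equiv.Perm (Fin n)) :
    HasCherry (g.relabel σ) := by
  obtain ⟨e, e', hne, ⟨v, hv, hv'⟩, h, h'⟩ := h
  exact ⟨edgePerm σ e, edgePerm σ e', (edgePerm σ).injective.ne hne,
    ⟨σ v, Sym2.mem_map.2 ⟨v, hv, rfl⟩, Sym2.mem_map.2 ⟨v, hv', rfl⟩⟩,
    by rwa [relabel_apply], by rwa [relabel_apply]⟩

theorem mem_longPathEdge (hn : 5 ≤ n) {i : Fin 4} {v : Fin n} :
    v ∈ (longPathEdge hn i).1 ↔ (v : ℕ) = i ∨ (v : ℕ) = i + 1 := by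
  change v ∈ s(Fin.castLE hn i.castSucc, Fin.castLE hn i.succ) ↔ _
  rw [Sym2.mem_iff, Fin.ext_iff, Fin.ext_iff]
  rfl

theorem hasCherry_pathGraph_iff (hn : 5 ≤ n) (f : Fin 4 → ℕ) :
    HasCherry (pathGraph hn f) ↔ ∃ i : Fin 3, f i.castSucc ≠ 0 ∧ f i.succ ≠ 0 := by
  constructor
  · rintro ⟨e, e', hne, ⟨v, hv, hv'⟩, h, h'⟩
    obtain ⟨i, rfl⟩ : e ∈ Set.range (longPathEdge hn) := by
      by_contra he
      exact h (pathGraph_apply_of_notMem hn f he)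
    obtain ⟨j, rfl⟩ : e' ∈ Set.range (longPathEdge hn) := by
      by_contra he
      exact h' (pathGraph_apply_of_notMem hn f he)
    rw [pathGraph_apply] at h h'
    rw [mem_longPathEdge] at hv hv'
    have hij : (i : ℕ) ≠ j := fun hij => hne (congrArg _ (Fin.ext hij))
    rcases lt_or_gt_of_ne hij with hlt | hlt
    · refine ⟨⟨i, by omega⟩, h, ?_⟩
      rwa [show Fin.succ ⟨(i : ℕ), _⟩ = j from Fin.ext (by simp; omega)]
    · refine ⟨⟨j, by omega⟩, h', ?_⟩
      rwa [show Fin.succ ⟨(j : ℕ), _⟩ = i from Fin.ext (by simp; omega)]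
  · rintro ⟨i, h, h'⟩
    refine ⟨longPathEdge hn i.castSucc, longPathEdge hn i.succ,
      (longPathEdge_injective hn).ne i.castSucc_lt_succ.ne,
      ⟨Fin.castLE hn i.succ.castSucc, ?_, ?_⟩, by rwa [pathGraph_apply], by rwa [pathGraph_apply]⟩
    · rw [mem_longPathEdge]
      right
      rfl
    · rw [mem_longPathEdge]
      left
      rfl

end Path

/-! ### Squarefree invariants at special points of the path -/

section Evaluation
open Multigraph
variable {K : Type*} [Field K] {n : ℕ}

/-- The coefficient at the graph formed by the given edges of the path. -/
noncomputable def pathCoeff (hn : 5 ≤ n) (q : MvPolynomial (Edge n) K) (b : Bool × Bool × Bool × Bool) :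
    K :=
  coeff (pathGraph hn ![b.1.toNat, b.2.1.toNat, b.2.2.1.toNat, b.2.2.2.toNat]) q

/-- The evaluation of a squarefree polynomial at a point supported on the path. -/
theorem aeval_squarefree (hn : 5 ≤ n) {A : Type*} [CommRing A] [Algebra K A]
    (q : MvPolynomial (Edge n) K) (hq : ∀ d ∈ q.support, IsSimple d) (y : Edge n → A)
    (hy : ∀ e ∉ Set.range (longPathEdge hn), y e = 0) :
    aeval y q = ∑ b : Bool × Bool × Bool × Bool, pathCoeff hn q b •
      (y (longPathEdge hn 0) ^ b.1.toNat * y (longPathEdge hn 1) ^ b.2.1.toNat *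
        y (longPathEdge hn 2) ^ b.2.2.1.toNat * y (longPathEdge hn 3) ^ b.2.2.2.toNat) := by
  classical
  let M : Bool × Bool × Bool × Bool → Multigraph n := fun b =>
    pathGraph hn ![b.1.toNat, b.2.1.toNat, b.2.2.1.toNat, b.2.2.2.toNat]
  have hM : Function.Injective M := by
    intro b b' h
    have h := pathGraph_injective hn h
    clear * - h
    revert b b'
    decide
  have hF : ∀ b, coeff (M b) q • ∏ e, y e ^ M b e = pathCoeff hn q b •
      (y (longPathEdge hn 0) ^ b.1.toNat * y (longPathEdge hn 1) ^ b.2.1.toNat *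
        y (longPathEdge hn 2) ^ b.2.2.1.toNat * y (longPathEdge hn 3) ^ b.2.2.2.toNat) := by
    intro b
    rw [prod_pathGraph, Fin.prod_univ_four]
    rfl
  rw [aeval_def, eval₂_eq', ← sum_congr rfl fun b _ => hF b,
    ← sum_image (f := fun d => coeff d q • ∏ e, y e ^ d e) hM.injOn]
  -- A squarefree monomial using an edge off the path vanishes at `y`; the others are the sixteen
  -- subgraphs of the path.
  refine sum_congr_of_eq_on_inter ?_ ?_ ?_
  · intro d hd hd'
    by_contra h0
    refine hd' (mem_image.2 ⟨(decide (d (longPathEdge hn 0) = 1), decide (d (longPathEdge hn 1) = 1),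
      decide (d (longPathEdge hn 2) = 1), decide (d (longPathEdge hn 3) = 1)), mem_univ _, ?_⟩)
    have hs : ∀ e, (decide (d e = 1)).toNat = d e := by
      intro e
      rcases hq d hd e with h | h <;> simp [h]
    ext e
    by_cases he : e ∈ Set.range (longPathEdge hn)
    · obtain ⟨i, rfl⟩ := he
      simp only [M, hs, pathGraph_apply]
      fin_cases i <;> rfl
    · simp only [M, pathGraph_apply_of_notMem hn _ he]
      by_contra hde
      refine h0 ?_
      rw [prod_eq_zero (mem_univ e), mul_zero]
      rw [hy e he, zero_pow (Ne.symm hde)]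
  · intro d _ hd
    rw [notMem_support_iff.1 hd, zero_smul]
  · intro d _ _
    rw [Algebra.smul_def]

theorem pathCoeff_congr (hn : 5 ≤ n) (q : Inv K n) (τ : Equiv.Perm (Fin 5))
    (π : Equiv.Perm (Fin 4)) {b c : Bool × Bool × Bool × Bool}
    (h : ∀ i, ![c.1.toNat, c.2.1.toNat, c.2.2.1.toNat, c.2.2.2.toNat] (π i) =
      ![b.1.toNat, b.2.1.toNat, b.2.2.1.toNat, b.2.2.2.toNat] i ∧
      (![b.1.toNat, b.2.1.toNat, b.2.2.1.toNat, b.2.2.2.toNat] i = 0 ∨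
        edgePerm τ (pathEdge i) = pathEdge (π i))) :
    pathCoeff hn q.1 b = pathCoeff hn q.1 c := by
  obtain ⟨σ, hσ⟩ := orbit_eq_iff.1 (orbit_pathGraph_eq hn τ π h)
  rw [pathCoeff, pathCoeff, ← hσ, coeff_relabel]

theorem pathCoeff_one (hn : 5 ≤ n) (q : Inv K n) :
    pathCoeff hn q.1 (false, true, false, false) = pathCoeff hn q.1 (true, false, false, false) ∧
    pathCoeff hn q.1 (false, false, true, false) = pathCoeff hn q.1 (true, false, false, false) ∧
    pathCoeff hn q.1 (false, false, false, true) = pathCoeff hn q.1 (true, false, false, false) := by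
  have h1 := pathCoeff_congr hn q (finRotate 5) (finRotate 4) (b := (true, false, false, false))
    (c := (false, true, false, false)) (by decide)
  have h2 := pathCoeff_congr hn q (finRotate 5) (finRotate 4) (b := (false, true, false, false))
    (c := (false, false, true, false)) (by decide)
  have h3 := pathCoeff_congr hn q (finRotate 5) (finRotate 4) (b := (false, false, true, false))
    (c := (false, false, false, true)) (by decide)
  exact ⟨h1.symm, (h1.trans h2).symm, (h1.trans (h2.trans h3)).symm⟩

/-- Two edges of the path form either a cherry or a pair of disjoint edges, so the six coefficients
take only two values. Rotation handles the shifts along the path; the pair of end edges needs a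
separate permutation. -/
theorem pathCoeff_two (hn : 5 ≤ n) (q : Inv K n) :
    pathCoeff hn q.1 (false, true, true, false) = pathCoeff hn q.1 (true, true, false, false) ∧
    pathCoeff hn q.1 (false, false, true, true) = pathCoeff hn q.1 (true, true, false, false) ∧
    pathCoeff hn q.1 (false, true, false, true) = pathCoeff hn q.1 (true, false, true, false) ∧
    pathCoeff hn q.1 (true, false, false, true) = pathCoeff hn q.1 (true, false, true, false) := by
  have h1 := pathCoeff_congr hn q (finRotate 5) (finRotate 4) (b := (true, true, false, false))
    (c := (false, true, true, false)) (by decide)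
  have h2 := pathCoeff_congr hn q (finRotate 5) (finRotate 4) (b := (false, true, true, false))
    (c := (false, false, true, true)) (by decide)
  have h3 := pathCoeff_congr hn q (finRotate 5) (finRotate 4) (b := (true, false, true, false))
    (c := (false, true, false, true)) (by decide)
  have h4 := pathCoeff_congr hn q (Equiv.swap 2 3 * Equiv.swap 3 4) (Equiv.swap 2 3)
    (b := (true, false, true, false)) (c := (true, false, false, true)) (by decide)
  exact ⟨h1.symm, (h1.trans h2).symm, h3.symm, h4.symm⟩

/-- The point of `K ^ Edge n` with the given coordinates on the path. -/
noncomputable def pathPoint (hn : 5 ≤ n) (t : Fin 4 → K) : Edge n → K :=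
  Function.extend (longPathEdge hn) t 0

theorem pathPoint_apply (hn : 5 ≤ n) (t : Fin 4 → K) (i : Fin 4) :
    pathPoint hn t (longPathEdge hn i) = t i :=
  (longPathEdge_injective hn).extend_apply _ _ _

theorem pathPoint_apply_of_notMem (hn : 5 ≤ n) (t : Fin 4 → K) {e : Edge n}
    (he : e ∉ Set.range (longPathEdge hn)) : pathPoint hn t e = 0 :=
  Function.extend_apply' _ _ _ he

/-- The variable `Z` is left free because it is later taken to be `X` and, for polynomials in
squared variables, `X ^ 2`. -/
theorem aeval_pathPoint (hn : 5 ≤ n) (q : Inv K n) (hq : ∀ d ∈ q.1.support, IsSimple d)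
    (t : Fin 4 → K) (Z : Polynomial K) :
    aeval (fun e => Polynomial.C (pathPoint hn t e) * Z) q.1 =
      Polynomial.C (pathCoeff hn q.1 (false, false, false, false)) +
      Polynomial.C (pathCoeff hn q.1 (true, false, false, false) * (t 0 + t 1 + t 2 + t 3)) * Z +
      Polynomial.C (pathCoeff hn q.1 (true, true, false, false) *
          (t 0 * t 1 + t 1 * t 2 + t 2 * t 3) +
        pathCoeff hn q.1 (true, false, true, false) *
          (t 0 * t 2 + t 1 * t 3 + t 0 * t 3)) * Z ^ 2 +
      Polynomial.C (pathCoeff hn q.1 (true, true, true, false) * (t 0 * t 1 * t 2) +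
        pathCoeff hn q.1 (true, true, false, true) * (t 0 * t 1 * t 3) +
        pathCoeff hn q.1 (true, false, true, true) * (t 0 * t 2 * t 3) +
        pathCoeff hn q.1 (false, true, true, true) * (t 1 * t 2 * t 3)) * Z ^ 3 +
      Polynomial.C (pathCoeff hn q.1 (true, true, true, true) *
        (t 0 * t 1 * t 2 * t 3)) * Z ^ 4 := by
  obtain ⟨a1, a2, a3⟩ := pathCoeff_one hn q
  obtain ⟨b1, b2, b3, b4⟩ := pathCoeff_two hn q
  rw [aeval_squarefree hn q.1 hq _ fun e he => by
    rw [pathPoint_apply_of_notMem hn t he, map_zero, zero_mul]]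
  simp only [pathPoint_apply, Fintype.sum_prod_type, Fintype.sum_bool, Bool.toNat_true,
    Bool.toNat_false, pow_zero, pow_one, mul_one, one_mul, a1, a2, a3, b1, b2, b3, b4,
    Polynomial.smul_eq_C_mul, map_add, map_mul]
  ring

/-- The restriction of polynomials to the line through the origin and a point of the path. -/
noncomputable def lineEval (hn : 5 ≤ n) (t : Fin 4 → K) :
    MvPolynomial (Edge n) K →ₐ[K] Polynomial K :=
  aeval fun e => Polynomial.C (pathPoint hn t e) * Polynomial.X

/-- The points of the path at which the invariants of degree one vanish and the invariants of
degree two are proportional to `t₀ t₂ + t₁ t₃ + t₀ t₃`. -/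
def IsSpecial (t : Fin 4 → K) : Prop :=
  t 0 + t 1 + t 2 + t 3 = 0 ∧ t 0 * t 1 + t 1 * t 2 + t 2 * t 3 = 0

/-- The polynomials whose components of degree `0`, `1`, `2` and `4` at special points are those of
polynomials in squarefree invariants. -/
noncomputable def specialSubalgebra (K : Type*) [Field K] (hn : 5 ≤ n) :
    Subalgebra K (MvPolynomial (Edge n) K) where
  carrier := {p | ∃ c α β γ : K, ∀ t, IsSpecial t →
    (lineEval hn t p).coeff 0 = c ∧ (lineEval hn t p).coeff 1 = 0 ∧
    (lineEval hn t p).coeff 2 = α * (t 0 * t 2 + t 1 * t 3 + t 0 * t 3) ∧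
    (lineEval hn t p).coeff 4 = β * (t 0 * t 2 + t 1 * t 3 + t 0 * t 3) ^ 2 +
      γ * (t 0 * t 1 * t 2 * t 3)}
  mul_mem' := by
    rintro p q ⟨c, α, β, γ, hp⟩ ⟨c', α', β', γ', hq⟩
    -- Degree three need not be controlled: it enters degree four only multiplied by a degree-one
    -- coefficient, which is zero.
    refine ⟨c * c', c * α' + α * c', c * β' + α * α' + β * c', c * γ' + γ * c', fun t ht => ?_⟩
    obtain ⟨p0, p1, p2, p4⟩ := hp t ht
    obtain ⟨q0, q1, q2, q4⟩ := hq t ht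
    simp only [map_mul, Polynomial.coeff_mul, Finset.Nat.sum_antidiagonal_eq_sum_range_succ_mk,
      sum_range_succ, range_zero, sum_empty, Nat.reduceSub, p0, p1, p2, p4, q0, q1, q2, q4]
    refine ⟨?_, ?_, ?_, ?_⟩ <;> ring
  add_mem' := by
    rintro p q ⟨c, α, β, γ, hp⟩ ⟨c', α', β', γ', hq⟩
    refine ⟨c + c', α + α', β + β', γ + γ', fun t ht => ?_⟩
    obtain ⟨p0, p1, p2, p4⟩ := hp t ht
    obtain ⟨q0, q1, q2, q4⟩ := hq t ht
    simp only [map_add, Polynomial.coeff_add, p0, p1, p2, p4, q0, q1, q2, q4]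
    exact ⟨trivial, add_zero 0, by ring, by ring⟩
  algebraMap_mem' := by
    intro r
    refine ⟨r, 0, 0, 0, fun t _ => ?_⟩
    rw [AlgHom.commutes, Polynomial.algebraMap_eq]
    simp [Polynomial.coeff_C]

theorem mem_specialSubalgebra (hn : 5 ≤ n) (q : Inv K n) (hq : ∀ d ∈ q.1.support, IsSimple d) :
    q.1 ∈ specialSubalgebra K hn := by
  refine ⟨pathCoeff hn q.1 (false, false, false, false), pathCoeff hn q.1 (true, false, true, false),
    0, pathCoeff hn q.1 (true, true, true, true), fun t ht => ?_⟩
  obtain ⟨h1, h2⟩ := ht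
  rw [lineEval, aeval_pathPoint hn q hq, h1, h2]
  simp [Polynomial.coeff_C, Polynomial.coeff_X_pow, -map_mul, -map_add]

theorem orbitSum_support_isSimple {g : Multigraph n} (hg : g.IsSimple) :
    ∀ d ∈ (orbitSum K g).support, IsSimple d := by
  intro d hd
  rw [mem_support_iff, coeff_orbitSum] at hd
  obtain ⟨σ, rfl⟩ := mem_orbit.1 (by_contra fun h => hd (if_neg h))
  intro e
  obtain ⟨e, rfl⟩ := (edgePerm σ).surjective e
  rw [relabel_apply]
  exact hg e

theorem expand_mem_inv (q : Inv K n) (k : ℕ) : expand k q.1 ∈ Inv K n := by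
  intro σ
  rw [rename_expand, q.2 σ]

theorem lineEval_expand (hn : 5 ≤ n) (q : MvPolynomial (Edge n) K) (t : Fin 4 → K) :
    lineEval hn t (expand 2 q) =
      aeval (fun e => Polynomial.C (pathPoint hn (fun i => t i ^ 2) e) * Polynomial.X ^ 2) q := by
  have h : (lineEval hn t).comp (expand 2) =
      aeval fun e => Polynomial.C (pathPoint hn (fun i => t i ^ 2) e) * Polynomial.X ^ 2 := by
    refine algHom_ext fun e => ?_
    rw [AlgHom.comp_apply, expand_X, map_pow, lineEval, aeval_X, aeval_X, mul_pow, ← map_pow]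
    by_cases he : e ∈ Set.range (longPathEdge hn)
    · obtain ⟨i, rfl⟩ := he
      rw [pathPoint_apply, pathPoint_apply]
    · rw [pathPoint_apply_of_notMem hn _ he, pathPoint_apply_of_notMem hn _ he, zero_pow two_ne_zero]
  exact DFunLike.congr_fun h q

/-- Substituting squares into the orbit sum of a cherry gives the orbit sum of the doubled cherry,
whose degree-four part at a special point escapes the two-parameter family of the subalgebra. -/
theorem expand_notMem_specialSubalgebra [CharZero K] (hn : 5 ≤ n) :
    expand 2 (orbitSum K (pathGraph hn ![1, 1, 0, 0])) ∉ specialSubalgebra K hn := by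
  rintro ⟨c, α, β, γ, h⟩
  have hsimple : IsSimple (pathGraph hn ![1, 1, 0, 0]) := by
    intro e
    by_cases he : e ∈ Set.range (longPathEdge hn)
    · obtain ⟨i, rfl⟩ := he
      rw [pathGraph_apply]
      fin_cases i <;> simp
    · exact Or.inl (pathGraph_apply_of_notMem hn _ he)
  have h1 : pathCoeff hn (orbitSum K (pathGraph hn ![1, 1, 0, 0])) (true, true, false, false) = 1 := by
    rw [pathCoeff, coeff_orbitSum]
    exact if_pos (self_mem_orbit _)
  -- Two disjoint edges are not isomorphic to a cherry; `HasCherry` is the invariant that separates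
  -- them.
  have h2 : pathCoeff hn (orbitSum K (pathGraph hn ![1, 1, 0, 0])) (true, false, true, false) = 0 := by
    rw [pathCoeff, coeff_orbitSum]
    refine if_neg fun hmem => ?_
    obtain ⟨σ, hσ⟩ := mem_orbit.1 hmem
    have hc : HasCherry (pathGraph hn ![1, 1, 0, 0]) :=
      (hasCherry_pathGraph_iff hn _).2 ⟨0, by decide, by decide⟩
    have hc := hc.relabel σ
    rw [hσ, hasCherry_pathGraph_iff] at hc
    revert hc
    decide
  have key : ∀ t : Fin 4 → K, IsSpecial t →
      t 0 ^ 2 * t 1 ^ 2 + t 1 ^ 2 * t 2 ^ 2 + t 2 ^ 2 * t 3 ^ 2 =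
      β * (t 0 * t 2 + t 1 * t 3 + t 0 * t 3) ^ 2 + γ * (t 0 * t 1 * t 2 * t 3) := by
    intro t ht
    rw [← (h t ht).2.2.2, lineEval_expand]
    have := aeval_pathPoint hn (exps K (pathGraph hn ![1, 1, 0, 0]))
      (orbitSum_support_isSimple hsimple) (fun i => t i ^ 2) (Polynomial.X ^ 2)
    simp only [exps] at this
    rw [this, h1, h2]
    simp [Polynomial.coeff_X_pow, ← pow_mul, -map_mul, -map_add, -map_pow]
  -- Three special points give three linear equations in `β` and `γ`: `24 = 121β - 8γ`, `504 = 3721β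
  -- - 108γ` and `24 = 25β + 4γ`.
  have k1 := key ![-4, 1, 2, 1] (by constructor <;> (simp; norm_num))
  have k2 := key ![-9, 2, 6, 1] (by constructor <;> (simp; norm_num))
  have k3 := key ![-1, -2, 2, 1] ⟨by simp, by simp; norm_num⟩
  simp at k1 k2 k3
  have : (119520 : K) = 0 := by
    -- The multipliers annihilate the columns of `β` and of `γ`; the left sides combine to 119520,
    -- which is nonzero in characteristic zero.
    linear_combination 4396 * k1 - 171 * k2 + 4175 * k3
  norm_num at this

theorem not_generates_isSimple [CharZero K] (hn : 5 ≤ n) :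
    ¬ Generates {p : Inv K n | ∃ g : Multigraph n, g.IsSimple ∧ p = g.exps K} := by
  intro h
  have hle : Algebra.adjoin K {p : Inv K n | ∃ g : Multigraph n, g.IsSimple ∧ p = g.exps K} ≤
      (specialSubalgebra K hn).comap (Inv K n).val := by
    refine Algebra.adjoin_le ?_
    rintro _ ⟨g, hg, rfl⟩
    exact mem_specialSubalgebra hn (exps K g) (orbitSum_support_isSimple hg)
  rw [show Algebra.adjoin K _ = ⊤ from h] at hle
  exact expand_notMem_specialSubalgebra hn
    (hle (x := ⟨_, expand_mem_inv (exps K (pathGraph hn ![1, 1, 0, 0])) 2⟩) Algebra.mem_top)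

end Evaluation
end GraphInvariants
theorem mainTheorem1 (K : Type*) [Field K] [CharZero K] :
    (∀ n : ℕ, 5 ≤ n →
      ¬ GraphInvariants.Generates
        {p : GraphInvariants.Inv K n |
          ∃ g : GraphInvariants.Multigraph n, g.IsSimple ∧ p = g.exps K}) ∧
    (∀ n : ℕ, 11 ≤ n → n ≤ 18 →
      ¬ GraphInvariants.Generates
        {p : GraphInvariants.Inv K n |
          ∃ g : GraphInvariants.Multigraph n, (∃ v, g.IsIsolated v) ∧ p = g.exps K}) :=
  ⟨fun _ hn => GraphInvariants.not_generates_isSimple hn,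
    fun _ hn hn' => GraphInvariants.not_generates_isolated hn hn'⟩
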